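/- **Notation.** For $\lambda\ge 1$ let $\mathbb T_\lambda=\mathbb R/2\pi\lambda\mathbb Z$, $\mathbb Z_\lambda=\{m/\lambda: m\in\mathbb Z\}$, $\langle x\rangle=(1+x^2)^{1/2}$, $\hat f(n)=\int_0^{2\pi\lambda}e^{-inx}f(x)\,dx$ for $n\in\mathbb Z_\lambda$, $\|f\|_{L^2_\lambda}^2=\int_0^{2\pi\lambda}|f|^2dx$, $\|f\|_{H^s_\lambda}^2=\frac1{2\pi\lambda}\sum_{n\in\mathbb Z_\lambda}\langle n\rangle^{2s}|\hat f(n)|^2$, and $$\mathcal N_n^\lambda=\{(n_1,n_2,n_3)\in\mathbb Z_\lambda^3:\ n_1+n_2+n_3=n,\ (n_1+n_2)(n_2+n_3)(n_3+n_1)\ne0\}.$$ Let $\beta\ge0$, $\gamma\in\mathbb R$, $\mu\in\{1,-1\}$. For a real-valued $u_0\in C^\infty(\mathbb T_\lambda)$ put $$p_\lambda(n)=n^5+\beta\lambda^{-2}n^3-\Big(\gamma+\frac{\mu}{2\pi\lambda}\|u_0\|_{L^2_\lambda}^2\Big)n-\frac{\mu n}{(2\pi\lambda)^2}|\hat u_0(n)|^2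 ,$$ and consider, for $t\in[0,1]$ and $n\in\mathbb Z_\lambda$, with $u(0)=u_0$, $$\partial_t\hat u(n)-ip_\lambda(n)\hat u(n)=-\frac{\mu i n}{(2\pi\lambda)^2}\big(|\hat u(n)|^2-|\hat u_0(n)|^2\big)\hat u(n)+\frac{\mu i}{3(2\pi\lambda)^2}\,n\sum_{\mathcal N_n^\lambda}\hat u(n_1)\hat u(n_2)\hat u(n_3).\tag{E}$$ Let $X^{s,b}_\lambda$ be the closure of the Schwartz functions on $\mathbb R\times\mathbb T_\lambda$ under $$\|f\|_{X^{s,b}_\lambda}^2=\frac1{2\pi\lambda}\sum_{n\in\mathbb Z_\lambda}\int_{\mathbb R}\langle n\rangle^{2s}\langle\tau-p_\lambda(n)\rangle^{2b}|\tilde f(\tau,n)|^2\,d\tau,\qquad \tilde f(\tau,n)=\frac1{2\pi}\int_{\mathbb R}\int_0^{2\pi\lambda}e^{-it\tau-inx}f(t,x)\,dx\,dt .$$ **Proposition.** Given $\beta$ and $\mu$ there is $\rho>0$, and for every $0\le s<\frac12$ there is $C>0$, such that the following holds for all $\gamma\in\mathbb R$, all $\lambda\ge1$ and all real-valued $u_0\in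 C^\infty(\mathbb T_\lambda)$ with $\|u_0\|_{L^2_\lambda}\le\rho$. Let $u:\mathbb R\times\mathbb T_\lambda\to\mathbb R$ belong to $X^{s,1/2}_\lambda$ and be, on the time interval $[0,1]$, a smooth solution of (E). Then for every $t\in[0,1]$ $$\sup_{n\in\mathbb Z_\lambda}\Big|\frac1{\lambda^4}\,\mathrm{Im}\Big[\int_0^t n^2\sum_{\mathcal N_n^\lambda}\hat u(t',n_1)\hat u(t',n_2)\hat u(t',n_3)\hat u(t',-n)\,dt'\Big]\Big|\le C\,\mathcal B,$$ where $$\mathcal B=\lambda^{-1}\log\lambda\Big(\|u_0\|_{H^s_\lambda}^4+\big(\|u_0\|_{H^s_\lambda}^2+\lambda^{\frac12+2s}\|u\|_{X^{s,1/2}_\lambda}^4\big)^2\Big)+\lambda^{-\frac12}\|u\|_{X^{s,1/2}_\lambda}^4+\lambda^{-\frac32}\|u\|_{X^{s,1/2}_\lambda}^6 ,$$ and $\log\lambda$ is replaced by $1$ when $\lambda=1$; the sums over $\mathcal N_n^\lambda$ converge absolutely and the time integral exists. Consequently also $$\frac1{\lambda^2}\sup_{n\in\mathbb Z_\lambda}|n|\,\big||\hat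 u(t,n)|^2-|\hat u_0(n)|^2\big|\le C\,\mathcal B .$$ -/

import Mathlib

open MeasureTheory
open scoped ContDiff FourierTransform ENNReal

noncomputable section

namespace Kawahara

/-- The frequency `n = k / L` in `ℤ_L = {k / L : k ∈ ℤ}` (`L` is the period parameter `λ`). -/
def freq (L : ℝ) (k : ℤ) : ℝ := (k : ℝ) / L

/-- The Japanese bracket `⟨x⟩ = (1 + x²)^{1/2}`. -/
def bracket (x : ℝ) : ℝ := Real.sqrt (1 + x ^ 2)

/-- Functions on `𝕋_L = ℝ / 2πLℤ` are functions on `ℝ` of period `2πL`. This is the Fourier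
coefficient `∫_0^{2πL} e^{-inx} f(x) dx` at `n = k / L`. -/
def fourierCoeffT (L : ℝ) (f : ℝ → ℂ) (k : ℤ) : ℂ :=
  ∫ x in (0 : ℝ)..(2 * Real.pi * L), Complex.exp (-(Complex.I * (freq L k : ℂ) * (x : ℂ))) * f x

/-- Fourier coefficient of a real-valued function. -/
def hatR (L : ℝ) (f : ℝ → ℝ) (k : ℤ) : ℂ := fourierCoeffT L (fun x => (f x : ℂ)) k

/-- `‖f‖_{L²(𝕋_L)}`. -/
def normL2 (L : ℝ) (f : ℝ → ℝ) : ℝ :=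
  Real.sqrt (∫ x in (0 : ℝ)..(2 * Real.pi * L), (f x) ^ 2)

/-- `‖f‖_{H^s(𝕋_L)} = ((2πL)⁻¹ ∑_{n ∈ ℤ_L} ⟨n⟩^{2s} |f̂(n)|²)^{1/2}`. -/
def normHs (L s : ℝ) (f : ℝ → ℝ) : ℝ :=
  Real.sqrt (1 / (2 * Real.pi * L) *
    ∑' k : ℤ, bracket (freq L k) ^ (2 * s) * ‖hatR L f k‖ ^ 2)

/-- The dispersion relation `p_L(n)` at `n = k / L`, with data `u₀`:
`n⁵ + β L⁻² n³ - (γ + μ/(2πL) ‖u₀‖²_{L²}) n - μ n/(2πL)² |û₀(n)|²`. -/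
def dispersion (β γ μ L : ℝ) (u₀ : ℝ → ℝ) (k : ℤ) : ℝ :=
  freq L k ^ 5 + β * (L ^ 2)⁻¹ * freq L k ^ 3
    - (γ + μ / (2 * Real.pi * L) * normL2 L u₀ ^ 2) * freq L k
    - μ * freq L k / (2 * Real.pi * L) ^ 2 * ‖hatR L u₀ k‖ ^ 2

/-- The non-resonant set `𝒩_n^L` for `n = k / L`; the triple `(n₁, n₂, n₃)` of frequencies is
recorded by the integers `(L n₁, L n₂, L n₃)`. -/
def nonRes (k : ℤ) : Set (ℤ × ℤ × ℤ) :=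
  {m | m.1 + m.2.1 + m.2.2 = k ∧ (m.1 + m.2.1) * (m.2.1 + m.2.2) * (m.2.2 + m.1) ≠ 0}

/-- The product `û(n₁) û(n₂) û(n₃)` for a function `f = u(t, ·)`. -/
def tripleProd (L : ℝ) (f : ℝ → ℝ) (m : ℤ × ℤ × ℤ) : ℂ :=
  hatR L f m.1 * hatR L f m.2.1 * hatR L f m.2.2

/-- The non-resonant cubic sum `∑_{𝒩_n^L} û(n₁) û(n₂) û(n₃)`. -/
def cubicSum (L : ℝ) (f : ℝ → ℝ) (k : ℤ) : ℂ := ∑' m : nonRes k, tripleProd L f m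

/-- `u : [0,1] × 𝕋_L → ℝ` is a smooth solution of
`∂ₜ û(n) - i p_L(n) û(n) = - μ i n/(2πL)² (|û(n)|² - |û₀(n)|²) û(n)
  + μ i/(3(2πL)²) n ∑_{𝒩_n^L} û(n₁) û(n₂) û(n₃)`
on the time interval `[0,1]` with initial datum `u₀` (the values of `u` at the other times play no
role here). -/
structure IsSmoothSolution (β γ μ L : ℝ) (u₀ : ℝ → ℝ) (u : ℝ → ℝ → ℝ) : Prop where
  smooth : ContDiffOn ℝ ∞ (fun q : ℝ × ℝ => u q.1 q.2) (Set.Icc (0 : ℝ) 1 ×ˢ Set.univ)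
  init : u 0 = u₀
  eqn : ∀ t ∈ Set.Icc (0 : ℝ) 1, ∀ k : ℤ,
    HasDerivWithinAt (fun τ : ℝ => hatR L (u τ) k)
      (Complex.I * (dispersion β γ μ L u₀ k : ℂ) * hatR L (u t) k
        - (μ : ℂ) * Complex.I * (freq L k : ℂ) / ((2 * Real.pi * L : ℝ) : ℂ) ^ 2
            * ((‖hatR L (u t) k‖ ^ 2 - ‖hatR L u₀ k‖ ^ 2 : ℝ) : ℂ) * hatR L (u t) k
        + (μ : ℂ) * Complex.I / (3 * ((2 * Real.pi * L : ℝ) : ℂ) ^ 2)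
            * (freq L k : ℂ) * cubicSum L (u t) k)
      (Set.Icc (0 : ℝ) 1) t

open Classical in
/-- The Fourier transform `𝓕 g(ξ) = ∫ e^{-2πitξ} g(t) dt` of a square integrable function on the
line, in the sense of Plancherel (used only for `g ∈ L²`; value `0` otherwise). -/
def fourierL2 (g : ℝ → ℂ) : ℝ → ℂ :=
  if h : MemLp g 2 volume then
    (((𝓕 (h.toLp g : Lp (α := ℝ) ℂ 2)) : Lp (α := ℝ) ℂ 2) : ℝ → ℂ)
  else 0

/-- The space-time Fourier transform
`ũ(τ, n) = (2π)⁻¹ ∫_ℝ ∫_0^{2πL} e^{-itτ} e^{-inx} u(t,x) dx dt` at `n = k / L`. -/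
def spaceTimeFourier (L : ℝ) (u : ℝ → ℝ → ℂ) (τ : ℝ) (k : ℤ) : ℂ :=
  (1 / (2 * Real.pi) : ℝ) * fourierL2 (fun t => fourierCoeffT L (u t) k) (τ / (2 * Real.pi))

/-- The norm of `X_L^{s,b}` attached to a dispersion relation `p`:
`((2πL)⁻¹ ∑_{n ∈ ℤ_L} ∫_ℝ ⟨n⟩^{2s} ⟨τ - p(n)⟩^{2b} |ũ(τ,n)|² dτ)^{1/2}`, possibly infinite. -/
def normX (L : ℝ) (p : ℤ → ℝ) (s b : ℝ) (u : ℝ → ℝ → ℂ) : ℝ≥0∞ :=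
  (ENNReal.ofReal (1 / (2 * Real.pi * L)) *
    ∑' k : ℤ, ∫⁻ τ : ℝ,
      ENNReal.ofReal (bracket (freq L k) ^ (2 * s) * bracket (τ - p k) ^ (2 * b))
        * ‖spaceTimeFourier L u τ k‖ₑ ^ 2) ^ (1 / 2 : ℝ)

/-- Schwartz functions on `ℝ × 𝕋_L`. -/
structure IsSchwartz (L : ℝ) (φ : ℝ → ℝ → ℂ) : Prop where
  smooth : ContDiff ℝ ∞ (fun q : ℝ × ℝ => φ q.1 q.2)
  periodic : ∀ t, Function.Periodic (φ t) (2 * Real.pi * L)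
  decay : ∀ j m : ℕ, ∃ C : ℝ, ∀ t x : ℝ,
    |t| ^ j * ‖iteratedFDeriv ℝ m (fun q : ℝ × ℝ => φ q.1 q.2) (t, x)‖ ≤ C

/-- Membership in `X_L^{s,b}`, the closure of the Schwartz functions under `normX`, for
`s, b ≥ 0`; in that range the norm dominates a multiple of the norm of `L²(ℝ × 𝕋_L)`, so that the
closure consists of elements of `L²(ℝ × 𝕋_L)`. -/
structure MemX (L : ℝ) (p : ℤ → ℝ) (s b : ℝ) (u : ℝ → ℝ → ℂ) : Prop where
  periodic : ∀ t, Function.Periodic (u t) (2 * Real.pi * L)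
  sqIntegrable : MemLp (fun q : ℝ × ℝ => u q.1 q.2) 2
    ((volume : Measure (ℝ × ℝ)).restrict (Set.univ ×ˢ Set.Ioc 0 (2 * Real.pi * L)))
  finite : normX L p s b u < ⊤
  approx : ∀ ε : ℝ≥0∞, 0 < ε → ∃ φ : ℝ → ℝ → ℂ, IsSchwartz L φ ∧
    normX L p s b (fun t x => u t x - φ t x) < ε

/-- `log L`, replaced by `1` when `L = 1`. -/
def logFactor (L : ℝ) : ℝ := if L = 1 then 1 else Real.log L

/-- The bound
`L⁻¹ log L (A⁴ + (A² + L^{1/2+2s} B⁴)²) + L^{-1/2} B⁴ + L^{-3/2} B⁶`. -/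
def smoothingBound (L s A B : ℝ) : ℝ :=
  L⁻¹ * logFactor L * (A ^ 4 + (A ^ 2 + L ^ (1 / 2 + 2 * s) * B ^ 4) ^ 2)
    + L ^ (-(1 / 2) : ℝ) * B ^ 4 + L ^ (-(3 / 2) : ℝ) * B ^ 6

end Kawahara

end

/-! Write `a` for the sequence of Fourier coefficients of `u(t)`, `M` for its squared `ℓ²` norm, and
consider frequencies with `n₁ + n₂ + n₃ + n₄ = 0`. Let `N = |n₁| + ⋯ + |n₄|` and let `x, y, z` be
the absolute values of the three pair sums. The proof is a normal form argument at the level of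
`L²`: one integration by parts in time, used with two different weights.

Resonance. For vanishing total frequency the fifth powers add up to `-(5/2)(n₁+n₂)(n₂+n₃)(n₃+n₁) ∑
nⱼ²`, the cubes add a term of the same sign because `β ≥ 0`, and the linear part of the phase
cancels. The term with `|û₀(n)|²` is a perturbation of size at most `N/(24L)` when `‖u₀‖ ≤ 1/2`, and
it is absorbed because `x, y, z ≥ 1/L`. Thus the sum `H` of the four phases satisfies `1 + xyzN² ≤
8|iH - 1|` (`resWeight_le`).

Integration by parts. A product `Q` of four coefficients satisfies `Q' = iHQ + R`, where `R` has one
factor replaced by the forcing. Hence `∫ Q` is bounded by boundary terms and nonlinear terms divided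
by `1 + xyzN²` (`Flow.norm_integral_quad_le`). Since `N ≤ 6 max(x, y, z)`, this divisor gives decay
in two pair sums, and Cauchy–Schwarz sums the result using only `M`.

Closing the estimate. The forcing at frequency `n` is at most `|n| L⁻² M^{1/2} ‖a * a‖`, and `‖a *
a‖` is an `L⁴` quantity which `M` does not control at a fixed time. But `‖a * a‖²` is itself a
quadrilinear form, so the normal form with weight `1` bounds its time integral by `M² L^{4/3}` plus
a multiple of `M² ∫ ‖a * a‖`, and the latter is absorbed (`Flow.exists_integral_quartic_le`). The
normal form with weight `n²` then gives the bound `C M²(L^{4/3} + M²)`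
(`Flow.exists_norm_integral_cubic_le`).

Conclusion. `M` is conserved, is at most `πL/2` by the smallness of the data, and is at most `4π² L
‖u‖²` in the `X^{s,1/2}` norm, which dominates the `L²` norm (`mass_le_normX`). Inserting this gives
the stated bound (`le_smoothingBound`); the pointwise consequence follows from `energy_identity`. -/

namespace Kawahara

/-! ### Elementary inequalities for the quotients by `1 + xyzN²`. -/

section WeightInequalities

/-- The symmetric weight `∑ (xy)^{-2/3}` over the pairs from `x, y, z`. -/
noncomputable def pairWeight (x y z : ℝ) : ℝ :=
  x ^ (-(2 / 3) : ℝ) * y ^ (-(2 / 3) : ℝ) + y ^ (-(2 / 3) : ℝ) * z ^ (-(2 / 3) : ℝ)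
    + z ^ (-(2 / 3) : ℝ) * x ^ (-(2 / 3) : ℝ)

variable {x y z N : ℝ}

/-- Interpolation: the quotient is at most `N²` and, as `N ≤ 6z`, at most `6/(xyN)`. The geometric
mean with exponents `1/3` and `2/3` cancels `N`. The exponent `2/3` exceeds `1/2`, so the weight is
square summable over the integers, and it costs only `L^{4/3}` on the lattice of mesh `1/L`. -/
lemma sq_div_le_of_large (hx : 0 < x) (hy : 0 < y) (hN : 0 < N) (hz : N ≤ 6 * z) :
    N ^ 2 / (1 + x * y * z * N ^ 2) ≤ 4 * (x ^ (-(2 / 3) : ℝ) * y ^ (-(2 / 3) : ℝ)) := by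
  have hz0 : 0 < z := by linarith
  rw [← Real.mul_rpow hx.le hy.le]
  set P := (x * y) ^ (1 / 3 : ℝ) with hP
  have hP0 : 0 < P := by positivity
  have h3 : P ^ 3 = x * y := by
    rw [hP, ← Real.rpow_natCast, ← Real.rpow_mul (by positivity)]; norm_num
  have h2 : (x * y) ^ (-(2 / 3) : ℝ) = (P ^ 2)⁻¹ := by
    rw [Real.rpow_neg (by positivity), hP, ← Real.rpow_natCast, ← Real.rpow_mul (by positivity)]
    norm_num
  rw [h2, div_le_iff₀ (by positivity), ← h3]
  have h4 : P ^ 3 * N ^ 3 ≤ 6 * (P ^ 3 * z * N ^ 2) := by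
    have : P ^ 3 * N ^ 2 * N ≤ P ^ 3 * N ^ 2 * (6 * z) := by gcongr
    nlinarith
  -- For `PN ≤ 2` the constant suffices; beyond that `(PN)³ ≥ 2(PN)²`. The coefficient `2/3 = 4/6`
  -- matches the `6` in `h4`.
  have h5 : (P * N) ^ 2 ≤ 4 + 2 / 3 * (P * N) ^ 3 := by
    have hs : 0 < P * N := by positivity
    rcases le_total (P * N) 2 with h | h
    · nlinarith [pow_pos hs 3]
    · nlinarith [mul_le_mul_of_nonneg_left h (sq_nonneg (P * N))]
  have h6 : N ^ 2 * P ^ 2 ≤ 4 * (1 + P ^ 3 * z * N ^ 2) := by nlinarith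
  calc N ^ 2 = (N ^ 2 * P ^ 2) * (P ^ 2)⁻¹ := by field_simp
    _ ≤ 4 * (1 + P ^ 3 * z * N ^ 2) * (P ^ 2)⁻¹ := by gcongr
    _ = _ := by ring

lemma sq_div_le_pairWeight (hx : 0 < x) (hy : 0 < y) (hz : 0 < z) (hN : 0 < N)
    (h : N ≤ 6 * x ∨ N ≤ 6 * y ∨ N ≤ 6 * z) :
    N ^ 2 / (1 + x * y * z * N ^ 2) ≤ 4 * pairWeight x y z := by
  have a : 0 < x ^ (-(2 / 3) : ℝ) := by positivity
  have b : 0 < y ^ (-(2 / 3) : ℝ) := by positivity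
  have c : 0 < z ^ (-(2 / 3) : ℝ) := by positivity
  unfold pairWeight
  rcases h with h | h | h
  · have := sq_div_le_of_large hy hz hN h
    rw [show x * y * z = y * z * x by ring]
    nlinarith [mul_pos a b, mul_pos c a]
  · have := sq_div_le_of_large hz hx hN h
    rw [show x * y * z = z * x * y by ring]
    nlinarith [mul_pos a b, mul_pos b c]
  · have := sq_div_le_of_large hx hy hN h
    nlinarith [mul_pos b c, mul_pos c a]

/-- The additional factor `1/(1 + N)` provides decay in the fourth frequency, needed when three
frequencies are free. It comes from writing `N(1 + N) = N + N²`. -/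
lemma div_le_pairWeight (hx : 0 < x) (hy : 0 < y) (hz : 0 < z) (hN : 0 < N)
    (hxN : x ≤ N) (hyN : y ≤ N) (h : N ≤ 6 * x ∨ N ≤ 6 * y ∨ N ≤ 6 * z) :
    N / (1 + x * y * z * N ^ 2) ≤ 8 * pairWeight x y z / (1 + N) := by
  have a : 0 < x ^ (-(2 / 3) : ℝ) := by positivity
  have b : 0 < y ^ (-(2 / 3) : ℝ) := by positivity
  have c : 0 < z ^ (-(2 / 3) : ℝ) := by positivity
  have h1 := sq_div_le_pairWeight hx hy hz hN h
  have hD : 1 ≤ 1 + x * y * z * N ^ 2 := by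
    have : 0 < x * y * z * N ^ 2 := by positivity
    linarith
  have h2 : N / (1 + x * y * z * N ^ 2) ≤ 4 * pairWeight x y z := by
    rcases le_total N 1 with hN1 | hN1
    · have h3 : N / (1 + x * y * z * N ^ 2) ≤ 1 := by
        rw [div_le_one (by linarith)]; linarith
      have hx1 : 1 ≤ x ^ (-(2 / 3) : ℝ) :=
        Real.one_le_rpow_of_pos_of_le_one_of_nonpos hx (by linarith) (by norm_num)
      have hy1 : 1 ≤ y ^ (-(2 / 3) : ℝ) :=
        Real.one_le_rpow_of_pos_of_le_one_of_nonpos hy (by linarith) (by norm_num)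
      unfold pairWeight
      nlinarith [mul_pos b c, mul_pos c a]
    · refine le_trans ?_ h1
      gcongr
      nlinarith
  rw [le_div_iff₀ (by linarith)]
  calc N / (1 + x * y * z * N ^ 2) * (1 + N)
      = N / (1 + x * y * z * N ^ 2) + N ^ 2 / (1 + x * y * z * N ^ 2) := by ring
    _ ≤ _ := by linarith

/-- With exponent `1` the powers of `N` cancel without interpolation. The cube arises from the
weight `n²` together with the derivative in the forcing. -/
lemma cube_div_le_of_large (hx : 0 < x) (hy : 0 < y) (hN : 0 < N) (hz : N ≤ 6 * z) :
    N ^ 3 / (1 + x * y * z * N ^ 2) ≤ 6 * (x⁻¹ * y⁻¹) := by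
  have hz0 : 0 < z := by linarith
  rw [← mul_inv, div_le_iff₀ (by positivity)]
  have : x * y * N ^ 2 * N ≤ x * y * N ^ 2 * (6 * z) := by gcongr
  calc N ^ 3 = (x * y)⁻¹ * (x * y * N ^ 2 * N) := by field_simp
    _ ≤ (x * y)⁻¹ * (6 * (1 + x * y * z * N ^ 2)) :=
        mul_le_mul_of_nonneg_left (by linarith) (by positivity)
    _ = _ := by ring

lemma cube_div_le (hx : 0 < x) (hy : 0 < y) (hz : 0 < z) (hN : 0 < N)
    (h : N ≤ 6 * x ∨ N ≤ 6 * y ∨ N ≤ 6 * z) :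
    N ^ 3 / (1 + x * y * z * N ^ 2) ≤ 6 * (x⁻¹ * y⁻¹ + y⁻¹ * z⁻¹ + z⁻¹ * x⁻¹) := by
  have a : 0 < x⁻¹ := by positivity
  have b : 0 < y⁻¹ := by positivity
  have c : 0 < z⁻¹ := by positivity
  rcases h with h | h | h
  · have := cube_div_le_of_large hy hz hN h
    rw [show x * y * z = y * z * x by ring]
    nlinarith [mul_pos a b, mul_pos c a]
  · have := cube_div_le_of_large hz hx hN h
    rw [show x * y * z = z * x * y by ring]
    nlinarith [mul_pos a b, mul_pos b c]
  · have := cube_div_le_of_large hx hy hN h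
    nlinarith [mul_pos b c, mul_pos c a]

/-- When `x` is the smallest pair sum, `xvwN²` is at least `x⁵`, which is more than the square
needed for summability. -/
lemma one_div_le_of_small {v w : ℝ} (hx : 0 < x) (hv : x ≤ v) (hw : x ≤ w) (hN : x ≤ N) :
    1 / (1 + x * v * w * N ^ 2) ≤ 2 * (1 + x ^ 2)⁻¹ := by
  have hv0 : 0 < v := hx.trans_le hv
  have hw0 : 0 < w := hx.trans_le hw
  have h1 : x ^ 5 ≤ x * v * w * N ^ 2 := by
    calc x ^ 5 = x * x * x * x ^ 2 := by ring
      _ ≤ _ := by gcongr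
  have h2 : (1 + x ^ 2) ≤ 2 * (1 + x ^ 5) := by
    rcases le_total x 1 with h | h
    · nlinarith [pow_pos hx 5]
    · have : x ^ 2 ≤ x ^ 5 := pow_le_pow_right₀ h (by norm_num)
      nlinarith
  rw [← div_eq_mul_inv, div_le_div_iff₀ (by nlinarith [pow_pos hx 5]) (by positivity)]
  linarith

lemma one_div_le (hx : 0 < x) (hy : 0 < y) (hz : 0 < z)
    (hxN : x ≤ N) (hyN : y ≤ N) (hzN : z ≤ N) :
    1 / (1 + x * y * z * N ^ 2) ≤ 2 * ((1 + x ^ 2)⁻¹ + (1 + y ^ 2)⁻¹ + (1 + z ^ 2)⁻¹) := by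
  have a : 0 < (1 + x ^ 2)⁻¹ := by positivity
  have b : 0 < (1 + y ^ 2)⁻¹ := by positivity
  have c : 0 < (1 + z ^ 2)⁻¹ := by positivity
  have h : (x ≤ y ∧ x ≤ z) ∨ (y ≤ z ∧ y ≤ x) ∨ (z ≤ x ∧ z ≤ y) := by
    by_contra! hcon
    obtain ⟨h1, h2, h3⟩ := hcon
    rcases le_total x y with h4 | h4
    · linarith [h1 h4, h3 ((h1 h4).le), h4]
    · rcases le_total y z with h5 | h5
      · linarith [h2 h5]
      · linarith [h3 (h5.trans h4)]
  rcases h with h | h | h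
  · have := one_div_le_of_small hx h.1 h.2 hxN
    linarith
  · have := one_div_le_of_small hy h.1 h.2 hyN
    rw [show x * y * z = y * z * x by ring]
    linarith
  · have := one_div_le_of_small hz h.1 h.2 hzN
    rw [show x * y * z = z * x * y by ring]
    linarith

end WeightInequalities

/-! ### Quadruples of frequencies and the resonance function. -/

/-- The fourth frequency, making the sum of the four equal to `0`. -/
def fourth (m : ℤ × ℤ × ℤ) : ℤ := -(m.1 + m.2.1 + m.2.2)

/-- The triples `m` for which `(m, fourth m)` is non-resonant. -/
def nonResAll : Set (ℤ × ℤ × ℤ) :=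
  {m | (m.1 + m.2.1) * (m.2.1 + m.2.2) * (m.2.2 + m.1) ≠ 0}

/-- `|n₁| + |n₂| + |n₃| + |n₄|`. -/
noncomputable def freqSize (L : ℝ) (m : ℤ × ℤ × ℤ) : ℝ :=
  |freq L m.1| + |freq L m.2.1| + |freq L m.2.2| + |freq L (fourth m)|

/-- `1 + |(n₁ + n₂)(n₂ + n₃)(n₃ + n₁)| (|n₁| + |n₂| + |n₃| + |n₄|)²`, a lower bound for the size of
the resonance function. -/
noncomputable def resWeight (L : ℝ) (m : ℤ × ℤ × ℤ) : ℝ :=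
  1 + |freq L (m.1 + m.2.1)| * |freq L (m.2.1 + m.2.2)| * |freq L (m.2.2 + m.1)|
    * freqSize L m ^ 2

lemma freq_add (L : ℝ) (j k : ℤ) : freq L (j + k) = freq L j + freq L k := by
  simp [freq, add_div]

lemma freq_neg (L : ℝ) (k : ℤ) : freq L (-k) = -freq L k := by
  simp [freq, neg_div]

lemma freq_fourth (L : ℝ) (m : ℤ × ℤ × ℤ) :
    freq L (fourth m) = -(freq L m.1 + freq L m.2.1 + freq L m.2.2) := by
  rw [fourth, freq_neg, freq_add, freq_add]

lemma one_le_resWeight (L : ℝ) (m : ℤ × ℤ × ℤ) : 1 ≤ resWeight L m := by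
  unfold resWeight
  have : 0 ≤ |freq L (m.1 + m.2.1)| * |freq L (m.2.1 + m.2.2)| * |freq L (m.2.2 + m.1)|
    * freqSize L m ^ 2 := by positivity
  linarith

lemma inv_le_abs_freq {L : ℝ} (hL : 1 ≤ L) {k : ℤ} (hk : k ≠ 0) : L⁻¹ ≤ |freq L k| := by
  have : (1 : ℝ) ≤ |(k : ℝ)| := by exact_mod_cast Int.one_le_abs hk
  rw [freq, abs_div, abs_of_pos (by linarith : 0 < L), inv_eq_one_div]
  gcongr

/-- The pair sums of a non-resonant triple are comparable with its size. -/
lemma pair_sum_bounds {L : ℝ} (hL : 1 ≤ L) {m : ℤ × ℤ × ℤ} (hm : m ∈ nonResAll) :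
    (0 < |freq L (m.1 + m.2.1)| ∧ 0 < |freq L (m.2.1 + m.2.2)| ∧ 0 < |freq L (m.2.2 + m.1)|) ∧
    (|freq L (m.1 + m.2.1)| ≤ freqSize L m ∧ |freq L (m.2.1 + m.2.2)| ≤ freqSize L m ∧
      |freq L (m.2.2 + m.1)| ≤ freqSize L m) ∧
    (freqSize L m ≤ 6 * |freq L (m.1 + m.2.1)| ∨ freqSize L m ≤ 6 * |freq L (m.2.1 + m.2.2)| ∨
      freqSize L m ≤ 6 * |freq L (m.2.2 + m.1)|) := by
  have hm' : (m.1 + m.2.1) * (m.2.1 + m.2.2) * (m.2.2 + m.1) ≠ 0 := hm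
  simp only [ne_eq, mul_eq_zero, not_or] at hm'
  have hi : 0 < L⁻¹ := by positivity
  refine ⟨⟨hi.trans_le (inv_le_abs_freq hL hm'.1.1), hi.trans_le (inv_le_abs_freq hL hm'.1.2),
    hi.trans_le (inv_le_abs_freq hL hm'.2)⟩, ?_, ?_⟩
  · simp only [freqSize, freq_add]
    have := abs_nonneg (freq L (fourth m))
    have := abs_nonneg (freq L m.1)
    have := abs_nonneg (freq L m.2.1)
    have := abs_nonneg (freq L m.2.2)
    have := abs_add_le (freq L m.1) (freq L m.2.1)
    have := abs_add_le (freq L m.2.1) (freq L m.2.2)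
    have := abs_add_le (freq L m.2.2) (freq L m.1)
    refine ⟨?_, ?_, ?_⟩ <;> linarith
  -- Twice each frequency is a signed sum of the three pair sums. Hence `N` is at most twice their
  -- total, and so at most six times the largest one.
  · rw [freqSize, freq_fourth, freq_add, freq_add, freq_add]
    generalize freq L m.1 = a
    generalize freq L m.2.1 = b
    generalize freq L m.2.2 = c
    by_contra! hcon
    obtain ⟨h1, h2, h3⟩ := hcon
    have h2abs : ∀ r : ℝ, 2 * |r| = |2 * r| := fun r => by rw [abs_mul, abs_two]
    have e1 : 2 * |a| ≤ |a + b| + |b + c| + |c + a| := by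
      have : 2 * a = (a + b) - (b + c) + (c + a) := by ring
      rw [h2abs, this]
      exact (abs_add_le _ _).trans (by gcongr; exact abs_sub _ _)
    have e2 : 2 * |b| ≤ |a + b| + |b + c| + |c + a| := by
      have : 2 * b = (a + b) + (b + c) - (c + a) := by ring
      rw [h2abs, this]
      exact (abs_sub _ _).trans (by gcongr; exact abs_add_le _ _)
    have e3 : 2 * |c| ≤ |a + b| + |b + c| + |c + a| := by
      have : 2 * c = (b + c) - (a + b) + (c + a) := by ring
      rw [h2abs, this]
      refine (abs_add_le _ _).trans ?_
      have := abs_sub (b + c) (a + b)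
      linarith
    have e4 : 2 * |-(a + b + c)| ≤ |a + b| + |b + c| + |c + a| := by
      have : 2 * (a + b + c) = (a + b) + (b + c) + (c + a) := by ring
      rw [abs_neg, h2abs, this]
      exact (abs_add_le _ _).trans (by gcongr; exact abs_add_le _ _)
    linarith

lemma freqSize_pos {L : ℝ} (hL : 1 ≤ L) {m : ℤ × ℤ × ℤ} (hm : m ∈ nonResAll) :
    0 < freqSize L m := by
  obtain ⟨⟨h, -⟩, ⟨h', -⟩, -⟩ := pair_sum_bounds hL hm
  exact h.trans_le h'

/-- A phase of the form `n⁵ + β L⁻² n³ - c n` up to a small multiple of `n / L` has a resonance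
function bounded below by `resWeight`. -/
lemma resWeight_le {L β c : ℝ} (hL : 1 ≤ L) (hβ : 0 ≤ β) {p : ℤ → ℝ}
    (hp : ∀ k, |p k - (freq L k ^ 5 + β * (L ^ 2)⁻¹ * freq L k ^ 3 - c * freq L k)|
      ≤ |freq L k| / (24 * L)) {m : ℤ × ℤ × ℤ} (hm : m ∈ nonResAll) :
    resWeight L m ≤ 8 * ‖Complex.I * ((p m.1 + p m.2.1 + p m.2.2 + p (fourth m) : ℝ) : ℂ) - 1‖ := by
  set H := p m.1 + p m.2.1 + p m.2.2 + p (fourth m) with hH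
  have hL0 : 0 < L := by linarith
  obtain ⟨⟨hx0, hy0, hz0⟩, -, hbig⟩ := pair_sum_bounds hL hm
  have hNpos := freqSize_pos hL hm
  have hm' : (m.1 + m.2.1) * (m.2.1 + m.2.2) * (m.2.2 + m.1) ≠ 0 := hm
  simp only [ne_eq, mul_eq_zero, not_or] at hm'
  have hx1 := inv_le_abs_freq hL hm'.1.1
  have hy1 := inv_le_abs_freq hL hm'.1.2
  have hz1 := inv_le_abs_freq hL hm'.2
  have hi : 0 < L⁻¹ := by positivity
  set N := freqSize L m with hN
  set W := |freq L (m.1 + m.2.1)| * |freq L (m.2.1 + m.2.2)| * |freq L (m.2.2 + m.1)| * N ^ 2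
    with hW
  -- the cubed size is controlled by the resonance
  have hNW : N ^ 3 * (L⁻¹) ^ 2 ≤ 6 * W := by
    rcases hbig with h | h | h
    · calc N ^ 3 * L⁻¹ ^ 2 = N * L⁻¹ * L⁻¹ * N ^ 2 := by ring
        _ ≤ (6 * |freq L (m.1 + m.2.1)|) * |freq L (m.2.1 + m.2.2)| * |freq L (m.2.2 + m.1)|
            * N ^ 2 := by gcongr
        _ = _ := by rw [hW]; ring
    · calc N ^ 3 * L⁻¹ ^ 2 = N * L⁻¹ * L⁻¹ * N ^ 2 := by ring
        _ ≤ (6 * |freq L (m.2.1 + m.2.2)|) * |freq L (m.1 + m.2.1)| * |freq L (m.2.2 + m.1)|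
            * N ^ 2 := by gcongr
        _ = _ := by rw [hW]; ring
    · calc N ^ 3 * L⁻¹ ^ 2 = N * L⁻¹ * L⁻¹ * N ^ 2 := by ring
        _ ≤ (6 * |freq L (m.2.2 + m.1)|) * |freq L (m.1 + m.2.1)| * |freq L (m.2.1 + m.2.2)|
            * N ^ 2 := by gcongr
        _ = _ := by rw [hW]; ring
  -- Together with `hNW` this gives `N/L ≤ 1 + 6W`, which makes the perturbation `N/(24L)` of the
  -- phase absorbable.
  have hNL : N / L ≤ 1 + N ^ 3 * (L⁻¹) ^ 2 := by
    rcases le_total N L with h | h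
    · have : N / L ≤ 1 := by rw [div_le_one hL0]; exact h
      have : 0 < N ^ 3 * (L⁻¹) ^ 2 := by positivity
      linarith
    · have h1 : 1 ≤ N := hL.trans h
      have : N / L ≤ N ^ 3 * L⁻¹ ^ 2 := by
        rw [inv_pow, ← div_eq_mul_inv, div_le_div_iff₀ hL0 (by positivity)]
        have : L ≤ N ^ 2 := by nlinarith
        calc N * L ^ 2 = N * L * L := by ring
          _ ≤ N * L * N ^ 2 := by gcongr
          _ = _ := by ring
      linarith
  -- With `q` the product of the pair sums and zero total frequency, `∑ nⱼ⁵ = -(5/2) q ∑ nⱼ²` and `∑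
  -- nⱼ³ = -3q`, while the linear parts cancel. Only the four deviations of `p` from the polynomial
  -- remain.
  have hsum : |H + 5 / 2 * (freq L (m.1 + m.2.1) * freq L (m.2.1 + m.2.2) * freq L (m.2.2 + m.1))
        * (freq L m.1 ^ 2 + freq L m.2.1 ^ 2 + freq L m.2.2 ^ 2 + freq L (fourth m) ^ 2)
        + 3 * β * (L ^ 2)⁻¹
          * (freq L (m.1 + m.2.1) * freq L (m.2.1 + m.2.2) * freq L (m.2.2 + m.1))|
      ≤ N / (24 * L) := by
    have e : H + 5 / 2 * (freq L (m.1 + m.2.1) * freq L (m.2.1 + m.2.2) * freq L (m.2.2 + m.1))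
        * (freq L m.1 ^ 2 + freq L m.2.1 ^ 2 + freq L m.2.2 ^ 2 + freq L (fourth m) ^ 2)
        + 3 * β * (L ^ 2)⁻¹
          * (freq L (m.1 + m.2.1) * freq L (m.2.1 + m.2.2) * freq L (m.2.2 + m.1))
        = (p m.1 - (freq L m.1 ^ 5 + β * (L ^ 2)⁻¹ * freq L m.1 ^ 3 - c * freq L m.1))
        + (p m.2.1 - (freq L m.2.1 ^ 5 + β * (L ^ 2)⁻¹ * freq L m.2.1 ^ 3 - c * freq L m.2.1))
        + (p m.2.2 - (freq L m.2.2 ^ 5 + β * (L ^ 2)⁻¹ * freq L m.2.2 ^ 3 - c * freq L m.2.2))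
        + (p (fourth m) - (freq L (fourth m) ^ 5 + β * (L ^ 2)⁻¹ * freq L (fourth m) ^ 3
          - c * freq L (fourth m))) := by
      rw [hH, freq_fourth, freq_add, freq_add, freq_add]; ring
    rw [e, hN, freqSize, add_div, add_div, add_div]
    refine (abs_add_le _ _).trans (add_le_add ?_ (hp _))
    refine (abs_add_le _ _).trans (add_le_add ?_ (hp _))
    exact (abs_add_le _ _).trans (add_le_add (hp _) (hp _))
  set q := freq L (m.1 + m.2.1) * freq L (m.2.1 + m.2.2) * freq L (m.2.2 + m.1) with hq
  set S := freq L m.1 ^ 2 + freq L m.2.1 ^ 2 + freq L m.2.2 ^ 2 + freq L (fourth m) ^ 2 with hS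
  have hSN : N ^ 2 ≤ 4 * S := by
    rw [hN, hS, freqSize, ← sq_abs (freq L m.1), ← sq_abs (freq L m.2.1), ← sq_abs (freq L m.2.2),
      ← sq_abs (freq L (fourth m))]
    generalize |freq L m.1| = a
    generalize |freq L m.2.1| = b
    generalize |freq L m.2.2| = d
    generalize |freq L (fourth m)| = e
    nlinarith [sq_nonneg (a - b), sq_nonneg (a - d), sq_nonneg (a - e), sq_nonneg (b - d),
      sq_nonneg (b - e), sq_nonneg (d - e)]
  have hWq : W = |q| * N ^ 2 := by rw [hW, hq, abs_mul, abs_mul]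
  -- Both terms carry the sign of `q` because `β ≥ 0`, so the cubic contribution can be dropped.
  have hmain : 5 / 8 * W ≤ |5 / 2 * q * S + 3 * β * (L ^ 2)⁻¹ * q| := by
    have e : 5 / 2 * q * S + 3 * β * (L ^ 2)⁻¹ * q = q * (5 / 2 * S + 3 * β * (L ^ 2)⁻¹) := by ring
    have hb : 0 ≤ 3 * β * (L ^ 2)⁻¹ := by positivity
    have hS0 : 0 ≤ S := by positivity
    rw [e, abs_mul, abs_of_nonneg (by positivity : 0 ≤ 5 / 2 * S + 3 * β * (L ^ 2)⁻¹), hWq]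
    have : |q| * (5 / 8 * N ^ 2) ≤ |q| * (5 / 2 * S + 3 * β * (L ^ 2)⁻¹) := by
      gcongr; linarith
    linarith
  -- The loss is at most `(1 + 6W)/24`, and `5/8 - 6/24 = 3/8`.
  have hHlow : 3 / 8 * W - 1 / 24 ≤ |H| := by
    have h1 : |5 / 2 * q * S + 3 * β * (L ^ 2)⁻¹ * q|
        ≤ |H + 5 / 2 * q * S + 3 * β * (L ^ 2)⁻¹ * q| + |H| := by
      have := abs_sub (H + 5 / 2 * q * S + 3 * β * (L ^ 2)⁻¹ * q) H
      rwa [show H + 5 / 2 * q * S + 3 * β * (L ^ 2)⁻¹ * q - H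
        = 5 / 2 * q * S + 3 * β * (L ^ 2)⁻¹ * q by ring] at this
    have h2 : N / (24 * L) = N / L / 24 := by field_simp
    rw [h2] at hsum
    linarith
  -- The real part of `iH - 1` is `-1` and its imaginary part is `H`.
  have hnorm : 1 + |H| ≤ 2 * ‖Complex.I * (H : ℂ) - 1‖ := by
    have h1 := Complex.abs_re_le_norm (Complex.I * (H : ℂ) - 1)
    have h2 := Complex.abs_im_le_norm (Complex.I * (H : ℂ) - 1)
    simp at h1 h2
    linarith
  have hW0 : 0 ≤ W := by positivity
  have : resWeight L m = 1 + W := rfl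
  rw [this]
  linarith

/-! ### Convolutions of sequences and the splitting into resonant and non-resonant parts. -/

section Sequences

/-- The product `a(k₁) a(k₂) a(k₃) a(k₄)` with `k₁ + k₂ + k₃ + k₄ = 0`. -/
def quad (a : ℤ → ℂ) (m : ℤ × ℤ × ℤ) : ℂ := a m.1 * a m.2.1 * a m.2.2 * a (fourth m)

/-- The square of the `ℓ²` norm. -/
noncomputable def mass (a : ℤ → ℂ) : ℝ := ∑' k, ‖a k‖ ^ 2

/-- The convolution square. -/
noncomputable def selfConv (a : ℤ → ℂ) (n : ℤ) : ℂ := ∑' j, a j * a (n - j)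

/-- The square of the `ℓ²` norm of the convolution square. -/
noncomputable def quartic (a : ℤ → ℂ) : ℝ := ∑' n, ‖selfConv a n‖ ^ 2

/-- The non-resonant cubic sum of a sequence. -/
noncomputable def cubic (a : ℤ → ℂ) (k : ℤ) : ℂ :=
  ∑' m : nonRes k, a m.1.1 * a m.1.2.1 * a m.1.2.2

/-- The triple with two given entries and a given sum. -/
def fiber (k : ℤ) (j : ℤ × ℤ) : ℤ × ℤ × ℤ := (j.1, j.2, k - j.1 - j.2)

/-- Splitting off the sum of the first two entries. -/
def pairSumEquiv (α : Type*) : ℤ × ℤ × α ≃ ℤ × ℤ × α where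
  toFun m := (m.2.1, m.1 - m.2.1, m.2.2)
  invFun m := (m.1 + m.2.1, m.1, m.2.2)
  left_inv m := by ext <;> simp
  right_inv m := by ext <;> simp

/-- Pairs parametrized by their sum and the first entry. -/
def sumEquiv : ℤ × ℤ ≃ ℤ × ℤ where
  toFun m := (m.2, m.1 - m.2)
  invFun m := (m.1 + m.2, m.1)
  left_inv m := by ext <;> simp
  right_inv m := by ext <;> simp

/-- Triples parametrized by their sum and the first two entries. -/
def fiberEquiv : ℤ × ℤ × ℤ ≃ ℤ × ℤ × ℤ where
  toFun m := fiber m.1 m.2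
  invFun m := (m.1 + m.2.1 + m.2.2, m.1, m.2.1)
  left_inv m := by ext <;> simp [fiber]
  right_inv m := by
    simp only [fiber]
    ext <;> dsimp only
    ring

lemma fiber_injective (k : ℤ) : Function.Injective (fiber k) := by
  intro i j h
  simp only [fiber, Prod.mk.injEq] at h
  exact Prod.ext h.1 h.2.1

lemma summable_triple {f g h : ℤ → ℝ} (hf : Summable f) (hg : Summable g) (hh : Summable h)
    (hf0 : ∀ k, 0 ≤ f k) (hg0 : ∀ k, 0 ≤ g k) (hh0 : ∀ k, 0 ≤ h k) :
    Summable fun m : ℤ × ℤ × ℤ => f m.1 * g m.2.1 * h m.2.2 := by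
  have h1 : Summable fun m : ℤ × ℤ => g m.1 * h m.2 := hg.mul_of_nonneg hh hg0 hh0
  have := hf.mul_of_nonneg h1 hf0 (fun m => mul_nonneg (hg0 _) (hh0 _))
  exact this.congr fun m => by ring

lemma summable_norm_sq {ι : Type*} {a : ι → ℂ} (ha : Summable fun k => ‖a k‖) :
    Summable fun k => ‖a k‖ ^ 2 := by
  refine Summable.of_nonneg_of_le (fun k => by positivity) (fun k => ?_)
    (ha.mul_left (∑' k, ‖a k‖))
  rw [sq]
  gcongr
  exact ha.le_tsum k fun _ _ => norm_nonneg _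

variable {a : ℤ → ℂ}

lemma mass_nonneg (a : ℤ → ℂ) : 0 ≤ mass a := tsum_nonneg fun _ => by positivity

lemma quartic_nonneg (a : ℤ → ℂ) : 0 ≤ quartic a := tsum_nonneg fun _ => by positivity

lemma norm_sq_le_mass (ha : Summable fun k => ‖a k‖) (k : ℤ) : ‖a k‖ ^ 2 ≤ mass a :=
  (summable_norm_sq ha).le_tsum k fun _ _ => by positivity

lemma norm_le_sqrt_mass (ha : Summable fun k => ‖a k‖) (k : ℤ) : ‖a k‖ ≤ √(mass a) :=
  Real.le_sqrt_of_sq_le (norm_sq_le_mass ha k)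

lemma summable_norm_quad (ha : Summable fun k => ‖a k‖) : Summable fun m => ‖quad a m‖ := by
  refine Summable.of_nonneg_of_le (fun k => by positivity) (fun m => ?_)
    ((summable_triple ha ha ha (fun _ => norm_nonneg _) (fun _ => norm_nonneg _)
      (fun _ => norm_nonneg _)).mul_right (∑' k, ‖a k‖))
  rw [quad, norm_mul, norm_mul, norm_mul]
  gcongr
  exact ha.le_tsum _ fun _ _ => norm_nonneg _

lemma summable_norm_pair (ha : Summable fun k => ‖a k‖) :
    Summable fun m : ℤ × ℤ => ‖a m.2 * a (m.1 - m.2)‖ := by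
  have h : Summable fun m : ℤ × ℤ => ‖a m.1‖ * ‖a m.2‖ :=
    ha.mul_of_nonneg ha (fun _ => norm_nonneg _) (fun _ => norm_nonneg _)
  refine (sumEquiv.summable_iff.2 h).congr fun m => ?_
  simp [sumEquiv]

lemma summable_norm_pair_fiber (ha : Summable fun k => ‖a k‖) (n : ℤ) :
    Summable fun j => ‖a j * a (n - j)‖ :=
  (summable_norm_pair ha).prod_factor n

lemma summable_norm_selfConv (ha : Summable fun k => ‖a k‖) :
    Summable fun n => ‖selfConv a n‖ :=
  Summable.of_nonneg_of_le (fun _ => norm_nonneg _)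
    (fun n => norm_tsum_le_tsum_norm (summable_norm_pair_fiber ha n)) (summable_norm_pair ha).prod

lemma selfConv_neg (hc : ∀ k, a (-k) = (starRingEnd ℂ) (a k)) (n : ℤ) :
    selfConv a (-n) = (starRingEnd ℂ) (selfConv a n) := by
  rw [selfConv, selfConv, Complex.conj_tsum, ← (Equiv.neg ℤ).tsum_eq]
  refine tsum_congr fun j => ?_
  rw [map_mul, ← hc, ← hc]
  simp only [Equiv.neg_apply]
  congr 2
  ring

/-- Grouping by the sum `n` of the first two frequencies, the last two add up to `-n`, and
conjugation symmetry turns the product into `|(a * a)(n)|²`. The quartic norm is therefore a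
quadrilinear form to which integration by parts in time applies. -/
lemma tsum_quad (ha : Summable fun k => ‖a k‖) (hc : ∀ k, a (-k) = (starRingEnd ℂ) (a k)) :
    ∑' m, quad a m = (quartic a : ℂ) := by
  have hs : Summable fun m => quad a (pairSumEquiv ℤ m) :=
    (pairSumEquiv ℤ).summable_iff.2 (summable_norm_quad ha).of_norm
  rw [← (pairSumEquiv ℤ).tsum_eq, hs.tsum_prod, quartic, Complex.ofReal_tsum]
  refine tsum_congr fun n => ?_
  have : (((‖selfConv a n‖ ^ 2 : ℝ)) : ℂ) = selfConv a n * selfConv a (-n) := by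
    rw [selfConv_neg hc, Complex.mul_conj, Complex.normSq_eq_norm_sq]
  rw [this, selfConv, selfConv,
    tsum_mul_tsum_of_summable_norm (summable_norm_pair_fiber ha n) (summable_norm_pair_fiber ha _)]
  refine tsum_congr fun j => ?_
  simp only [quad, pairSumEquiv, fourth, Equiv.coe_fn_mk]
  rw [show -(j.1 + (n - j.1) + j.2) = -n - j.2 by ring]
  ring

lemma tsum_mul_le_sqrt {ι : Type*} {f g : ι → ℝ} (hf : ∀ i, 0 ≤ f i) (hg : ∀ i, 0 ≤ g i)
    (hf2 : Summable fun i => f i ^ 2) (hg2 : Summable fun i => g i ^ 2) :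
    ∑' i, f i * g i ≤ √(∑' i, f i ^ 2) * √(∑' i, g i ^ 2) := by
  refine Real.tsum_le_of_sum_le (fun i => mul_nonneg (hf i) (hg i)) fun s => ?_
  refine (Real.sum_mul_le_sqrt_mul_sqrt s f g).trans ?_
  gcongr
  · exact hf2.sum_le_tsum s fun _ _ => by positivity
  · exact hg2.sum_le_tsum s fun _ _ => by positivity

lemma summable_norm_fiber (ha : Summable fun k => ‖a k‖) (k : ℤ) :
    Summable fun j : ℤ × ℤ => ‖a j.1 * a j.2 * a (k - j.1 - j.2)‖ := by
  have h := summable_triple ha ha ha (fun _ => norm_nonneg _) (fun _ => norm_nonneg _)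
    (fun _ => norm_nonneg _)
  refine (h.comp_injective (fiber_injective k)).congr fun j => ?_
  simp [fiber]

lemma tsum_fiber_eq (ha : Summable fun k => ‖a k‖) (k : ℤ) :
    ∑' j : ℤ × ℤ, a j.1 * a j.2 * a (k - j.1 - j.2) = ∑' n, selfConv a n * a (k - n) := by
  set f : ℤ × ℤ → ℂ := fun j => a j.1 * a j.2 * a (k - j.1 - j.2) with hf
  have hs : Summable fun j => f (sumEquiv j) :=
    sumEquiv.summable_iff.2 (summable_norm_fiber ha k).of_norm
  rw [← sumEquiv.tsum_eq f, hs.tsum_prod]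
  refine tsum_congr fun n => ?_
  rw [selfConv, ← tsum_mul_right]
  refine tsum_congr fun j => ?_
  simp only [hf, sumEquiv, Equiv.coe_fn_mk]
  rw [show k - j - (n - j) = k - n by ring]

/-- The unrestricted cubic sum is `(a * a) * a`, so Cauchy–Schwarz in the last convolution suffices.
-/
lemma norm_tsum_fiber_le (ha : Summable fun k => ‖a k‖) (k : ℤ) :
    ‖∑' j : ℤ × ℤ, a j.1 * a j.2 * a (k - j.1 - j.2)‖ ≤ √(mass a) * √(quartic a) := by
  rw [tsum_fiber_eq ha]
  have hk : Summable fun n => ‖a (k - n)‖ := (Equiv.subLeft k).summable_iff.2 ha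
  have hm : ∑' n, ‖a (k - n)‖ ^ 2 = mass a :=
    (Equiv.subLeft k).tsum_eq fun n => ‖a n‖ ^ 2
  have hb : Summable fun n => ‖selfConv a n * a (k - n)‖ := by
    simp_rw [norm_mul]
    refine Summable.of_nonneg_of_le (fun n => by positivity) (fun n => ?_)
      ((summable_norm_selfConv ha).mul_right (∑' n, ‖a (k - n)‖))
    exact mul_le_mul_of_nonneg_left (hk.le_tsum n fun _ _ => norm_nonneg _) (norm_nonneg _)
  refine (norm_tsum_le_tsum_norm hb).trans ?_
  simp_rw [norm_mul]
  refine (tsum_mul_le_sqrt (fun _ => norm_nonneg _) (fun _ => norm_nonneg _)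
    (summable_norm_sq (summable_norm_selfConv ha)) (summable_norm_sq hk)).trans ?_
  rw [hm, mul_comm]
  exact le_rfl

/-- The value of `a * a` at `0` is `∑ a(j) a(-j)`, which equals the mass. This allows resonant terms
to be absorbed into the bound for the forcing. -/
lemma mass_sq_le_quartic (ha : Summable fun k => ‖a k‖)
    (hc : ∀ k, a (-k) = (starRingEnd ℂ) (a k)) : mass a ^ 2 ≤ quartic a := by
  have h : selfConv a 0 = (mass a : ℂ) := by
    rw [selfConv, mass, Complex.ofReal_tsum]
    refine tsum_congr fun j => ?_
    rw [zero_sub, hc, Complex.mul_conj, Complex.normSq_eq_norm_sq]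
  have := (summable_norm_sq (summable_norm_selfConv ha)).le_tsum 0 fun _ _ => by positivity
  rw [h, Complex.norm_real, Real.norm_of_nonneg (mass_nonneg a)] at this
  exact this

/-- A sum over a set covered by three injectively parametrized pieces. -/
lemma tsum_indicator_le_three {ι κ : Type*} {g : κ → ℝ} (hg : Summable g) (hg0 : ∀ b, 0 ≤ g b)
    {R : Set κ} {φ₁ φ₂ φ₃ : ι → κ} (h₁ : Function.Injective φ₁) (h₂ : Function.Injective φ₂)
    (h₃ : Function.Injective φ₃)
    (hR : R ⊆ Set.range φ₁ ∪ Set.range φ₂ ∪ Set.range φ₃) :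
    ∑' b, R.indicator g b ≤ ∑' c, g (φ₁ c) + ∑' c, g (φ₂ c) + ∑' c, g (φ₃ c) := by
  have key : ∀ {φ : ι → κ}, Function.Injective φ →
      ∑' c, g (φ c) = ∑' b, (Set.range φ).indicator g b := fun {φ} h => by
    rw [← tsum_subtype, tsum_range g h]
  rw [key h₁, key h₂, key h₃, ← (hg.indicator _).tsum_add (hg.indicator _),
    ← ((hg.indicator _).add (hg.indicator _)).tsum_add (hg.indicator _)]
  refine (hg.indicator _).tsum_le_tsum (fun b => ?_)
    (((hg.indicator _).add (hg.indicator _)).add (hg.indicator _))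
  have hn : ∀ s : Set κ, 0 ≤ s.indicator g b := fun s => Set.indicator_nonneg (fun b _ => hg0 b) b
  by_cases hb : b ∈ R
  · rw [Set.indicator_of_mem hb]
    rcases hR hb with (h | h) | h
    · have := Set.indicator_of_mem h g
      linarith [hn (Set.range φ₂), hn (Set.range φ₃)]
    · have := Set.indicator_of_mem h g
      linarith [hn (Set.range φ₁), hn (Set.range φ₃)]
    · have := Set.indicator_of_mem h g
      linarith [hn (Set.range φ₁), hn (Set.range φ₂)]
  · rw [Set.indicator_of_notMem hb]
    linarith [hn (Set.range φ₁), hn (Set.range φ₂), hn (Set.range φ₃)]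

lemma norm_neg_eq (hc : ∀ k, a (-k) = (starRingEnd ℂ) (a k)) (k : ℤ) : ‖a (-k)‖ = ‖a k‖ := by
  rw [hc, Complex.norm_conj]

/-- The part of the quadrilinear sum off the non-resonant set. -/
lemma tsum_resonant_quad_le (ha : Summable fun k => ‖a k‖)
    (hc : ∀ k, a (-k) = (starRingEnd ℂ) (a k)) :
    ∑' m, (nonResAllᶜ).indicator (fun m => ‖quad a m‖) m ≤ 3 * mass a ^ 2 := by
  have h2 : ∑' j : ℤ × ℤ, ‖a j.1‖ ^ 2 * ‖a j.2‖ ^ 2 = mass a ^ 2 := by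
    have hs := summable_norm_sq ha
    rw [sq, mass, tsum_mul_tsum_of_summable_norm (by simpa using hs) (by simpa using hs)]
  refine (tsum_indicator_le_three (φ₁ := fun j : ℤ × ℤ => (j.1, -j.1, j.2))
    (φ₂ := fun j : ℤ × ℤ => (j.2, j.1, -j.1)) (φ₃ := fun j : ℤ × ℤ => (j.1, j.2, -j.1))
    (summable_norm_quad ha) (fun _ => norm_nonneg _) ?_ ?_ ?_ ?_).trans ?_
  · intro i j h; simp only [Prod.mk.injEq] at h; exact Prod.ext h.1 h.2.2
  · intro i j h; simp only [Prod.mk.injEq] at h; exact Prod.ext h.2.1 h.1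
  · intro i j h; simp only [Prod.mk.injEq] at h; exact Prod.ext h.1 h.2.1
  -- A vanishing pair sum makes two frequencies opposite, and the fourth is then opposite to the
  -- remaining one, so the term is a product of two squares.
  · rintro ⟨i, j, l⟩ hm
    simp only [nonResAll, Set.mem_compl_iff, Set.mem_ofPred_eq, ne_eq, mul_eq_zero, not_not] at hm
    rcases hm with (h | h) | h
    · exact Or.inl (Or.inl ⟨(i, l), by ext <;> simp; omega⟩)
    · exact Or.inl (Or.inr ⟨(j, i), by ext <;> simp; omega⟩)
    · exact Or.inr ⟨(i, j), by ext <;> simp; omega⟩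
  · refine le_of_eq ?_
    have e1 : ∀ j : ℤ × ℤ, ‖quad a (j.1, -j.1, j.2)‖ = ‖a j.1‖ ^ 2 * ‖a j.2‖ ^ 2 := fun j => by
      simp only [quad, fourth, norm_mul, norm_neg_eq hc]
      rw [show j.1 + -j.1 + j.2 = j.2 by ring]; ring
    have e2 : ∀ j : ℤ × ℤ, ‖quad a (j.2, j.1, -j.1)‖ = ‖a j.1‖ ^ 2 * ‖a j.2‖ ^ 2 := fun j => by
      simp only [quad, fourth, norm_mul, norm_neg_eq hc]
      rw [show j.2 + j.1 + -j.1 = j.2 by ring]; ring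
    have e3 : ∀ j : ℤ × ℤ, ‖quad a (j.1, j.2, -j.1)‖ = ‖a j.1‖ ^ 2 * ‖a j.2‖ ^ 2 := fun j => by
      simp only [quad, fourth, norm_mul, norm_neg_eq hc]
      rw [show j.1 + j.2 + -j.1 = j.2 by ring]; ring
    simp_rw [e1, e2, e3, h2]
    ring

/-- Only the non-resonant part oscillates and needs integration by parts; the resonant part is
controlled by the mass at each time. -/
lemma quartic_le (ha : Summable fun k => ‖a k‖) (hc : ∀ k, a (-k) = (starRingEnd ℂ) (a k)) :
    quartic a ≤ 3 * mass a ^ 2 + (∑' m, nonResAll.indicator (quad a) m).re := by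
  have hs := (summable_norm_quad ha).of_norm
  have h : (quartic a : ℂ) = ∑' m, nonResAll.indicator (quad a) m
      + ∑' m, (nonResAllᶜ).indicator (quad a) m := by
    rw [← tsum_quad ha hc, ← (hs.indicator _).tsum_add (hs.indicator _)]
    exact tsum_congr fun m => (Set.indicator_self_add_compl_apply _ _ _).symm
  have h2 : ‖∑' m, (nonResAllᶜ).indicator (quad a) m‖ ≤ 3 * mass a ^ 2 := by
    have e : (fun m => ‖(nonResAllᶜ).indicator (quad a) m‖)
        = fun m => (nonResAllᶜ).indicator (fun m => ‖quad a m‖) m := by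
      funext m; exact norm_indicator_eq_indicator_norm _ _
    have hs' := (summable_norm_quad ha).indicator (nonResAllᶜ)
    refine (norm_tsum_le_tsum_norm (by rw [e]; exact hs')).trans ?_
    rw [e]
    exact tsum_resonant_quad_le ha hc
  have h3 := congrArg Complex.re h
  rw [Complex.ofReal_re, Complex.add_re] at h3
  have := Complex.re_le_norm (∑' m, (nonResAllᶜ).indicator (quad a) m)
  linarith

lemma cubic_eq_tsum (a : ℤ → ℂ) (k : ℤ) :
    cubic a k = ∑' j : ℤ × ℤ, (fiber k ⁻¹' nonResAll).indicator
      (fun j => a j.1 * a j.2 * a (k - j.1 - j.2)) j := by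
  have h1 : cubic a k = ∑' m, (nonRes k).indicator
      (fun m : ℤ × ℤ × ℤ => a m.1 * a m.2.1 * a m.2.2) m :=
    tsum_subtype (nonRes k) fun m : ℤ × ℤ × ℤ => a m.1 * a m.2.1 * a m.2.2
  rw [h1, ← (fiber_injective k).tsum_eq]
  · refine tsum_congr fun j => ?_
    have : fiber k j ∈ nonRes k ↔ j ∈ fiber k ⁻¹' nonResAll := by
      simp [nonRes, nonResAll, fiber]
    by_cases h : j ∈ fiber k ⁻¹' nonResAll
    · rw [Set.indicator_of_mem h, Set.indicator_of_mem (this.2 h)]; rfl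
    · rw [Set.indicator_of_notMem h, Set.indicator_of_notMem (fun h' => h (this.1 h'))]
  · intro m hm
    have hm' : m ∈ nonRes k := by
      by_contra h
      exact hm (Set.indicator_of_notMem h _)
    refine ⟨(m.1, m.2.1), ?_⟩
    have h := hm'.1
    simp only [fiber]
    ext <;> simp only
    omega

/-- If a pair sum vanishes, the third frequency is `k` and the term has size `|a(j)|² |a(k)|`. There
are three such families. -/
lemma norm_cubic_le (ha : Summable fun k => ‖a k‖)
    (hc : ∀ k, a (-k) = (starRingEnd ℂ) (a k)) (k : ℤ) :
    ‖cubic a k‖ ≤ √(mass a) * √(quartic a) + 3 * (mass a * ‖a k‖) := by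
  have hn := summable_norm_fiber ha k
  have hs := hn.of_norm
  set f : ℤ × ℤ → ℂ := fun j => a j.1 * a j.2 * a (k - j.1 - j.2) with hf
  set R := fiber k ⁻¹' nonResAll with hR
  have h : ∑' j, f j = cubic a k + ∑' j, Rᶜ.indicator f j := by
    rw [cubic_eq_tsum, ← (hs.indicator _).tsum_add (hs.indicator _)]
    exact tsum_congr fun m => (Set.indicator_self_add_compl_apply _ _ _).symm
  have e : (fun m => ‖Rᶜ.indicator f m‖) = fun m => Rᶜ.indicator (fun m => ‖f m‖) m := by
    funext m; exact norm_indicator_eq_indicator_norm _ _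
  have h2 : ‖∑' j, Rᶜ.indicator f j‖ ≤ 3 * (mass a * ‖a k‖) := by
    refine (norm_tsum_le_tsum_norm (by rw [e]; exact hn.indicator _)).trans ?_
    rw [e]
    refine (tsum_indicator_le_three (φ₁ := fun j : ℤ => (j, -j))
      (φ₂ := fun j : ℤ => (k, j)) (φ₃ := fun j : ℤ => (j, k))
      hn (fun _ => norm_nonneg _) ?_ ?_ ?_ ?_).trans ?_
    · intro i j h; simpa using h
    · intro i j h; simpa using h
    · intro i j h; simpa using h
    · rintro ⟨i, j⟩ hm
      simp only [hR, Set.preimage_ofPred_eq, fiber, nonResAll, Set.mem_compl_iff, Set.mem_ofPred_eq,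
        ne_eq, mul_eq_zero, not_not] at hm
      rcases hm with (h | h) | h
      · exact Or.inl (Or.inl ⟨i, by ext <;> simp; omega⟩)
      · exact Or.inl (Or.inr ⟨j, by ext <;> simp; omega⟩)
      · exact Or.inr ⟨i, by ext <;> simp; omega⟩
    · refine le_of_eq ?_
      have e1 : ∀ j : ℤ, ‖f (j, -j)‖ = ‖a j‖ ^ 2 * ‖a k‖ := fun j => by
        simp only [hf, norm_mul, norm_neg_eq hc]
        rw [show k - j - -j = k by ring]; ring
      have e2 : ∀ j : ℤ, ‖f (k, j)‖ = ‖a j‖ ^ 2 * ‖a k‖ := fun j => by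
        simp only [hf, norm_mul]
        rw [show k - k - j = -j by ring, norm_neg_eq hc]; ring
      have e3 : ∀ j : ℤ, ‖f (j, k)‖ = ‖a j‖ ^ 2 * ‖a k‖ := fun j => by
        simp only [hf, norm_mul]
        rw [show k - j - k = -j by ring, norm_neg_eq hc]; ring
      refine (congrArg₂ (· + ·) (congrArg₂ (· + ·) (tsum_congr e1) (tsum_congr e2))
        (tsum_congr e3)).trans ?_
      simp only [tsum_mul_right, mass]
      ring
  have h3 := norm_tsum_fiber_le ha k
  have h4 : cubic a k = ∑' j, f j - ∑' j, Rᶜ.indicator f j := by rw [h]; ring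
  rw [h4]
  exact (norm_sub_le _ _).trans (add_le_add h3 h2)

end Sequences

/-! ### The symmetry that makes the mass constant. -/

section Conservation

variable {a : ℤ → ℂ}

/-- Exchanging the first and the fourth entry. -/
def swapFirst : ℤ × ℤ × ℤ ≃ ℤ × ℤ × ℤ where
  toFun m := (fourth m, m.2.1, m.2.2)
  invFun m := (fourth m, m.2.1, m.2.2)
  left_inv m := by
    simp only [fourth]
    ext <;> dsimp only
    ring
  right_inv m := by
    simp only [fourth]
    ext <;> dsimp only
    ring

/-- Exchanging the second and the fourth entry. -/
def swapSecond : ℤ × ℤ × ℤ ≃ ℤ × ℤ × ℤ where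
  toFun m := (m.1, fourth m, m.2.2)
  invFun m := (m.1, fourth m, m.2.2)
  left_inv m := by
    simp only [fourth]
    ext <;> dsimp only
    ring
  right_inv m := by
    simp only [fourth]
    ext <;> dsimp only
    ring

/-- Exchanging the third and the fourth entry. -/
def swapThird : ℤ × ℤ × ℤ ≃ ℤ × ℤ × ℤ where
  toFun m := (m.1, m.2.1, fourth m)
  invFun m := (m.1, m.2.1, fourth m)
  left_inv m := by
    simp only [fourth]
    ext <;> dsimp only
    ring
  right_inv m := by
    simp only [fourth]
    ext <;> dsimp only
    ring

lemma summable_weighted_quad (ha : Summable fun k : ℤ => (1 + |(k : ℝ)|) * ‖a k‖)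
    {π : ℤ × ℤ × ℤ → ℤ}
    (hπ : ∀ m, |(π m : ℝ)| ≤ (1 + |(m.1 : ℝ)|) * (1 + |(m.2.1 : ℝ)|) * (1 + |(m.2.2 : ℝ)|)
      * (1 + |(fourth m : ℝ)|)) :
    Summable fun m => ‖(π m : ℂ) * quad a m‖ := by
  have h0 : ∀ k : ℤ, 0 ≤ (1 + |(k : ℝ)|) * ‖a k‖ := fun k => by positivity
  refine Summable.of_nonneg_of_le (fun k => by positivity) (fun m => ?_)
    ((summable_triple ha ha ha h0 h0 h0).mul_right (∑' k : ℤ, (1 + |(k : ℝ)|) * ‖a k‖))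
  have h4 := ha.le_tsum (fourth m) fun k _ => h0 k
  rw [quad, norm_mul, norm_mul, norm_mul, norm_mul, Complex.norm_intCast]
  calc |(π m : ℝ)| * (‖a m.1‖ * ‖a m.2.1‖ * ‖a m.2.2‖ * ‖a (fourth m)‖)
      ≤ ((1 + |(m.1 : ℝ)|) * (1 + |(m.2.1 : ℝ)|) * (1 + |(m.2.2 : ℝ)|) * (1 + |(fourth m : ℝ)|))
        * (‖a m.1‖ * ‖a m.2.1‖ * ‖a m.2.2‖ * ‖a (fourth m)‖) := by
        gcongr; exact hπ m
    _ = ((1 + |(m.1 : ℝ)|) * ‖a m.1‖) * ((1 + |(m.2.1 : ℝ)|) * ‖a m.2.1‖)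
        * ((1 + |(m.2.2 : ℝ)|) * ‖a m.2.2‖) * ((1 + |(fourth m : ℝ)|) * ‖a (fourth m)‖) := by ring
    _ ≤ _ := by gcongr

/-- The four frequencies play the same role in `quad` and in `nonResAll`, so the sum weighted by
`nⱼ` does not depend on `j`. The four sums add up to `0` because the frequencies do, hence each is
`0`. -/
lemma tsum_fourth_mul_quad_eq_zero (ha : Summable fun k : ℤ => (1 + |(k : ℝ)|) * ‖a k‖) :
    ∑' m, nonResAll.indicator (fun m => (fourth m : ℂ) * quad a m) m = 0 := by
  have key : ∀ {p q r s : ℝ}, 0 ≤ p → 0 ≤ q → 0 ≤ r → 0 ≤ s →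
      p ≤ (1 + p) * (1 + q) * (1 + r) * (1 + s) := by
    intro p q r s hp hq hr hs
    have h1 : 1 ≤ (1 + q) * (1 + r) := by nlinarith [mul_nonneg hq hr]
    have h2 : 1 ≤ (1 + q) * (1 + r) * (1 + s) := by nlinarith [mul_nonneg hq hr]
    nlinarith
  have s1 : Summable fun m : ℤ × ℤ × ℤ => (m.1 : ℂ) * quad a m :=
    (summable_weighted_quad ha fun m => key (abs_nonneg _) (abs_nonneg _) (abs_nonneg _)
      (abs_nonneg _)).of_norm
  have s2 : Summable fun m : ℤ × ℤ × ℤ => (m.2.1 : ℂ) * quad a m :=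
    (summable_weighted_quad ha fun m => by
      have := key (abs_nonneg (m.2.1 : ℝ)) (abs_nonneg (m.1 : ℝ)) (abs_nonneg (m.2.2 : ℝ))
        (abs_nonneg (fourth m : ℝ))
      nlinarith).of_norm
  have s3 : Summable fun m : ℤ × ℤ × ℤ => (m.2.2 : ℂ) * quad a m :=
    (summable_weighted_quad ha fun m => by
      have := key (abs_nonneg (m.2.2 : ℝ)) (abs_nonneg (m.1 : ℝ)) (abs_nonneg (m.2.1 : ℝ))
        (abs_nonneg (fourth m : ℝ))
      nlinarith).of_norm
  have s4 : Summable fun m : ℤ × ℤ × ℤ => (fourth m : ℂ) * quad a m :=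
    (summable_weighted_quad ha fun m => by
      have := key (abs_nonneg (fourth m : ℝ)) (abs_nonneg (m.1 : ℝ)) (abs_nonneg (m.2.1 : ℝ))
        (abs_nonneg (m.2.2 : ℝ))
      nlinarith).of_norm
  have hsym : ∀ (σ : ℤ × ℤ × ℤ ≃ ℤ × ℤ × ℤ) (π : ℤ × ℤ × ℤ → ℤ),
      (∀ m, σ m ∈ nonResAll ↔ m ∈ nonResAll) → (∀ m, quad a (σ m) = quad a m) →
      (∀ m, fourth (σ m) = π m) →
      ∑' m, nonResAll.indicator (fun m => (π m : ℂ) * quad a m) m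
        = ∑' m, nonResAll.indicator (fun m => (fourth m : ℂ) * quad a m) m := by
    intro σ π h1 h2 h3
    rw [← σ.tsum_eq (fun m => nonResAll.indicator (fun m => (fourth m : ℂ) * quad a m) m)]
    refine tsum_congr fun m => ?_
    by_cases hm : m ∈ nonResAll
    · rw [Set.indicator_of_mem hm, Set.indicator_of_mem ((h1 m).2 hm), h2, h3]
    · rw [Set.indicator_of_notMem hm, Set.indicator_of_notMem (fun h => hm ((h1 m).1 h))]
  have t1 := hsym swapFirst (fun m => m.1)
    (fun m => by
      simp only [nonResAll, swapFirst, fourth, Equiv.coe_fn_mk, Set.mem_ofPred_eq]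
      rw [show (-(m.1 + m.2.1 + m.2.2) + m.2.1) * (m.2.1 + m.2.2)
        * (m.2.2 + -(m.1 + m.2.1 + m.2.2)) = (m.1 + m.2.1) * (m.2.1 + m.2.2) * (m.2.2 + m.1) by
          ring])
    (fun m => by
      simp only [quad, swapFirst, fourth, Equiv.coe_fn_mk]
      rw [show -(-(m.1 + m.2.1 + m.2.2) + m.2.1 + m.2.2) = m.1 by ring]; ring)
    (fun m => by simp only [swapFirst, fourth, Equiv.coe_fn_mk]; ring)
  have t2 := hsym swapSecond (fun m => m.2.1)
    (fun m => by
      simp only [nonResAll, swapSecond, fourth, Equiv.coe_fn_mk, Set.mem_ofPred_eq]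
      rw [show (m.1 + -(m.1 + m.2.1 + m.2.2)) * (-(m.1 + m.2.1 + m.2.2) + m.2.2)
        * (m.2.2 + m.1) = (m.1 + m.2.1) * (m.2.1 + m.2.2) * (m.2.2 + m.1) by ring])
    (fun m => by
      simp only [quad, swapSecond, fourth, Equiv.coe_fn_mk]
      rw [show -(m.1 + -(m.1 + m.2.1 + m.2.2) + m.2.2) = m.2.1 by ring]; ring)
    (fun m => by simp only [swapSecond, fourth, Equiv.coe_fn_mk]; ring)
  have t3 := hsym swapThird (fun m => m.2.2)
    (fun m => by
      simp only [nonResAll, swapThird, fourth, Equiv.coe_fn_mk, Set.mem_ofPred_eq]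
      rw [show (m.1 + m.2.1) * (m.2.1 + -(m.1 + m.2.1 + m.2.2))
        * (-(m.1 + m.2.1 + m.2.2) + m.1) = (m.1 + m.2.1) * (m.2.1 + m.2.2) * (m.2.2 + m.1) by
          ring])
    (fun m => by
      simp only [quad, swapThird, fourth, Equiv.coe_fn_mk]
      rw [show -(m.1 + m.2.1 + -(m.1 + m.2.1 + m.2.2)) = m.2.2 by ring]; ring)
    (fun m => by simp only [swapThird, fourth, Equiv.coe_fn_mk]; ring)
  have hsum : ∑' m, nonResAll.indicator (fun m => (m.1 : ℂ) * quad a m) m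
      + ∑' m, nonResAll.indicator (fun m => (m.2.1 : ℂ) * quad a m) m
      + ∑' m, nonResAll.indicator (fun m => (m.2.2 : ℂ) * quad a m) m
      + ∑' m, nonResAll.indicator (fun m => (fourth m : ℂ) * quad a m) m = 0 := by
    rw [← (s1.indicator _).tsum_add (s2.indicator _),
      ← ((s1.indicator _).add (s2.indicator _)).tsum_add (s3.indicator _),
      ← (((s1.indicator _).add (s2.indicator _)).add (s3.indicator _)).tsum_add (s4.indicator _)]
    rw [← tsum_zero (β := ℤ × ℤ × ℤ)]
    refine tsum_congr fun m => ?_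
    by_cases hm : m ∈ nonResAll
    · simp only [Set.indicator_of_mem hm, fourth]
      push_cast; ring
    · simp only [Set.indicator_of_notMem hm, add_zero]
  rw [t1, t2, t3] at hsum
  linear_combination hsum / 4

/-- The symmetry behind the conservation of the `L²` norm. -/
lemma tsum_cubic_mul_eq_zero (ha : Summable fun k : ℤ => (1 + |(k : ℝ)|) * ‖a k‖) :
    ∑' k : ℤ, (k : ℂ) * (cubic a k * a (-k)) = 0 := by
  have s4 : Summable fun m : ℤ × ℤ × ℤ => (fourth m : ℂ) * quad a m :=
    (summable_weighted_quad ha fun m => by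
      have h1 := abs_nonneg (m.1 : ℝ)
      have h2 := abs_nonneg (m.2.1 : ℝ)
      have h3 := abs_nonneg (m.2.2 : ℝ)
      have h4 := abs_nonneg (fourth m : ℝ)
      have : 1 ≤ (1 + |(m.1 : ℝ)|) * (1 + |(m.2.1 : ℝ)|) := by nlinarith [mul_nonneg h1 h2]
      have : 1 ≤ (1 + |(m.1 : ℝ)|) * (1 + |(m.2.1 : ℝ)|) * (1 + |(m.2.2 : ℝ)|) := by nlinarith
      nlinarith).of_norm
  have h := tsum_fourth_mul_quad_eq_zero ha
  have hs : Summable fun m => nonResAll.indicator (fun m => (fourth m : ℂ) * quad a m)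
      (fiberEquiv m) := fiberEquiv.summable_iff.2 (s4.indicator nonResAll)
  rw [← fiberEquiv.tsum_eq, hs.tsum_prod] at h
  rw [← neg_eq_zero, ← tsum_neg, ← h]
  refine tsum_congr fun k => ?_
  rw [cubic_eq_tsum, ← tsum_mul_right, ← tsum_mul_left, ← tsum_neg]
  refine tsum_congr fun j => ?_
  have e : fourth (fiber k j) = -k := by simp only [fourth, fiber]; ring
  by_cases hj : j ∈ fiber k ⁻¹' nonResAll
  · have hj' : fiberEquiv (k, j) ∈ nonResAll := hj
    rw [Set.indicator_of_mem hj, Set.indicator_of_mem hj']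
    change -((k : ℂ) * (a j.1 * a j.2 * a (k - j.1 - j.2) * a (-k)))
      = (fourth (fiber k j) : ℂ) * (a j.1 * a j.2 * a (k - j.1 - j.2) * a (fourth (fiber k j)))
    rw [e]; push_cast; ring
  · have hj' : fiberEquiv (k, j) ∉ nonResAll := hj
    rw [Set.indicator_of_notMem hj, Set.indicator_of_notMem hj']
    simp

end Conservation

/-! ### Square-summable weights and Cauchy–Schwarz over injectively parametrized sums. -/

section FiniteSums

/-- `max(1, |k|)^{-θ}`. -/
noncomputable def decayWeight (θ : ℝ) (k : ℤ) : ℝ := (max 1 |(k : ℝ)|) ^ (-θ)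

/-- The square of the `ℓ²` norm of `decayWeight θ`. -/
noncomputable def decayConst (θ : ℝ) : ℝ := ∑' k, decayWeight θ k ^ 2

lemma decayWeight_nonneg (θ : ℝ) (k : ℤ) : 0 ≤ decayWeight θ k := by
  unfold decayWeight; positivity

lemma decayConst_nonneg (θ : ℝ) : 0 ≤ decayConst θ := tsum_nonneg fun _ => by positivity

lemma summable_decayWeight_sq {θ : ℝ} (hθ : 1 / 2 < θ) :
    Summable fun k => decayWeight θ k ^ 2 := by
  have h1 : Summable fun k : ℤ => |(k : ℝ)| ^ (-(2 * θ)) :=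
    Real.summable_abs_int_rpow (by linarith)
  have h2 : Summable fun k : ℤ => if k = 0 then (1 : ℝ) else 0 :=
    summable_of_ne_finset_zero (s := {0}) (by simp)
  refine Summable.of_nonneg_of_le (fun k => by positivity) (fun k => ?_) (h1.add h2)
  have h0 : (0 : ℝ) ≤ max 1 |(k : ℝ)| := le_trans zero_le_one (le_max_left _ _)
  rw [decayWeight, ← Real.rpow_natCast, ← Real.rpow_mul h0]
  have he : -θ * ((2 : ℕ) : ℝ) = -(2 * θ) := by push_cast; ring
  rw [he]
  by_cases hk : k = 0
  · simp only [hk, Int.cast_zero, abs_zero, if_true]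
    rw [max_eq_left zero_le_one, Real.one_rpow]
    have := Real.rpow_nonneg (le_refl (0 : ℝ)) (-(2 * θ))
    linarith
  · have : (1 : ℝ) ≤ |(k : ℝ)| := by exact_mod_cast Int.one_le_abs hk
    rw [max_eq_right this, if_neg hk, add_zero]

lemma abs_freq_rpow {L : ℝ} (hL : 1 ≤ L) (θ : ℝ) {k : ℤ} (hk : k ≠ 0) :
    |freq L k| ^ (-θ) = L ^ θ * decayWeight θ k := by
  have h1 : (1 : ℝ) ≤ |(k : ℝ)| := by exact_mod_cast Int.one_le_abs hk
  have hL0 : 0 < L := by linarith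
  rw [decayWeight, max_eq_right h1, freq, abs_div, abs_of_pos hL0,
    Real.div_rpow (abs_nonneg _) hL0.le, Real.rpow_neg hL0.le]
  field_simp

variable {ι : Type*} {S : Finset ι}

lemma sum_pair_le {f g : ℤ → ℝ} (hf : Summable f) (hg : Summable g) (hf0 : ∀ k, 0 ≤ f k)
    (hg0 : ∀ k, 0 ≤ g k) {φ : ι → ℤ × ℤ} (hφ : Set.InjOn φ S) :
    ∑ m ∈ S, f (φ m).1 * g (φ m).2 ≤ (∑' k, f k) * ∑' k, g k := by
  classical
  have hs : Summable fun j : ℤ × ℤ => f j.1 * g j.2 := hf.mul_of_nonneg hg hf0 hg0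
  rw [hf.tsum_mul_tsum hg hs, ← Finset.sum_image (f := fun j : ℤ × ℤ => f j.1 * g j.2) hφ]
  exact hs.sum_le_tsum _ fun _ _ => mul_nonneg (hf0 _) (hg0 _)

lemma sum_triple_le {f g h : ℤ → ℝ} (hf : Summable f) (hg : Summable g) (hh : Summable h)
    (hf0 : ∀ k, 0 ≤ f k) (hg0 : ∀ k, 0 ≤ g k) (hh0 : ∀ k, 0 ≤ h k)
    {φ : ι → ℤ × ℤ × ℤ} (hφ : Set.InjOn φ S) :
    ∑ m ∈ S, f (φ m).1 * g (φ m).2.1 * h (φ m).2.2 ≤ (∑' k, f k) * (∑' k, g k) * ∑' k, h k := by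
  classical
  have h1 : Summable fun m : ℤ × ℤ => g m.1 * h m.2 := hg.mul_of_nonneg hh hg0 hh0
  have h2 : Summable fun m : ℤ × ℤ × ℤ => f m.1 * (g m.2.1 * h m.2.2) :=
    hf.mul_of_nonneg h1 hf0 (fun m => mul_nonneg (hg0 _) (hh0 _))
  have h3 : Summable fun m : ℤ × ℤ × ℤ => f m.1 * g m.2.1 * h m.2.2 :=
    h2.congr fun m => by ring
  rw [mul_assoc, hg.tsum_mul_tsum hh h1, hf.tsum_mul_tsum h1 h2,
    ← Finset.sum_image (f := fun j : ℤ × ℤ × ℤ => f j.1 * g j.2.1 * h j.2.2) hφ]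
  refine (h3.sum_le_tsum _ fun _ _ => mul_nonneg (mul_nonneg (hf0 _) (hg0 _)) (hh0 _)).trans ?_
  exact le_of_eq (tsum_congr fun m => by ring)

/-- Cauchy–Schwarz for sums over pairs. -/
lemma sum_pair_mul_pair_le {f g : ℤ → ℝ} (hf : Summable fun k => f k ^ 2)
    (hg : Summable fun k => g k ^ 2) {φ η : ι → ℤ × ℤ} (hφ : Set.InjOn φ S)
    (hη : Set.InjOn η S) :
    ∑ m ∈ S, (f (φ m).1 * f (φ m).2) * (g (η m).1 * g (η m).2)
      ≤ (∑' k, f k ^ 2) * ∑' k, g k ^ 2 := by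
  have hf0 : 0 ≤ ∑' k, f k ^ 2 := tsum_nonneg fun _ => by positivity
  have hg0 : 0 ≤ ∑' k, g k ^ 2 := tsum_nonneg fun _ => by positivity
  refine (Real.sum_mul_le_sqrt_mul_sqrt S _ _).trans ?_
  gcongr
  · refine Real.sqrt_le_iff.2 ⟨hf0, ?_⟩
    simp_rw [mul_pow]
    rw [sq (∑' k, f k ^ 2)]
    exact sum_pair_le hf hf (fun _ => by positivity) (fun _ => by positivity) hφ
  · refine Real.sqrt_le_iff.2 ⟨hg0, ?_⟩
    simp_rw [mul_pow]
    rw [sq (∑' k, g k ^ 2)]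
    exact sum_pair_le hg hg (fun _ => by positivity) (fun _ => by positivity) hη

/-- Cauchy–Schwarz for sums over triples. -/
lemma sum_triple_mul_triple_le {f g : ℤ → ℝ} (hf : Summable fun k => f k ^ 2)
    (hg : Summable fun k => g k ^ 2) {φ η : ι → ℤ × ℤ × ℤ} (hφ : Set.InjOn φ S)
    (hη : Set.InjOn η S) :
    ∑ m ∈ S, (f (φ m).1 * f (φ m).2.1 * f (φ m).2.2) * (g (η m).1 * g (η m).2.1 * g (η m).2.2)
      ≤ √((∑' k, f k ^ 2) ^ 3) * √((∑' k, g k ^ 2) ^ 3) := by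
  refine (Real.sum_mul_le_sqrt_mul_sqrt S _ _).trans ?_
  gcongr
  · simp_rw [mul_pow]
    rw [pow_succ, sq]
    exact sum_triple_le hf hf hf (fun _ => by positivity) (fun _ => by positivity)
      (fun _ => by positivity) hφ
  · simp_rw [mul_pow]
    rw [pow_succ, sq]
    exact sum_triple_le hg hg hg (fun _ => by positivity) (fun _ => by positivity)
      (fun _ => by positivity) hη

end FiniteSums

/-! ### Multilinear sums weighted by the inverse resonance. -/

section QuadSums

/-- The products of three of the four factors. -/
noncomputable def tripleSum (a : ℤ → ℂ) (m : ℤ × ℤ × ℤ) : ℝ :=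
  ‖a m.2.1‖ * ‖a m.2.2‖ * ‖a (fourth m)‖ + ‖a m.1‖ * ‖a m.2.2‖ * ‖a (fourth m)‖
    + ‖a m.1‖ * ‖a m.2.1‖ * ‖a (fourth m)‖ + ‖a m.1‖ * ‖a m.2.1‖ * ‖a m.2.2‖

/-- The symmetric sum of products of `decayWeight` at the pair sums. -/
noncomputable def pairDecay (θ : ℝ) (m : ℤ × ℤ × ℤ) : ℝ :=
  decayWeight θ (m.1 + m.2.1) * decayWeight θ (m.2.1 + m.2.2)
    + decayWeight θ (m.2.1 + m.2.2) * decayWeight θ (m.2.2 + m.1)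
    + decayWeight θ (m.2.2 + m.1) * decayWeight θ (m.1 + m.2.1)

variable {a : ℤ → ℂ} {L : ℝ} {k : ℤ} {S : Finset (ℤ × ℤ × ℤ)}

lemma pairDecay_nonneg (θ : ℝ) (m : ℤ × ℤ × ℤ) : 0 ≤ pairDecay θ m :=
  add_nonneg (add_nonneg (mul_nonneg (decayWeight_nonneg _ _) (decayWeight_nonneg _ _))
    (mul_nonneg (decayWeight_nonneg _ _) (decayWeight_nonneg _ _)))
    (mul_nonneg (decayWeight_nonneg _ _) (decayWeight_nonneg _ _))

lemma ne_zero_of_mem_nonResAll {m : ℤ × ℤ × ℤ} (hm : m ∈ nonResAll) :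
    m.1 + m.2.1 ≠ 0 ∧ m.2.1 + m.2.2 ≠ 0 ∧ m.2.2 + m.1 ≠ 0 := by
  have hm' : (m.1 + m.2.1) * (m.2.1 + m.2.2) * (m.2.2 + m.1) ≠ 0 := hm
  simp only [ne_eq, mul_eq_zero, not_or] at hm'
  exact ⟨hm'.1.1, hm'.1.2, hm'.2⟩

lemma pairWeight_eq (hL : 1 ≤ L) {m : ℤ × ℤ × ℤ} (hm : m ∈ nonResAll) :
    pairWeight |freq L (m.1 + m.2.1)| |freq L (m.2.1 + m.2.2)| |freq L (m.2.2 + m.1)|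
      = L ^ (4 / 3 : ℝ) * pairDecay (2 / 3) m := by
  obtain ⟨h1, h2, h3⟩ := ne_zero_of_mem_nonResAll hm
  have hLL : L ^ (4 / 3 : ℝ) = L ^ (2 / 3 : ℝ) * L ^ (2 / 3 : ℝ) := by
    rw [← Real.rpow_add (by linarith)]; norm_num
  rw [pairWeight, abs_freq_rpow hL _ h1, abs_freq_rpow hL _ h2, abs_freq_rpow hL _ h3, pairDecay,
    hLL]
  ring

lemma sum_inv_eq (hL : 1 ≤ L) {m : ℤ × ℤ × ℤ} (hm : m ∈ nonResAll) :
    |freq L (m.1 + m.2.1)|⁻¹ * |freq L (m.2.1 + m.2.2)|⁻¹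
      + |freq L (m.2.1 + m.2.2)|⁻¹ * |freq L (m.2.2 + m.1)|⁻¹
      + |freq L (m.2.2 + m.1)|⁻¹ * |freq L (m.1 + m.2.1)|⁻¹ = L ^ 2 * pairDecay 1 m := by
  obtain ⟨h1, h2, h3⟩ := ne_zero_of_mem_nonResAll hm
  rw [← Real.rpow_neg_one, ← Real.rpow_neg_one, ← Real.rpow_neg_one, abs_freq_rpow hL _ h1,
    abs_freq_rpow hL _ h2, abs_freq_rpow hL _ h3, pairDecay, Real.rpow_one]
  ring

lemma inv_one_add_sq_le (hL : 1 ≤ L) {j : ℤ} (hj : j ≠ 0) :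
    (1 + |freq L j| ^ 2)⁻¹ ≤ L ^ (4 / 3 : ℝ) * decayWeight (2 / 3) j ^ 2 := by
  have hx : 0 < |freq L j| := (by positivity : 0 < L⁻¹).trans_le (inv_le_abs_freq hL hj)
  have hLL : L ^ (4 / 3 : ℝ) = (L ^ (2 / 3 : ℝ)) ^ 2 := by
    rw [← Real.rpow_natCast, ← Real.rpow_mul (by linarith)]; norm_num
  rw [hLL, ← mul_pow, ← abs_freq_rpow hL _ hj, Real.rpow_neg hx.le, inv_pow]
  apply inv_anti₀ (by positivity)
  rw [← Real.rpow_natCast, ← Real.rpow_mul hx.le]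
  rcases le_total |freq L j| 1 with h | h
  · have := Real.rpow_le_one hx.le h (by norm_num : (0 : ℝ) ≤ 2 / 3 * ((2 : ℕ) : ℝ))
    nlinarith
  · have := Real.rpow_le_rpow_of_exponent_le h (by norm_num : 2 / 3 * ((2 : ℕ) : ℝ) ≤ (2 : ℕ))
    rw [Real.rpow_natCast] at this
    linarith

lemma inv_one_add_size_le (hL : 1 ≤ L) (m : ℤ × ℤ × ℤ) :
    (1 + freqSize L m)⁻¹ ≤ L ^ (2 / 3 : ℝ) * decayWeight (2 / 3) (fourth m) := by
  have hN : |freq L (fourth m)| ≤ freqSize L m := by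
    unfold freqSize
    have := abs_nonneg (freq L m.1)
    have := abs_nonneg (freq L m.2.1)
    have := abs_nonneg (freq L m.2.2)
    linarith
  have hN0 : 0 ≤ freqSize L m := (abs_nonneg _).trans hN
  -- Unlike the pair sums, the fourth frequency may vanish; the truncation at `1` in `decayWeight`
  -- covers this case.
  by_cases h : fourth m = 0
  · have h1 : decayWeight (2 / 3) (fourth m) = 1 := by simp [decayWeight, h]
    rw [h1, mul_one]
    exact (inv_le_one_of_one_le₀ (by linarith)).trans (Real.one_le_rpow hL (by norm_num))
  · have hx : 0 < |freq L (fourth m)| := (by positivity : 0 < L⁻¹).trans_le (inv_le_abs_freq hL h)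
    rw [← abs_freq_rpow hL _ h, Real.rpow_neg hx.le]
    apply inv_anti₀ (by positivity)
    rcases le_total |freq L (fourth m)| 1 with h1 | h1
    · have := Real.rpow_le_one hx.le h1 (by norm_num : (0 : ℝ) ≤ 2 / 3)
      linarith
    · have := Real.rpow_le_rpow_of_exponent_le h1 (by norm_num : (2 / 3 : ℝ) ≤ 1)
      rw [Real.rpow_one] at this
      linarith

/-- With the output frequency fixed, a triple has two degrees of freedom. It is determined by two of
its pair sums and also by the two entries selected by `η`, so Cauchy–Schwarz separates the weights
from the coefficients. -/
lemma sum_pairDecay_mul_le (ha : Summable fun k => ‖a k‖) {θ : ℝ} (hθ : 1 / 2 < θ)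
    (hS : ∀ m ∈ S, m ∈ nonRes k) {η : ℤ × ℤ × ℤ → ℤ × ℤ} (hη : Set.InjOn η S) :
    ∑ m ∈ S, pairDecay θ m * (‖a (η m).1‖ * ‖a (η m).2‖) ≤ 3 * (decayConst θ * mass a) := by
  have hf := summable_decayWeight_sq hθ
  have hg := summable_norm_sq ha
  have hk : ∀ m ∈ S, m.1 + m.2.1 + m.2.2 = k := fun m hm => (hS m hm).1
  simp only [pairDecay, add_mul, Finset.sum_add_distrib]
  have h1 := sum_pair_mul_pair_le (S := S) hf hg (η := η)
    (φ := fun m : ℤ × ℤ × ℤ => (m.1 + m.2.1, m.2.1 + m.2.2)) (fun m hm n hn h => by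
      have e1 := hk m hm
      have e2 := hk n hn
      simp only [Prod.mk.injEq] at h
      ext <;> omega) hη
  have h2 := sum_pair_mul_pair_le (S := S) hf hg (η := η)
    (φ := fun m : ℤ × ℤ × ℤ => (m.2.1 + m.2.2, m.2.2 + m.1)) (fun m hm n hn h => by
      have e1 := hk m hm
      have e2 := hk n hn
      simp only [Prod.mk.injEq] at h
      ext <;> omega) hη
  have h3 := sum_pair_mul_pair_le (S := S) hf hg (η := η)
    (φ := fun m : ℤ × ℤ × ℤ => (m.2.2 + m.1, m.1 + m.2.1)) (fun m hm n hn h => by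
      have e1 := hk m hm
      have e2 := hk n hn
      simp only [Prod.mk.injEq] at h
      ext <;> omega) hη
  rw [decayConst, mass]
  linarith

/-- Two of the four coefficients enter the `ℓ²` sum; the other two are bounded pointwise by `√M`. -/
lemma sum_fixed_quad_le (ha : Summable fun k => ‖a k‖) {θ : ℝ} (hθ : 1 / 2 < θ)
    (hS : ∀ m ∈ S, m ∈ nonRes k) :
    ∑ m ∈ S, pairDecay θ m * ‖quad a m‖ ≤ 3 * (decayConst θ * mass a ^ 2) := by
  have hk : ∀ m ∈ S, m.1 + m.2.1 + m.2.2 = k := fun m hm => (hS m hm).1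
  have h := sum_pairDecay_mul_le ha hθ hS (η := fun m => (m.1, m.2.1)) (fun m hm n hn h => by
      have e1 := hk m hm
      have e2 := hk n hn
      simp only [Prod.mk.injEq] at h
      ext <;> omega)
  have hp := pairDecay_nonneg θ
  calc ∑ m ∈ S, pairDecay θ m * ‖quad a m‖
      ≤ ∑ m ∈ S, mass a * (pairDecay θ m * (‖a m.1‖ * ‖a m.2.1‖)) := by
        refine Finset.sum_le_sum fun m _ => ?_
        have h3 := norm_le_sqrt_mass ha m.2.2
        have h4 := norm_le_sqrt_mass ha (fourth m)
        have h5 : ‖a m.2.2‖ * ‖a (fourth m)‖ ≤ mass a := by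
          rw [← Real.mul_self_sqrt (mass_nonneg a)]; gcongr
        rw [quad, norm_mul, norm_mul, norm_mul]
        calc pairDecay θ m * (‖a m.1‖ * ‖a m.2.1‖ * ‖a m.2.2‖ * ‖a (fourth m)‖)
            = (‖a m.2.2‖ * ‖a (fourth m)‖) * (pairDecay θ m * (‖a m.1‖ * ‖a m.2.1‖)) := by ring
          _ ≤ _ := by
            have := hp m
            gcongr
    _ = mass a * ∑ m ∈ S, pairDecay θ m * (‖a m.1‖ * ‖a m.2.1‖) := by rw [Finset.mul_sum]
    _ ≤ mass a * (3 * (decayConst θ * mass a)) := mul_le_mul_of_nonneg_left h (mass_nonneg a)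
    _ = _ := by ring

lemma sum_fixed_tripleSum_le (ha : Summable fun k => ‖a k‖) {θ : ℝ} (hθ : 1 / 2 < θ)
    (hS : ∀ m ∈ S, m ∈ nonRes k) :
    ∑ m ∈ S, pairDecay θ m * tripleSum a m
      ≤ 12 * (decayConst θ * (mass a * √(mass a))) := by
  have hk : ∀ m ∈ S, m.1 + m.2.1 + m.2.2 = k := fun m hm => (hS m hm).1
  have h12 := sum_pairDecay_mul_le ha hθ hS (η := fun m => (m.1, m.2.1)) (fun m hm n hn h => by
      have e1 := hk m hm
      have e2 := hk n hn
      simp only [Prod.mk.injEq] at h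
      ext <;> omega)
  have h13 := sum_pairDecay_mul_le ha hθ hS (η := fun m => (m.1, m.2.2)) (fun m hm n hn h => by
      have e1 := hk m hm
      have e2 := hk n hn
      simp only [Prod.mk.injEq] at h
      ext <;> omega)
  have h23 := sum_pairDecay_mul_le ha hθ hS (η := fun m => (m.2.1, m.2.2)) (fun m hm n hn h => by
      have e1 := hk m hm
      have e2 := hk n hn
      simp only [Prod.mk.injEq] at h
      ext <;> omega)
  have hp := pairDecay_nonneg θ
  calc ∑ m ∈ S, pairDecay θ m * tripleSum a m
      ≤ ∑ m ∈ S, √(mass a) * (pairDecay θ m * (‖a m.2.1‖ * ‖a m.2.2‖)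
          + pairDecay θ m * (‖a m.1‖ * ‖a m.2.2‖) + 2 * (pairDecay θ m * (‖a m.1‖ * ‖a m.2.1‖))) := by
        refine Finset.sum_le_sum fun m _ => ?_
        have h3 := norm_le_sqrt_mass ha m.2.2
        have h4 := norm_le_sqrt_mass ha (fourth m)
        have := hp m
        have e1 : ‖a m.2.1‖ * ‖a m.2.2‖ * ‖a (fourth m)‖ ≤ ‖a m.2.1‖ * ‖a m.2.2‖ * √(mass a) := by
          gcongr
        have e2 : ‖a m.1‖ * ‖a m.2.2‖ * ‖a (fourth m)‖ ≤ ‖a m.1‖ * ‖a m.2.2‖ * √(mass a) := by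
          gcongr
        have e3 : ‖a m.1‖ * ‖a m.2.1‖ * ‖a (fourth m)‖ ≤ ‖a m.1‖ * ‖a m.2.1‖ * √(mass a) := by
          gcongr
        have e4 : ‖a m.1‖ * ‖a m.2.1‖ * ‖a m.2.2‖ ≤ ‖a m.1‖ * ‖a m.2.1‖ * √(mass a) := by
          gcongr
        calc pairDecay θ m * tripleSum a m
            ≤ pairDecay θ m * (‖a m.2.1‖ * ‖a m.2.2‖ * √(mass a)
              + ‖a m.1‖ * ‖a m.2.2‖ * √(mass a) + ‖a m.1‖ * ‖a m.2.1‖ * √(mass a)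
              + ‖a m.1‖ * ‖a m.2.1‖ * √(mass a)) := by
              refine mul_le_mul_of_nonneg_left ?_ (hp m)
              unfold tripleSum
              linarith
          _ = _ := by ring
    _ = √(mass a) * (∑ m ∈ S, pairDecay θ m * (‖a m.2.1‖ * ‖a m.2.2‖)
          + ∑ m ∈ S, pairDecay θ m * (‖a m.1‖ * ‖a m.2.2‖)
          + 2 * ∑ m ∈ S, pairDecay θ m * (‖a m.1‖ * ‖a m.2.1‖)) := by
        rw [← Finset.mul_sum, Finset.sum_add_distrib, Finset.sum_add_distrib, ← Finset.mul_sum]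
    _ ≤ √(mass a) * (12 * (decayConst θ * mass a)) :=
        mul_le_mul_of_nonneg_left (by linarith) (Real.sqrt_nonneg _)
    _ = _ := by ring

/-- Boundary terms at fixed output frequency. -/
lemma fixed_boundary_le (hL : 1 ≤ L) (ha : Summable fun k => ‖a k‖)
    (hS : ∀ m ∈ S, m ∈ nonRes k) :
    ∑ m ∈ S, freq L k ^ 2 / resWeight L m * ‖quad a m‖
      ≤ 12 * decayConst (2 / 3) * (L ^ (4 / 3 : ℝ) * mass a ^ 2) := by
  have hLp : 0 ≤ L ^ (4 / 3 : ℝ) := by positivity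
  calc ∑ m ∈ S, freq L k ^ 2 / resWeight L m * ‖quad a m‖
      ≤ ∑ m ∈ S, 4 * L ^ (4 / 3 : ℝ) * (pairDecay (2 / 3) m * ‖quad a m‖) := by
        refine Finset.sum_le_sum fun m hm => ?_
        have hn : m ∈ nonResAll := (hS m hm).2
        obtain ⟨⟨hx, hy, hz⟩, -, hb⟩ := pair_sum_bounds hL hn
        have h1 := sq_div_le_pairWeight hx hy hz (freqSize_pos hL hn) hb
        rw [pairWeight_eq hL hn] at h1
        have h2 : freq L k ^ 2 ≤ freqSize L m ^ 2 := by
          rw [← sq_abs, show k = -fourth m by rw [← (hS m hm).1, fourth, neg_neg], freq_neg, abs_neg]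
          unfold freqSize
          gcongr
          have := abs_nonneg (freq L m.1)
          have := abs_nonneg (freq L m.2.1)
          have := abs_nonneg (freq L m.2.2)
          linarith
        rw [← mul_assoc]
        refine mul_le_mul_of_nonneg_right ?_ (norm_nonneg _)
        refine (div_le_div_of_nonneg_right h2 (by linarith [one_le_resWeight L m])).trans ?_
        refine h1.trans (le_of_eq (by ring))
    _ = 4 * L ^ (4 / 3 : ℝ) * ∑ m ∈ S, pairDecay (2 / 3) m * ‖quad a m‖ := by rw [Finset.mul_sum]
    _ ≤ 4 * L ^ (4 / 3 : ℝ) * (3 * (decayConst (2 / 3) * mass a ^ 2)) :=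
        mul_le_mul_of_nonneg_left (sum_fixed_quad_le ha (by norm_num) hS) (by positivity)
    _ = _ := by ring

lemma tripleSum_nonneg (a : ℤ → ℂ) (m : ℤ × ℤ × ℤ) : 0 ≤ tripleSum a m := by
  unfold tripleSum; positivity

/-- Nonlinear terms at fixed output frequency. -/
lemma fixed_nonlinear_le (hL : 1 ≤ L) (ha : Summable fun k => ‖a k‖)
    (hS : ∀ m ∈ S, m ∈ nonRes k) :
    ∑ m ∈ S, freq L k ^ 2 / resWeight L m * (freqSize L m * tripleSum a m)
      ≤ 72 * decayConst 1 * (L ^ 2 * (mass a * √(mass a))) := by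
  calc ∑ m ∈ S, freq L k ^ 2 / resWeight L m * (freqSize L m * tripleSum a m)
      ≤ ∑ m ∈ S, 6 * L ^ 2 * (pairDecay 1 m * tripleSum a m) := by
        refine Finset.sum_le_sum fun m hm => ?_
        have hn : m ∈ nonResAll := (hS m hm).2
        obtain ⟨⟨hx, hy, hz⟩, -, hb⟩ := pair_sum_bounds hL hn
        have hN := freqSize_pos hL hn
        have h1 := cube_div_le hx hy hz hN hb
        rw [sum_inv_eq hL hn] at h1
        have h2 : freq L k ^ 2 ≤ freqSize L m ^ 2 := by
          rw [← sq_abs, show k = -fourth m by rw [← (hS m hm).1, fourth, neg_neg], freq_neg, abs_neg]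
          unfold freqSize
          gcongr
          have := abs_nonneg (freq L m.1)
          have := abs_nonneg (freq L m.2.1)
          have := abs_nonneg (freq L m.2.2)
          linarith
        rw [← mul_assoc, ← mul_assoc]
        refine mul_le_mul_of_nonneg_right ?_ (tripleSum_nonneg a m)
        have hD : 0 < resWeight L m := by linarith [one_le_resWeight L m]
        calc freq L k ^ 2 / resWeight L m * freqSize L m
            ≤ freqSize L m ^ 2 / resWeight L m * freqSize L m := by gcongr
          _ = freqSize L m ^ 3 / resWeight L m := by ring
          _ ≤ _ := h1.trans (le_of_eq (by ring))
    _ = 6 * L ^ 2 * ∑ m ∈ S, pairDecay 1 m * tripleSum a m := by rw [Finset.mul_sum]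
    _ ≤ 6 * L ^ 2 * (12 * (decayConst 1 * (mass a * √(mass a)))) :=
        mul_le_mul_of_nonneg_left (sum_fixed_tripleSum_le ha (by norm_num) hS) (by positivity)
    _ = _ := by ring

/-- With three free frequencies and a weight in one variable only, `2AB ≤ A² + B²` splits the four
coefficients into two pairs. Each pair together with `σ` determines the triple, so summability of
`κ` is enough. -/
lemma sum_weight_quad_le (ha : Summable fun k => ‖a k‖) {κ : ℤ → ℝ} (hκ : Summable κ)
    (hκ0 : ∀ k, 0 ≤ κ k) {η₁ η₂ : ℤ × ℤ × ℤ → ℤ × ℤ} {σ : ℤ × ℤ × ℤ → ℤ}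
    (h₁ : Set.InjOn (fun m => ((η₁ m).1, (η₁ m).2, σ m)) S)
    (h₂ : Set.InjOn (fun m => ((η₂ m).1, (η₂ m).2, σ m)) S)
    (hq : ∀ m, ‖quad a m‖ = (‖a (η₁ m).1‖ * ‖a (η₁ m).2‖) * (‖a (η₂ m).1‖ * ‖a (η₂ m).2‖)) :
    ∑ m ∈ S, κ (σ m) * ‖quad a m‖ ≤ (∑' k, κ k) * mass a ^ 2 := by
  have hg := summable_norm_sq ha
  have e1 := sum_triple_le hg hg hκ (fun _ => by positivity) (fun _ => by positivity) hκ0 h₁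
  have e2 := sum_triple_le hg hg hκ (fun _ => by positivity) (fun _ => by positivity) hκ0 h₂
  rw [← mass] at e1 e2
  calc ∑ m ∈ S, κ (σ m) * ‖quad a m‖
      ≤ ∑ m ∈ S, (1 / 2 * (‖a (η₁ m).1‖ ^ 2 * ‖a (η₁ m).2‖ ^ 2 * κ (σ m))
          + 1 / 2 * (‖a (η₂ m).1‖ ^ 2 * ‖a (η₂ m).2‖ ^ 2 * κ (σ m))) := by
        refine Finset.sum_le_sum fun m _ => ?_
        rw [hq m]
        have := mul_nonneg (hκ0 (σ m)) (sq_nonneg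
          (‖a (η₁ m).1‖ * ‖a (η₁ m).2‖ - ‖a (η₂ m).1‖ * ‖a (η₂ m).2‖))
        linarith
    _ = 1 / 2 * ∑ m ∈ S, ‖a (η₁ m).1‖ ^ 2 * ‖a (η₁ m).2‖ ^ 2 * κ (σ m)
        + 1 / 2 * ∑ m ∈ S, ‖a (η₂ m).1‖ ^ 2 * ‖a (η₂ m).2‖ ^ 2 * κ (σ m) := by
        rw [Finset.sum_add_distrib, ← Finset.mul_sum, ← Finset.mul_sum]
    _ ≤ _ := by linarith

/-- Boundary terms summed over all non-resonant triples. -/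
lemma all_boundary_le (hL : 1 ≤ L) (ha : Summable fun k => ‖a k‖)
    (hS : ∀ m ∈ S, m ∈ nonResAll) :
    ∑ m ∈ S, 1 / resWeight L m * ‖quad a m‖
      ≤ 6 * decayConst (2 / 3) * (L ^ (4 / 3 : ℝ) * mass a ^ 2) := by
  have hκ := summable_decayWeight_sq (θ := 2 / 3) (by norm_num)
  have hκ0 : ∀ k, 0 ≤ decayWeight (2 / 3) k ^ 2 := fun k => by positivity
  have e1 := sum_weight_quad_le (S := S) ha hκ hκ0
    (η₁ := fun m => (m.1, m.2.2)) (η₂ := fun m => (m.2.1, fourth m)) (σ := fun m => m.1 + m.2.1)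
    (fun m _ n _ h => by simp only [Prod.mk.injEq] at h; ext <;> omega)
    (fun m _ n _ h => by simp only [Prod.mk.injEq, fourth] at h; ext <;> omega)
    (fun m => by simp only [quad, norm_mul]; ring)
  have e2 := sum_weight_quad_le (S := S) ha hκ hκ0
    (η₁ := fun m => (m.1, m.2.2)) (η₂ := fun m => (m.2.1, fourth m)) (σ := fun m => m.2.1 + m.2.2)
    (fun m _ n _ h => by simp only [Prod.mk.injEq] at h; ext <;> omega)
    (fun m _ n _ h => by simp only [Prod.mk.injEq, fourth] at h; ext <;> omega)
    (fun m => by simp only [quad, norm_mul]; ring)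
  have e3 := sum_weight_quad_le (S := S) ha hκ hκ0
    (η₁ := fun m => (m.1, m.2.1)) (η₂ := fun m => (m.2.2, fourth m)) (σ := fun m => m.2.2 + m.1)
    (fun m _ n _ h => by simp only [Prod.mk.injEq] at h; ext <;> omega)
    (fun m _ n _ h => by simp only [Prod.mk.injEq, fourth] at h; ext <;> omega)
    (fun m => by simp only [quad, norm_mul]; ring)
  calc ∑ m ∈ S, 1 / resWeight L m * ‖quad a m‖
      ≤ ∑ m ∈ S, 2 * L ^ (4 / 3 : ℝ) * (decayWeight (2 / 3) (m.1 + m.2.1) ^ 2 * ‖quad a m‖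
        + decayWeight (2 / 3) (m.2.1 + m.2.2) ^ 2 * ‖quad a m‖
        + decayWeight (2 / 3) (m.2.2 + m.1) ^ 2 * ‖quad a m‖) := by
        refine Finset.sum_le_sum fun m hm => ?_
        have hn := hS m hm
        obtain ⟨⟨hx, hy, hz⟩, ⟨hxN, hyN, hzN⟩, -⟩ := pair_sum_bounds hL hn
        obtain ⟨h1, h2, h3⟩ := ne_zero_of_mem_nonResAll hn
        have h := one_div_le hx hy hz hxN hyN hzN
        have i1 := inv_one_add_sq_le hL h1
        have i2 := inv_one_add_sq_le hL h2
        have i3 := inv_one_add_sq_le hL h3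
        rw [← add_mul, ← add_mul, ← mul_assoc]
        refine mul_le_mul_of_nonneg_right ?_ (norm_nonneg _)
        refine le_trans h ?_
        linarith
    _ = 2 * L ^ (4 / 3 : ℝ) * (∑ m ∈ S, decayWeight (2 / 3) (m.1 + m.2.1) ^ 2 * ‖quad a m‖
        + ∑ m ∈ S, decayWeight (2 / 3) (m.2.1 + m.2.2) ^ 2 * ‖quad a m‖
        + ∑ m ∈ S, decayWeight (2 / 3) (m.2.2 + m.1) ^ 2 * ‖quad a m‖) := by
        rw [← Finset.mul_sum, Finset.sum_add_distrib, Finset.sum_add_distrib]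
    _ ≤ 2 * L ^ (4 / 3 : ℝ) * (3 * (decayConst (2 / 3) * mass a ^ 2)) := by
        refine mul_le_mul_of_nonneg_left ?_ (by positivity)
        rw [← decayConst] at e1 e2 e3
        linarith
    _ = _ := by ring

/-- Nonlinear terms summed over all non-resonant triples. -/
lemma all_nonlinear_le (hL : 1 ≤ L) (ha : Summable fun k => ‖a k‖)
    (hS : ∀ m ∈ S, m ∈ nonResAll) :
    ∑ m ∈ S, 1 / resWeight L m * (freqSize L m * tripleSum a m)
      ≤ 96 * √(decayConst (2 / 3) ^ 3) * (L ^ 2 * √(mass a ^ 3)) := by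
  have hf := summable_decayWeight_sq (θ := 2 / 3) (by norm_num)
  have hg := summable_norm_sq ha
  -- The three remaining coefficients are paired with three weights, at two pair sums and at the
  -- fourth frequency. These three determine the triple, and the weight at the fourth frequency
  -- comes from `1/(1 + N)`.
  have key : ∀ {φ η : ℤ × ℤ × ℤ → ℤ × ℤ × ℤ}, Set.InjOn φ S → Set.InjOn η S →
      ∑ m ∈ S, (decayWeight (2 / 3) (φ m).1 * decayWeight (2 / 3) (φ m).2.1
        * decayWeight (2 / 3) (φ m).2.2) * (‖a (η m).1‖ * ‖a (η m).2.1‖ * ‖a (η m).2.2‖)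
      ≤ √(decayConst (2 / 3) ^ 3) * √(mass a ^ 3) := fun hφ hη =>
    sum_triple_mul_triple_le hf hg hφ hη
  have hall : ∀ {η : ℤ × ℤ × ℤ → ℤ × ℤ × ℤ}, Set.InjOn η S →
      ∑ m ∈ S, (pairDecay (2 / 3) m * decayWeight (2 / 3) (fourth m))
        * (‖a (η m).1‖ * ‖a (η m).2.1‖ * ‖a (η m).2.2‖)
      ≤ 3 * (√(decayConst (2 / 3) ^ 3) * √(mass a ^ 3)) := fun {η} hη => by
    have e1 := key (φ := fun m => (m.1 + m.2.1, m.2.1 + m.2.2, fourth m))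
      (fun m _ n _ h => by simp only [Prod.mk.injEq, fourth] at h; ext <;> omega) hη
    have e2 := key (φ := fun m => (m.2.1 + m.2.2, m.2.2 + m.1, fourth m))
      (fun m _ n _ h => by simp only [Prod.mk.injEq, fourth] at h; ext <;> omega) hη
    have e3 := key (φ := fun m => (m.2.2 + m.1, m.1 + m.2.1, fourth m))
      (fun m _ n _ h => by simp only [Prod.mk.injEq, fourth] at h; ext <;> omega) hη
    simp only [pairDecay, add_mul, Finset.sum_add_distrib]
    linarith
  have t1 := hall (η := fun m => (m.2.1, m.2.2, fourth m))
    (fun m _ n _ h => by simp only [Prod.mk.injEq, fourth] at h; ext <;> omega)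
  have t2 := hall (η := fun m => (m.1, m.2.2, fourth m))
    (fun m _ n _ h => by simp only [Prod.mk.injEq, fourth] at h; ext <;> omega)
  have t3 := hall (η := fun m => (m.1, m.2.1, fourth m))
    (fun m _ n _ h => by simp only [Prod.mk.injEq, fourth] at h; ext <;> omega)
  have t4 := hall (η := fun m => (m.1, m.2.1, m.2.2))
    (fun m _ n _ h => by simp only [Prod.mk.injEq] at h; ext <;> omega)
  have hLL : L ^ (4 / 3 : ℝ) * L ^ (2 / 3 : ℝ) = L ^ 2 := by
    rw [← Real.rpow_add (by linarith), ← Real.rpow_natCast]; norm_num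
  calc ∑ m ∈ S, 1 / resWeight L m * (freqSize L m * tripleSum a m)
      ≤ ∑ m ∈ S, 8 * L ^ 2 * ((pairDecay (2 / 3) m * decayWeight (2 / 3) (fourth m))
          * tripleSum a m) := by
        refine Finset.sum_le_sum fun m hm => ?_
        have hn := hS m hm
        obtain ⟨⟨hx, hy, hz⟩, ⟨hxN, hyN, -⟩, hb⟩ := pair_sum_bounds hL hn
        have h := div_le_pairWeight hx hy hz (freqSize_pos hL hn) hxN hyN hb
        rw [pairWeight_eq hL hn] at h
        rw [← mul_assoc, ← mul_assoc]
        refine mul_le_mul_of_nonneg_right ?_ (tripleSum_nonneg a m)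
        have hp := pairDecay_nonneg (2 / 3) m
        calc 1 / resWeight L m * freqSize L m = freqSize L m / resWeight L m := by ring
          _ ≤ 8 * (L ^ (4 / 3 : ℝ) * pairDecay (2 / 3) m) / (1 + freqSize L m) := h
          _ = 8 * (L ^ (4 / 3 : ℝ) * pairDecay (2 / 3) m) * (1 + freqSize L m)⁻¹ := rfl
          _ ≤ 8 * (L ^ (4 / 3 : ℝ) * pairDecay (2 / 3) m)
              * (L ^ (2 / 3 : ℝ) * decayWeight (2 / 3) (fourth m)) :=
            mul_le_mul_of_nonneg_left (inv_one_add_size_le hL m) (by positivity)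
          _ = _ := by rw [← hLL]; ring
    _ = 8 * L ^ 2 * (∑ m ∈ S, (pairDecay (2 / 3) m * decayWeight (2 / 3) (fourth m))
          * tripleSum a m) := by rw [Finset.mul_sum]
    _ ≤ 8 * L ^ 2 * (12 * (√(decayConst (2 / 3) ^ 3) * √(mass a ^ 3))) := by
        refine mul_le_mul_of_nonneg_left ?_ (by positivity)
        simp only [tripleSum, mul_add, Finset.sum_add_distrib]
        linarith
    _ = _ := by ring

end QuadSums

/-! ### Integration by parts in time and the closed estimates for a flow. -/

section NormalForm

/-- A curve of sequences on `[0,1]` with `a' = i p a + F`, constant `ℓ²` norm, a forcing term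
bounded by `|n| L⁻² M^{1/2} ‖a * a‖_{ℓ²}`, and a resonance function bounded below. -/
structure Flow (L : ℝ) (p : ℤ → ℝ) (a F : ℝ → ℤ → ℂ) (d : ℤ → ℝ) (M : ℝ) : Prop where
  one_le : 1 ≤ L
  conj : ∀ t ∈ Set.Icc (0 : ℝ) 1, ∀ k, a t (-k) = (starRingEnd ℂ) (a t k)
  summable_bound : Summable d
  norm_le : ∀ t ∈ Set.Icc (0 : ℝ) 1, ∀ k, ‖a t k‖ ≤ d k
  deriv : ∀ t ∈ Set.Icc (0 : ℝ) 1, ∀ k, HasDerivWithinAt (fun τ => a τ k)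
    (Complex.I * (p k : ℂ) * a t k + F t k) (Set.Icc (0 : ℝ) 1) t
  continuousOn_forcing : ∀ k, ContinuousOn (fun t => F t k) (Set.Icc (0 : ℝ) 1)
  mass_eq : ∀ t ∈ Set.Icc (0 : ℝ) 1, mass (a t) = M
  norm_forcing_le : ∀ t ∈ Set.Icc (0 : ℝ) 1, ∀ k,
    ‖F t k‖ ≤ |freq L k| * ((L ^ 2)⁻¹ * √M * √(quartic (a t)))
  resonance : ∀ m ∈ nonResAll, resWeight L m
    ≤ 8 * ‖Complex.I * ((p m.1 + p m.2.1 + p m.2.2 + p (fourth m) : ℝ) : ℂ) - 1‖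

section Dominated

variable {a : ℝ → ℤ → ℂ} {d : ℤ → ℝ}

lemma summable_norm_of_le {b : ℤ → ℂ} (hd : Summable d) (h : ∀ k, ‖b k‖ ≤ d k) :
    Summable fun k => ‖b k‖ :=
  Summable.of_nonneg_of_le (fun _ => norm_nonneg _) h hd

lemma exists_quad_bound (hd : Summable d) (hd0 : ∀ k, 0 ≤ d k) :
    ∃ Q : ℤ × ℤ × ℤ → ℝ, Summable Q ∧
      ∀ b : ℤ → ℂ, (∀ k, ‖b k‖ ≤ d k) → ∀ m, ‖quad b m‖ ≤ Q m := by
  refine ⟨fun m => d m.1 * d m.2.1 * d m.2.2 * ∑' k, d k,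
    (summable_triple hd hd hd hd0 hd0 hd0).mul_right _, fun b hb m => ?_⟩
  have h1 := hd.le_tsum (fourth m) fun k _ => hd0 k
  have := hd0 m.1
  have := hd0 m.2.1
  have := hd0 m.2.2
  rw [quad, norm_mul, norm_mul, norm_mul]
  change _ ≤ d m.1 * d m.2.1 * d m.2.2 * ∑' k, d k
  gcongr
  · exact hb _
  · exact hb _
  · exact hb _
  · exact (hb _).trans h1

lemma continuousOn_quad {I : Set ℝ} (hc : ∀ k, ContinuousOn (fun t => a t k) I) (m : ℤ × ℤ × ℤ) :
    ContinuousOn (fun t => quad (a t) m) I :=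
  (((hc _).mul (hc _)).mul (hc _)).mul (hc _)

/-- The integral of a dominated series is bounded by bounds for the finite sums of the norms of
the integrals of its terms. -/
lemma norm_integral_tsum_le {ι : Type*} [Countable ι] {f : ι → ℝ → ℂ} {Q : ι → ℝ} {t B : ℝ}
    (ht : 0 ≤ t) (hf : ∀ i, ContinuousOn (f i) (Set.Icc 0 t)) (hQ : Summable Q)
    (hfQ : ∀ i, ∀ τ ∈ Set.Icc 0 t, ‖f i τ‖ ≤ Q i)
    (hB : ∀ S : Finset ι, ∑ i ∈ S, ‖∫ τ in (0 : ℝ)..t, f i τ‖ ≤ B) :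
    ‖∫ τ in (0 : ℝ)..t, ∑' i, f i τ‖ ≤ B := by
  have hsub : Set.uIoc 0 t ⊆ Set.Icc 0 t := by
    rw [Set.uIoc_of_le ht]; exact Set.Ioc_subset_Icc_self
  have h := intervalIntegral.hasSum_integral_of_dominated_convergence (μ := volume) (a := 0)
    (b := t) (F := f) (f := fun τ => ∑' i, f i τ) (fun i _ => Q i)
    (fun i => ((hf i).mono hsub).aestronglyMeasurable measurableSet_uIoc)
    (fun i => Filter.Eventually.of_forall fun τ hτ => hfQ i τ (hsub hτ))
    (Filter.Eventually.of_forall fun τ _ => hQ) (by simp)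
    (Filter.Eventually.of_forall fun τ hτ =>
      (Summable.of_norm_bounded hQ fun i => hfQ i τ (hsub hτ)).hasSum)
  rw [← h.tsum_eq]
  have hs : Summable fun i => ‖∫ τ in (0 : ℝ)..t, f i τ‖ :=
    summable_of_sum_le (fun _ => norm_nonneg _) hB
  exact (norm_tsum_le_tsum_norm hs).trans (hs.tsum_le_of_sum_le hB)

end Dominated

namespace Flow

variable {L : ℝ} {p : ℤ → ℝ} {a F : ℝ → ℤ → ℂ} {d : ℤ → ℝ} {M : ℝ}

lemma bound_nonneg (h : Flow L p a F d M) (k : ℤ) : 0 ≤ d k :=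
  (norm_nonneg _).trans (h.norm_le 0 (by simp) k)

lemma summable_norm (h : Flow L p a F d M) {t : ℝ} (ht : t ∈ Set.Icc (0 : ℝ) 1) :
    Summable fun k => ‖a t k‖ :=
  summable_norm_of_le h.summable_bound (h.norm_le t ht)

lemma mass_const_nonneg (h : Flow L p a F d M) : 0 ≤ M := by
  rw [← h.mass_eq 0 (by simp)]; exact mass_nonneg _

lemma continuousOn (h : Flow L p a F d M) (k : ℤ) :
    ContinuousOn (fun t => a t k) (Set.Icc (0 : ℝ) 1) :=
  fun t ht => (h.deriv t ht k).continuousWithinAt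

/-- Continuity is read off from the quadrilinear series, which has a summable majorant independent
of time. -/
lemma continuousOn_quartic (h : Flow L p a F d M) :
    ContinuousOn (fun t => quartic (a t)) (Set.Icc (0 : ℝ) 1) := by
  obtain ⟨Q, hQ, hQb⟩ := exists_quad_bound h.summable_bound h.bound_nonneg
  have h1 : ContinuousOn (fun t => ∑' m, quad (a t) m) (Set.Icc (0 : ℝ) 1) :=
    continuousOn_tsum (continuousOn_quad h.continuousOn) hQ
      fun m t ht => hQb (a t) (h.norm_le t ht) m
  have h2 : ContinuousOn (fun t => (∑' m, quad (a t) m).re) (Set.Icc (0 : ℝ) 1) :=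
    Complex.continuous_re.comp_continuousOn h1
  refine h2.congr fun t ht => ?_
  simp only [tsum_quad (h.summable_norm ht) (h.conj t ht), Complex.ofReal_re]

/-- The bound for the forcing term, without the frequency. -/
noncomputable def gain (L M : ℝ) (a : ℝ → ℤ → ℂ) (t : ℝ) : ℝ :=
  (L ^ 2)⁻¹ * √M * √(quartic (a t))

lemma gain_nonneg (L M : ℝ) (a : ℝ → ℤ → ℂ) (t : ℝ) : 0 ≤ gain L M a t := by
  unfold gain; positivity

lemma continuousOn_sqrt_quartic (h : Flow L p a F d M) :
    ContinuousOn (fun t => √(quartic (a t))) (Set.Icc (0 : ℝ) 1) :=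
  h.continuousOn_quartic.sqrt

lemma continuousOn_gain (h : Flow L p a F d M) :
    ContinuousOn (gain L M a) (Set.Icc (0 : ℝ) 1) :=
  continuousOn_const.mul h.continuousOn_sqrt_quartic

lemma continuousOn_tripleSum (h : Flow L p a F d M) (m : ℤ × ℤ × ℤ) :
    ContinuousOn (fun t => tripleSum (a t) m) (Set.Icc (0 : ℝ) 1) := by
  have hc : ∀ k, ContinuousOn (fun t => ‖a t k‖) (Set.Icc (0 : ℝ) 1) :=
    fun k => (h.continuousOn k).norm
  exact ((((hc _).mul (hc _)).mul (hc _)).add (((hc _).mul (hc _)).mul (hc _))).add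
    (((hc _).mul (hc _)).mul (hc _)) |>.add (((hc _).mul (hc _)).mul (hc _))

lemma intervalIntegrable {E : Type*} [NormedAddCommGroup E] {f : ℝ → E}
    (hf : ContinuousOn f (Set.Icc (0 : ℝ) 1)) {t : ℝ} (ht : t ∈ Set.Icc (0 : ℝ) 1) :
    IntervalIntegrable f volume 0 t := by
  refine (hf.mono ?_).intervalIntegrable
  rw [Set.uIcc_of_le ht.1]
  exact Set.Icc_subset_Icc_right ht.2

/-- Integration by parts in time. -/
lemma norm_integral_quad_le (h : Flow L p a F d M) {m : ℤ × ℤ × ℤ} (hm : m ∈ nonResAll) {t : ℝ}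
    (ht : t ∈ Set.Icc (0 : ℝ) 1) :
    ‖∫ τ in (0 : ℝ)..t, quad (a τ) m‖ ≤ 8 * (1 / resWeight L m) * (‖quad (a t) m‖ + ‖quad (a 0) m‖
      + ∫ τ in (0 : ℝ)..t, (‖quad (a τ) m‖ + gain L M a τ * (freqSize L m * tripleSum (a τ) m))) := by
  set H : ℝ := p m.1 + p m.2.1 + p m.2.2 + p (fourth m) with hH
  set z : ℂ := Complex.I * (H : ℂ) - 1 with hz
  set R : ℝ → ℂ := fun τ => F τ m.1 * a τ m.2.1 * a τ m.2.2 * a τ (fourth m)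
    + a τ m.1 * F τ m.2.1 * a τ m.2.2 * a τ (fourth m)
    + a τ m.1 * a τ m.2.1 * F τ m.2.2 * a τ (fourth m)
    + a τ m.1 * a τ m.2.1 * a τ m.2.2 * F τ (fourth m) with hR
  have hac := h.continuousOn
  have hFc := h.continuousOn_forcing
  have hRc : ContinuousOn R (Set.Icc (0 : ℝ) 1) :=
    ((((((hFc _).mul (hac _)).mul (hac _)).mul (hac _)).add
      ((((hac _).mul (hFc _)).mul (hac _)).mul (hac _))).add
      ((((hac _).mul (hac _)).mul (hFc _)).mul (hac _))).add
      ((((hac _).mul (hac _)).mul (hac _)).mul (hFc _))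
  have hqc := continuousOn_quad hac m
  have hsub : Set.Icc 0 t ⊆ Set.Icc (0 : ℝ) 1 := Set.Icc_subset_Icc_right ht.2
  have hRb : ∀ τ ∈ Set.Icc (0 : ℝ) 1,
      ‖R τ‖ ≤ gain L M a τ * (freqSize L m * tripleSum (a τ) m) := by
    intro τ hτ
    have hg := gain_nonneg L M a τ
    have hF := h.norm_forcing_le τ hτ
    have hN1 : |freq L m.1| ≤ freqSize L m := by
      unfold freqSize
      linarith [abs_nonneg (freq L m.2.1), abs_nonneg (freq L m.2.2), abs_nonneg (freq L (fourth m))]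
    have hN2 : |freq L m.2.1| ≤ freqSize L m := by
      unfold freqSize
      linarith [abs_nonneg (freq L m.1), abs_nonneg (freq L m.2.2), abs_nonneg (freq L (fourth m))]
    have hN3 : |freq L m.2.2| ≤ freqSize L m := by
      unfold freqSize
      linarith [abs_nonneg (freq L m.1), abs_nonneg (freq L m.2.1), abs_nonneg (freq L (fourth m))]
    have hN4 : |freq L (fourth m)| ≤ freqSize L m := by
      unfold freqSize
      linarith [abs_nonneg (freq L m.1), abs_nonneg (freq L m.2.1), abs_nonneg (freq L m.2.2)]
    have hF' : ∀ k, |freq L k| ≤ freqSize L m → ‖F τ k‖ ≤ freqSize L m * gain L M a τ :=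
      fun k hk => (hF k).trans (mul_le_mul_of_nonneg_right hk hg)
    have e1 := hF' _ hN1
    have e2 := hF' _ hN2
    have e3 := hF' _ hN3
    have e4 := hF' _ hN4
    refine (norm_add_le _ _).trans ?_
    refine (add_le_add ((norm_add_le _ _).trans (add_le_add (norm_add_le _ _) le_rfl)) le_rfl).trans ?_
    simp only [norm_mul]
    calc ‖F τ m.1‖ * ‖a τ m.2.1‖ * ‖a τ m.2.2‖ * ‖a τ (fourth m)‖
          + ‖a τ m.1‖ * ‖F τ m.2.1‖ * ‖a τ m.2.2‖ * ‖a τ (fourth m)‖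
          + ‖a τ m.1‖ * ‖a τ m.2.1‖ * ‖F τ m.2.2‖ * ‖a τ (fourth m)‖
          + ‖a τ m.1‖ * ‖a τ m.2.1‖ * ‖a τ m.2.2‖ * ‖F τ (fourth m)‖
        ≤ (freqSize L m * gain L M a τ) * ‖a τ m.2.1‖ * ‖a τ m.2.2‖ * ‖a τ (fourth m)‖
          + ‖a τ m.1‖ * (freqSize L m * gain L M a τ) * ‖a τ m.2.2‖ * ‖a τ (fourth m)‖
          + ‖a τ m.1‖ * ‖a τ m.2.1‖ * (freqSize L m * gain L M a τ) * ‖a τ (fourth m)‖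
          + ‖a τ m.1‖ * ‖a τ m.2.1‖ * ‖a τ m.2.2‖ * (freqSize L m * gain L M a τ) := by
          gcongr
      _ = _ := by unfold tripleSum; ring
  -- In the product rule the four phases add up to `H`, and `R` collects the terms with one factor
  -- replaced by the forcing.
  have hderiv : ∀ τ ∈ Set.Ioo 0 t, HasDerivAt (fun τ => quad (a τ) m)
      (Complex.I * (H : ℂ) * quad (a τ) m + R τ) τ := by
    intro τ hτ
    have hτ' : τ ∈ Set.Icc (0 : ℝ) 1 := hsub ⟨hτ.1.le, hτ.2.le⟩
    have hn : Set.Icc (0 : ℝ) 1 ∈ nhds τ := Icc_mem_nhds hτ.1 (hτ.2.trans_le ht.2)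
    have hd := fun k => (h.deriv τ hτ' k).hasDerivAt hn
    refine ((((hd m.1).mul (hd m.2.1)).mul (hd m.2.2)).mul (hd (fourth m))).congr_deriv ?_
    simp only [hR, hH, quad, Pi.mul_apply]
    push_cast
    ring
  have hqi := intervalIntegrable hqc ht
  have hRi := intervalIntegrable hRc ht
  have hftc := intervalIntegral.integral_eq_sub_of_hasDerivAt_of_le ht.1 (hqc.mono hsub) hderiv
    ((hqi.const_mul _).add hRi)
  rw [intervalIntegral.integral_add (hqi.const_mul _) hRi, intervalIntegral.integral_const_mul]
    at hftc
  -- Subtracting the integral of the product from both sides replaces `iH` by `iH - 1`, whose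
  -- modulus is at least `1`. No small divisor occurs, and the extra integral is estimated like a
  -- boundary term.
  have hkey : z * ∫ τ in (0 : ℝ)..t, quad (a τ) m
      = quad (a t) m - quad (a 0) m - (∫ τ in (0 : ℝ)..t, quad (a τ) m)
        - ∫ τ in (0 : ℝ)..t, R τ := by
    rw [hz]; linear_combination hftc
  have hT : ContinuousOn (fun τ => gain L M a τ * (freqSize L m * tripleSum (a τ) m))
      (Set.Icc (0 : ℝ) 1) :=
    h.continuousOn_gain.mul (continuousOn_const.mul (h.continuousOn_tripleSum m))
  have hT1 := intervalIntegrable hT ht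
  have hb1 : ‖∫ τ in (0 : ℝ)..t, quad (a τ) m‖ ≤ ∫ τ in (0 : ℝ)..t, ‖quad (a τ) m‖ :=
    intervalIntegral.norm_integral_le_integral_norm ht.1
  have hb2 : ‖∫ τ in (0 : ℝ)..t, R τ‖
      ≤ ∫ τ in (0 : ℝ)..t, gain L M a τ * (freqSize L m * tripleSum (a τ) m) :=
    (intervalIntegral.norm_integral_le_integral_norm ht.1).trans
      (intervalIntegral.integral_mono_on ht.1 hRi.norm hT1 fun τ hτ => hRb τ (hsub hτ))
  rw [intervalIntegral.integral_add hqi.norm hT1]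
  have hres := h.resonance m hm
  have hD : 0 < resWeight L m := by linarith [one_le_resWeight L m]
  have hzn : ‖z‖ * ‖∫ τ in (0 : ℝ)..t, quad (a τ) m‖ ≤ ‖quad (a t) m‖ + ‖quad (a 0) m‖
      + ((∫ τ in (0 : ℝ)..t, ‖quad (a τ) m‖)
        + ∫ τ in (0 : ℝ)..t, gain L M a τ * (freqSize L m * tripleSum (a τ) m)) := by
    rw [← norm_mul, hkey]
    refine (norm_sub_le _ _).trans ?_
    have := norm_sub_le (quad (a t) m - quad (a 0) m) (∫ τ in (0 : ℝ)..t, quad (a τ) m)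
    have := norm_sub_le (quad (a t) m) (quad (a 0) m)
    linarith
  set X := ‖quad (a t) m‖ + ‖quad (a 0) m‖ + ((∫ τ in (0 : ℝ)..t, ‖quad (a τ) m‖)
        + ∫ τ in (0 : ℝ)..t, gain L M a τ * (freqSize L m * tripleSum (a τ) m)) with hX
  have : resWeight L m * ‖∫ τ in (0 : ℝ)..t, quad (a τ) m‖ ≤ 8 * X := by
    calc resWeight L m * ‖∫ τ in (0 : ℝ)..t, quad (a τ) m‖
        ≤ 8 * ‖z‖ * ‖∫ τ in (0 : ℝ)..t, quad (a τ) m‖ := by gcongr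
      _ ≤ 8 * X := by rw [mul_assoc]; gcongr
  rw [show 8 * (1 / resWeight L m) * X = 8 * X / resWeight L m by ring, le_div_iff₀ hD]
  linarith

/-- Finite sums of time integrals, given bounds for the boundary and the nonlinear terms. -/
lemma sum_norm_integral_quad_le (h : Flow L p a F d M) {S : Finset (ℤ × ℤ × ℤ)}
    (hS : ∀ m ∈ S, m ∈ nonResAll) {w R₁ R₂ : ℝ} (hw : 0 ≤ w)
    (h₁ : ∀ t ∈ Set.Icc (0 : ℝ) 1, ∑ m ∈ S, w / resWeight L m * ‖quad (a t) m‖ ≤ R₁)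
    (h₂ : ∀ t ∈ Set.Icc (0 : ℝ) 1,
      ∑ m ∈ S, w / resWeight L m * (freqSize L m * tripleSum (a t) m) ≤ R₂)
    {t : ℝ} (ht : t ∈ Set.Icc (0 : ℝ) 1) :
    ∑ m ∈ S, w * ‖∫ τ in (0 : ℝ)..t, quad (a τ) m‖
      ≤ 8 * (3 * R₁ + R₂ * ∫ τ in (0 : ℝ)..1, gain L M a τ) := by
  have h0 : (0 : ℝ) ∈ Set.Icc (0 : ℝ) 1 := by simp
  have hsub : Set.Icc 0 t ⊆ Set.Icc (0 : ℝ) 1 := Set.Icc_subset_Icc_right ht.2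
  have hgi := intervalIntegrable h.continuousOn_gain ht
  have hterm : ∀ m, ContinuousOn (fun τ => ‖quad (a τ) m‖
      + gain L M a τ * (freqSize L m * tripleSum (a τ) m)) (Set.Icc (0 : ℝ) 1) := fun m =>
    (continuousOn_quad h.continuousOn m).norm.add
      (h.continuousOn_gain.mul (continuousOn_const.mul (h.continuousOn_tripleSum m)))
  have hR1 : 0 ≤ R₁ := le_trans (Finset.sum_nonneg fun m _ => by
    have := one_le_resWeight L m
    positivity) (h₁ 0 h0)
  have hR2 : 0 ≤ R₂ := le_trans (Finset.sum_nonneg fun m hm => by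
    have := one_le_resWeight L m
    have := freqSize_pos h.one_le (hS m hm)
    have := tripleSum_nonneg (a 0) m
    positivity) (h₂ 0 h0)
  have hint : ∑ m ∈ S, w / resWeight L m * ∫ τ in (0 : ℝ)..t, (‖quad (a τ) m‖
      + gain L M a τ * (freqSize L m * tripleSum (a τ) m))
      ≤ R₁ + R₂ * ∫ τ in (0 : ℝ)..1, gain L M a τ := by
    calc ∑ m ∈ S, w / resWeight L m * ∫ τ in (0 : ℝ)..t, (‖quad (a τ) m‖
          + gain L M a τ * (freqSize L m * tripleSum (a τ) m))
        = ∫ τ in (0 : ℝ)..t, ∑ m ∈ S, w / resWeight L m * (‖quad (a τ) m‖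
          + gain L M a τ * (freqSize L m * tripleSum (a τ) m)) := by
          rw [intervalIntegral.integral_finsetSum
            fun m _ => (intervalIntegrable (hterm m) ht).const_mul _]
          exact Finset.sum_congr rfl fun m _ => (intervalIntegral.integral_const_mul _ _).symm
      _ ≤ ∫ τ in (0 : ℝ)..t, (R₁ + R₂ * gain L M a τ) := by
          refine intervalIntegral.integral_mono_on ht.1 ?_ ?_ fun τ hτ => ?_
          · refine intervalIntegrable (continuousOn_finsetSum S fun m _ => ?_) ht
            exact continuousOn_const.mul (hterm m)
          · exact (intervalIntegrable continuousOn_const ht).add (hgi.const_mul _)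
          · have e1 := h₁ τ (hsub hτ)
            have e2 := mul_le_mul_of_nonneg_left (h₂ τ (hsub hτ)) (gain_nonneg L M a τ)
            rw [Finset.mul_sum] at e2
            calc ∑ m ∈ S, w / resWeight L m * (‖quad (a τ) m‖
                  + gain L M a τ * (freqSize L m * tripleSum (a τ) m))
                = ∑ m ∈ S, w / resWeight L m * ‖quad (a τ) m‖ + ∑ m ∈ S, gain L M a τ
                  * (w / resWeight L m * (freqSize L m * tripleSum (a τ) m)) := by
                  rw [← Finset.sum_add_distrib]
                  exact Finset.sum_congr rfl fun m _ => by ring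
              _ ≤ R₁ + R₂ * gain L M a τ := by linarith
      _ = t * R₁ + R₂ * ∫ τ in (0 : ℝ)..t, gain L M a τ := by
          rw [intervalIntegral.integral_add (intervalIntegrable continuousOn_const ht)
            (hgi.const_mul _), intervalIntegral.integral_const_mul,
            intervalIntegral.integral_const, sub_zero, smul_eq_mul]
      _ ≤ R₁ + R₂ * ∫ τ in (0 : ℝ)..1, gain L M a τ := by
          have e1 : t * R₁ ≤ 1 * R₁ := mul_le_mul_of_nonneg_right ht.2 hR1
          have e2 : ∫ τ in (0 : ℝ)..t, gain L M a τ ≤ ∫ τ in (0 : ℝ)..1, gain L M a τ :=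
            intervalIntegral.integral_mono_interval le_rfl ht.1 ht.2
              (Filter.Eventually.of_forall fun τ => gain_nonneg L M a τ)
              (intervalIntegrable h.continuousOn_gain (by simp))
          have e3 := mul_le_mul_of_nonneg_left e2 hR2
          linarith
  calc ∑ m ∈ S, w * ‖∫ τ in (0 : ℝ)..t, quad (a τ) m‖
      ≤ ∑ m ∈ S, 8 * (w / resWeight L m * ‖quad (a t) m‖ + w / resWeight L m * ‖quad (a 0) m‖
          + w / resWeight L m * ∫ τ in (0 : ℝ)..t, (‖quad (a τ) m‖
          + gain L M a τ * (freqSize L m * tripleSum (a τ) m))) := by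
        refine Finset.sum_le_sum fun m hm => ?_
        refine (mul_le_mul_of_nonneg_left (h.norm_integral_quad_le (hS m hm) ht) hw).trans ?_
        exact le_of_eq (by ring)
    _ = 8 * (∑ m ∈ S, w / resWeight L m * ‖quad (a t) m‖
          + ∑ m ∈ S, w / resWeight L m * ‖quad (a 0) m‖
          + ∑ m ∈ S, w / resWeight L m * ∫ τ in (0 : ℝ)..t, (‖quad (a τ) m‖
          + gain L M a τ * (freqSize L m * tripleSum (a τ) m))) := by
        rw [← Finset.mul_sum, Finset.sum_add_distrib, Finset.sum_add_distrib]
    -- `R₁` is counted three times: at time `t`, at time `0`, and in the integral over an interval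
    -- of length at most `1`.
    _ ≤ _ := by
        have e1 := h₁ t ht
        have e2 := h₁ 0 h0
        linarith

lemma sqrt_mul_sqrt_cube {M : ℝ} (hM : 0 ≤ M) : √M * √(M ^ 3) = M ^ 2 := by
  rw [← Real.sqrt_mul hM, show M * M ^ 3 = (M ^ 2) ^ 2 by ring, Real.sqrt_sq (by positivity)]

lemma integral_gain (L M : ℝ) (a : ℝ → ℤ → ℂ) :
    ∫ τ in (0 : ℝ)..1, gain L M a τ = (L ^ 2)⁻¹ * √M * ∫ τ in (0 : ℝ)..1, √(quartic (a τ)) := by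
  unfold gain
  rw [intervalIntegral.integral_const_mul]

/-- Time integrals of the quadrilinear form. -/
lemma norm_integral_tsum_quad_le (h : Flow L p a F d M) {R : Set (ℤ × ℤ × ℤ)} {B t : ℝ}
    (ht : t ∈ Set.Icc (0 : ℝ) 1)
    (hB : ∀ S : Finset (ℤ × ℤ × ℤ), (∀ m ∈ S, m ∈ R) →
      ∑ m ∈ S, ‖∫ τ in (0 : ℝ)..t, quad (a τ) m‖ ≤ B) :
    ‖∫ τ in (0 : ℝ)..t, ∑' m : R, quad (a τ) m‖ ≤ B := by
  obtain ⟨Q, hQ, hQb⟩ := exists_quad_bound h.summable_bound h.bound_nonneg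
  have hsub : Set.Icc 0 t ⊆ Set.Icc (0 : ℝ) 1 := Set.Icc_subset_Icc_right ht.2
  refine norm_integral_tsum_le (Q := fun m : R => Q m) ht.1
    (fun m => (continuousOn_quad h.continuousOn m.1).mono hsub) (hQ.subtype R)
    (fun m τ hτ => hQb (a τ) (h.norm_le τ (hsub hτ)) m.1) fun S => ?_
  have := hB (S.map (Function.Embedding.subtype _)) fun m hm => by
    obtain ⟨x, -, rfl⟩ := Finset.mem_map.1 hm
    exact x.2
  rwa [Finset.sum_map] at this

/-- The time-integrated quartic bound. -/
lemma exists_integral_quartic_le : ∃ C : ℝ, 0 < C ∧ ∀ {L : ℝ} {p : ℤ → ℝ} {a F : ℝ → ℤ → ℂ}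
    {d : ℤ → ℝ} {M : ℝ}, Flow L p a F d M →
    ∫ τ in (0 : ℝ)..1, quartic (a τ) ≤ C * (L ^ (4 / 3 : ℝ) * M ^ 2 + M ^ 4) := by
  set K₁ := 6 * decayConst (2 / 3) with hK₁
  set K₂ := 96 * √(decayConst (2 / 3) ^ 3) with hK₂
  have hK₁0 : 0 ≤ K₁ := mul_nonneg (by norm_num) (decayConst_nonneg _)
  have hK₂0 : 0 ≤ K₂ := by positivity
  refine ⟨6 + 48 * K₁ + 64 * K₂ ^ 2, by positivity, fun {L p a F d M} h => ?_⟩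
  have hL := h.one_le
  have hL0 : 0 < L := by linarith
  have hM := h.mass_const_nonneg
  have h1 : (1 : ℝ) ∈ Set.Icc (0 : ℝ) 1 := by simp
  set X := ∫ τ in (0 : ℝ)..1, √(quartic (a τ)) with hX
  set J := ∫ τ in (0 : ℝ)..1, quartic (a τ) with hJ
  have hqi := intervalIntegrable h.continuousOn_quartic h1
  have hsi := intervalIntegrable h.continuousOn_sqrt_quartic h1
  -- The factor `L²` lost in the nonlinear sum is recovered exactly from the `L⁻²` in the forcing.
  have hgain : L ^ 2 * √(M ^ 3) * ((L ^ 2)⁻¹ * √M * X) = M ^ 2 * X := by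
    rw [← sqrt_mul_sqrt_cube hM]; field_simp
  have hN : ‖∫ τ in (0 : ℝ)..1, ∑' m : nonResAll, quad (a τ) m‖
      ≤ 8 * (3 * (K₁ * (L ^ (4 / 3 : ℝ) * M ^ 2)) + K₂ * (M ^ 2 * X)) := by
    refine h.norm_integral_tsum_quad_le h1 fun S hS => ?_
    have := h.sum_norm_integral_quad_le hS zero_le_one (R₁ := K₁ * (L ^ (4 / 3 : ℝ) * M ^ 2))
      (R₂ := K₂ * (L ^ 2 * √(M ^ 3)))
      (fun t ht => by
        have := all_boundary_le hL (h.summable_norm ht) hS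
        rwa [h.mass_eq t ht] at this)
      (fun t ht => by
        have := all_nonlinear_le hL (h.summable_norm ht) hS
        rwa [h.mass_eq t ht] at this) h1
    simp only [one_mul] at this
    rwa [integral_gain, mul_assoc K₂, hgain] at this
  obtain ⟨Q, hQ, hQb⟩ := exists_quad_bound h.summable_bound h.bound_nonneg
  have hcts : ContinuousOn (fun t => ∑' m : nonResAll, quad (a t) m) (Set.Icc (0 : ℝ) 1) :=
    continuousOn_tsum (fun m => continuousOn_quad h.continuousOn m.1) (hQ.subtype nonResAll)
      fun m t ht => hQb (a t) (h.norm_le t ht) m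
  have hint := intervalIntegrable hcts h1
  have hJle : J ≤ 3 * M ^ 2 + ‖∫ τ in (0 : ℝ)..1, ∑' m : nonResAll, quad (a τ) m‖ := by
    have hre : IntervalIntegrable (fun τ => (∑' m : nonResAll, quad (a τ) m).re) volume 0 1 :=
      intervalIntegrable (Complex.continuous_re.comp_continuousOn hcts) h1
    have e1 : J ≤ ∫ τ in (0 : ℝ)..1, (3 * M ^ 2 + (∑' m : nonResAll, quad (a τ) m).re) := by
      refine intervalIntegral.integral_mono_on zero_le_one hqi
        ((intervalIntegrable continuousOn_const h1).add hre) fun τ hτ => ?_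
      have := quartic_le (h.summable_norm hτ) (h.conj τ hτ)
      rwa [h.mass_eq τ hτ, ← tsum_subtype] at this
    rw [intervalIntegral.integral_add (intervalIntegrable continuousOn_const h1) hre,
      intervalIntegral.integral_const, sub_zero, one_smul] at e1
    have e2 : ∫ τ in (0 : ℝ)..1, (∑' m : nonResAll, quad (a τ) m).re
        = (∫ τ in (0 : ℝ)..1, ∑' m : nonResAll, quad (a τ) m).re :=
      Complex.reCLM.intervalIntegral_comp_comm hint
    rw [e2] at e1
    exact e1.trans (by gcongr; exact Complex.re_le_norm _)
  -- Young's inequality with half of `J` on the right, to be absorbed on the left.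
  have hXJ : 8 * K₂ * M ^ 2 * X ≤ 32 * (K₂ * M ^ 2) ^ 2 + J / 2 := by
    have : ∫ τ in (0 : ℝ)..1, (8 * K₂ * M ^ 2) * √(quartic (a τ))
        ≤ ∫ τ in (0 : ℝ)..1, (32 * (K₂ * M ^ 2) ^ 2 + (1 / 2) * quartic (a τ)) := by
      refine intervalIntegral.integral_mono_on zero_le_one (hsi.const_mul _)
        ((intervalIntegrable continuousOn_const h1).add (hqi.const_mul _)) fun τ _ => ?_
      have e1 := Real.sq_sqrt (quartic_nonneg (a τ))
      nlinarith [sq_nonneg (8 * K₂ * M ^ 2 - √(quartic (a τ)))]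
    rw [intervalIntegral.integral_const_mul, intervalIntegral.integral_add
      (intervalIntegrable continuousOn_const h1) (hqi.const_mul _),
      intervalIntegral.integral_const_mul (1 / 2), intervalIntegral.integral_const, sub_zero,
      one_smul] at this
    linarith
  have hLp : 1 ≤ L ^ (4 / 3 : ℝ) := Real.one_le_rpow hL (by norm_num)
  have hLM : M ^ 2 ≤ L ^ (4 / 3 : ℝ) * M ^ 2 := le_mul_of_one_le_left (by positivity) hLp
  have p1 : 0 ≤ K₂ ^ 2 * (L ^ (4 / 3 : ℝ) * M ^ 2) := by positivity
  have p2 : 0 ≤ K₁ * M ^ 4 := by positivity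
  have p3 : 0 ≤ M ^ 4 := by positivity
  nlinarith

/-- The time-integrated square root of the quartic norm. -/
lemma exists_integral_sqrt_quartic_le : ∃ C : ℝ, 0 < C ∧ ∀ {L : ℝ} {p : ℤ → ℝ}
    {a F : ℝ → ℤ → ℂ} {d : ℤ → ℝ} {M : ℝ}, Flow L p a F d M →
    ∫ τ in (0 : ℝ)..1, √(quartic (a τ)) ≤ C * (L ^ (4 / 3 : ℝ) + M ^ 2) := by
  obtain ⟨C, hC, hJ⟩ := exists_integral_quartic_le
  refine ⟨(1 + C) / 2, by positivity, fun {L p a F d M} h => ?_⟩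
  have hJ := hJ h
  have hL := h.one_le
  have h1 : (1 : ℝ) ∈ Set.Icc (0 : ℝ) 1 := by simp
  have hLp : 1 ≤ L ^ (4 / 3 : ℝ) := Real.one_le_rpow hL (by norm_num)
  -- `Λ` is chosen so that `J ≤ CΛ²`; integrating `Λ√q ≤ Λ²/2 + q/2` and dividing by `Λ` gives the
  -- constant `(1 + C)/2`.
  set Λ := L ^ (4 / 3 : ℝ) + M ^ 2 with hΛ
  have hΛ0 : 0 < Λ := by positivity
  have hqi := intervalIntegrable h.continuousOn_quartic h1
  have hsi := intervalIntegrable h.continuousOn_sqrt_quartic h1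
  have : ∫ τ in (0 : ℝ)..1, Λ * √(quartic (a τ))
      ≤ ∫ τ in (0 : ℝ)..1, (Λ ^ 2 / 2 + (1 / 2) * quartic (a τ)) := by
    refine intervalIntegral.integral_mono_on zero_le_one (hsi.const_mul _)
      ((intervalIntegrable continuousOn_const h1).add (hqi.const_mul _)) fun τ _ => ?_
    have e1 := Real.sq_sqrt (quartic_nonneg (a τ))
    nlinarith [sq_nonneg (Λ - √(quartic (a τ)))]
  rw [intervalIntegral.integral_const_mul, intervalIntegral.integral_add
    (intervalIntegrable continuousOn_const h1) (hqi.const_mul _),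
    intervalIntegral.integral_const_mul, intervalIntegral.integral_const, sub_zero,
    one_smul] at this
  have e : L ^ (4 / 3 : ℝ) * M ^ 2 + M ^ 4 ≤ Λ ^ 2 := by
    rw [hΛ]; nlinarith [sq_nonneg M, mul_nonneg (zero_le_one.trans hLp) (sq_nonneg M)]
  have e2 := mul_le_mul_of_nonneg_left e hC.le
  refine le_of_mul_le_mul_left ?_ hΛ0
  nlinarith

lemma cubic_mul_eq (a : ℝ → ℤ → ℂ) (t : ℝ) (k : ℤ) :
    cubic (a t) k * a t (-k) = ∑' m : nonRes k, quad (a t) m := by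
  rw [cubic, ← tsum_mul_right]
  refine tsum_congr fun m => ?_
  have : fourth m.1 = -k := by rw [fourth, m.2.1]
  rw [quad, this]

/-- The smoothing estimate for the time-integrated non-resonant quadrilinear form. -/
lemma exists_norm_integral_cubic_le : ∃ C : ℝ, 0 < C ∧ ∀ {L : ℝ} {p : ℤ → ℝ}
    {a F : ℝ → ℤ → ℂ} {d : ℤ → ℝ} {M : ℝ}, Flow L p a F d M → ∀ k : ℤ,
    ∀ t ∈ Set.Icc (0 : ℝ) 1,
    ‖∫ τ in (0 : ℝ)..t, (freq L k : ℂ) ^ 2 * (cubic (a τ) k * a τ (-k))‖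
      ≤ C * (M ^ 2 * (L ^ (4 / 3 : ℝ) + M ^ 2)) := by
  obtain ⟨C, hC, hX⟩ := exists_integral_sqrt_quartic_le
  set K₁ := 12 * decayConst (2 / 3) with hK₁
  set K₂ := 72 * decayConst 1 with hK₂
  have hK₁0 : 0 ≤ K₁ := mul_nonneg (by norm_num) (decayConst_nonneg _)
  have hK₂0 : 0 ≤ K₂ := mul_nonneg (by norm_num) (decayConst_nonneg _)
  refine ⟨1 + 24 * K₁ + 8 * K₂ * C, by positivity, fun {L p a F d M} h k t ht => ?_⟩
  have hX := hX h
  have hL := h.one_le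
  have hL0 : 0 < L := by linarith
  have hM := h.mass_const_nonneg
  set X := ∫ τ in (0 : ℝ)..1, √(quartic (a τ)) with hXdef
  have hgain : L ^ 2 * (M * √M) * ((L ^ 2)⁻¹ * √M * X) = M ^ 2 * X := by
    have : M ^ 2 = M * (√M * √M) := by rw [Real.mul_self_sqrt hM, sq]
    rw [this]; field_simp
  have hN : freq L k ^ 2 * ‖∫ τ in (0 : ℝ)..t, ∑' m : nonRes k, quad (a τ) m‖
      ≤ 8 * (3 * (K₁ * (L ^ (4 / 3 : ℝ) * M ^ 2)) + K₂ * (M ^ 2 * X)) := by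
    have hS' : ∀ S : Finset (ℤ × ℤ × ℤ), (∀ m ∈ S, m ∈ nonRes k) →
        freq L k ^ 2 * ∑ m ∈ S, ‖∫ τ in (0 : ℝ)..t, quad (a τ) m‖
        ≤ 8 * (3 * (K₁ * (L ^ (4 / 3 : ℝ) * M ^ 2)) + K₂ * (M ^ 2 * X)) := fun S hS => by
      have := h.sum_norm_integral_quad_le (fun m hm => (hS m hm).2) (sq_nonneg (freq L k))
        (R₁ := K₁ * (L ^ (4 / 3 : ℝ) * M ^ 2)) (R₂ := K₂ * (L ^ 2 * (M * √M)))
        (fun t ht => by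
          have := fixed_boundary_le hL (h.summable_norm ht) hS
          rwa [h.mass_eq t ht] at this)
        (fun t ht => by
          have := fixed_nonlinear_le hL (h.summable_norm ht) hS
          rwa [h.mass_eq t ht] at this) ht
      rwa [integral_gain, mul_assoc K₂, hgain, ← Finset.mul_sum] at this
    -- At nonzero frequency, dividing by `n²` allows the bound for the weighted finite sums to be
    -- passed to the series.
    rcases eq_or_ne (freq L k) 0 with h0 | h0
    · rw [h0]
      have := hS' ∅ (by simp)
      rw [Finset.sum_empty, mul_zero] at this
      simpa using this
    · have hf : 0 < freq L k ^ 2 := by positivity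
      rw [mul_comm, ← le_div_iff₀ hf]
      refine h.norm_integral_tsum_quad_le ht fun S hS => ?_
      rw [le_div_iff₀ hf, mul_comm]
      exact hS' S hS
  have e : ∫ τ in (0 : ℝ)..t, (freq L k : ℂ) ^ 2 * (cubic (a τ) k * a τ (-k))
      = (freq L k : ℂ) ^ 2 * ∫ τ in (0 : ℝ)..t, ∑' m : nonRes k, quad (a τ) m := by
    rw [← intervalIntegral.integral_const_mul]
    simp_rw [cubic_mul_eq]
  rw [e, norm_mul, norm_pow, Complex.norm_real, Real.norm_eq_abs, sq_abs]
  refine hN.trans ?_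
  have e2 : K₂ * (M ^ 2 * X) ≤ K₂ * (M ^ 2 * (C * (L ^ (4 / 3 : ℝ) + M ^ 2))) := by gcongr
  have hLp : 0 ≤ L ^ (4 / 3 : ℝ) := by positivity
  have p1 : 0 ≤ M ^ 2 * (L ^ (4 / 3 : ℝ) + M ^ 2) := by positivity
  have p2 : 0 ≤ K₁ * (M ^ 2 * M ^ 2) := by positivity
  nlinarith

end Flow

end NormalForm

/-! ### Parseval and rapid decay of the Fourier coefficients, uniformly in time. -/

section FourierCoefficients

variable {L : ℝ}

lemma hatR_neg (L : ℝ) (f : ℝ → ℝ) (k : ℤ) :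
    hatR L f (-k) = (starRingEnd ℂ) (hatR L f k) := by
  rw [hatR, hatR, fourierCoeffT, fourierCoeffT, ← intervalIntegral.intervalIntegral_conj]
  refine intervalIntegral.integral_congr fun x _ => ?_
  simp only [map_mul, Complex.conj_ofReal, ← Complex.exp_conj, map_neg, Complex.conj_I, freq_neg]
  congr 2
  push_cast
  ring

lemma fourierCoeffOn_eq_fourierCoeffT (hL : 0 < 2 * Real.pi * L) (f : ℝ → ℂ) (k : ℤ) :
    fourierCoeffOn hL f k = (2 * Real.pi * L)⁻¹ • fourierCoeffT L f k := by
  rw [fourierCoeffOn_eq_integral, fourierCoeffT, sub_zero, one_div]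
  congr 1
  refine intervalIntegral.integral_congr fun x _ => ?_
  simp only [fourier_coe_apply, smul_eq_mul, freq]
  congr 2
  have hpi : (Real.pi : ℂ) ≠ 0 := by exact_mod_cast Real.pi_ne_zero
  have hL' : (L : ℂ) ≠ 0 := by
    have : L ≠ 0 := by rintro rfl; simp at hL
    exact_mod_cast this
  push_cast
  field_simp

/-- Parseval's identity. -/
lemma hasSum_norm_sq_hatR (hL : 1 ≤ L) {f : ℝ → ℝ} (hf : Continuous f) :
    HasSum (fun k => ‖hatR L f k‖ ^ 2) (2 * Real.pi * L * normL2 L f ^ 2) := by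
  have hP : 0 < 2 * Real.pi * L := by positivity
  have hc : Continuous fun x => (f x : ℂ) := Complex.continuous_ofReal.comp hf
  have hmem : MemLp (fun x => (f x : ℂ)) 2 (volume.restrict (Set.Ioc 0 (2 * Real.pi * L))) := by
    obtain ⟨C, hC⟩ := (isCompact_Icc (a := (0 : ℝ)) (b := 2 * Real.pi * L)).exists_bound_of_continuousOn
      hc.continuousOn
    refine MemLp.of_bound hc.aestronglyMeasurable C ?_
    filter_upwards [ae_restrict_mem measurableSet_Ioc] with x hx
    exact hC x ⟨hx.1.le, hx.2⟩
  have h := (hasSum_sq_fourierCoeffOn hP hmem).mul_left ((2 * Real.pi * L) ^ 2)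
  have h0 : 0 ≤ ∫ x in (0 : ℝ)..(2 * Real.pi * L), f x ^ 2 :=
    intervalIntegral.integral_nonneg hP.le fun x _ => sq_nonneg _
  have e1 : ∀ k, (2 * Real.pi * L) ^ 2 * ‖fourierCoeffOn hP (fun x => (f x : ℂ)) k‖ ^ 2
      = ‖hatR L f k‖ ^ 2 := fun k => by
    rw [fourierCoeffOn_eq_fourierCoeffT hP, norm_smul, Real.norm_of_nonneg (by positivity), hatR,
      mul_pow]
    field_simp
  have e2 : (2 * Real.pi * L) ^ 2 * ((2 * Real.pi * L - 0)⁻¹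
      • ∫ x in (0 : ℝ)..(2 * Real.pi * L), ‖(f x : ℂ)‖ ^ 2) = 2 * Real.pi * L * normL2 L f ^ 2 := by
    rw [normL2, Real.sq_sqrt h0, sub_zero, smul_eq_mul]
    simp only [Complex.norm_real, Real.norm_eq_abs, sq_abs]
    field_simp
  rw [e2] at h
  exact h.congr_fun fun k => (e1 k).symm

/-- Integration by parts in the Fourier coefficient. -/
lemma hatR_deriv (hL : 1 ≤ L) {f g : ℝ → ℝ} (hfg : ∀ x, HasDerivAt f (g x) x) (hg : Continuous g)
    (hper : Function.Periodic f (2 * Real.pi * L)) (k : ℤ) :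
    hatR L g k = Complex.I * (freq L k : ℂ) * hatR L f k := by
  have hexp : ∀ x : ℝ, HasDerivAt
      (fun x : ℝ => Complex.exp (-(Complex.I * (freq L k : ℂ) * (x : ℂ))))
      (-(Complex.I * (freq L k : ℂ)) * Complex.exp (-(Complex.I * (freq L k : ℂ) * (x : ℂ)))) x := by
    intro x
    have h1 : HasDerivAt (fun x : ℝ => -(Complex.I * (freq L k : ℂ) * (x : ℂ)))
        (-(Complex.I * (freq L k : ℂ))) x := by
      exact ((hasDerivAt_id x).ofReal_comp.const_mul (Complex.I * (freq L k : ℂ))).fun_neg.congr_deriv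
        (by simp)
    exact h1.cexp.congr_deriv (by ring)
  have h := intervalIntegral.integral_mul_deriv_eq_deriv_mul (a := 0) (b := 2 * Real.pi * L)
    (u := fun x : ℝ => Complex.exp (-(Complex.I * (freq L k : ℂ) * (x : ℂ))))
    (v := fun x => (f x : ℂ)) (v' := fun x => (g x : ℂ))
    (fun x _ => hexp x) (fun x _ => (hfg x).ofReal_comp)
    ((by fun_prop : Continuous _).intervalIntegrable _ _)
    ((Complex.continuous_ofReal.comp hg).intervalIntegrable _ _)
  have hend : Complex.exp (-(Complex.I * (freq L k : ℂ) * ((2 * Real.pi * L : ℝ) : ℂ))) = 1 := by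
    rw [Complex.exp_eq_one_iff]
    refine ⟨-k, ?_⟩
    have hL' : (L : ℂ) ≠ 0 := by exact_mod_cast (by linarith : L ≠ 0)
    rw [freq]
    push_cast
    field_simp
  have hp0 : f (2 * Real.pi * L) = f 0 := by simpa using hper 0
  rw [hatR, fourierCoeffT, h, hend, hp0, hatR, fourierCoeffT, ← intervalIntegral.integral_const_mul]
  simp only [Complex.ofReal_zero, mul_zero, neg_zero, Complex.exp_zero, sub_self, zero_sub]
  rw [← intervalIntegral.integral_neg]
  refine intervalIntegral.integral_congr fun x _ => ?_
  ring

/-- The spatial derivative of a function that is smooth up to the boundary of the time interval. -/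
lemma exists_spatial_deriv {f : ℝ × ℝ → ℝ}
    (hf : ContDiffOn ℝ ∞ f (Set.Icc (0 : ℝ) 1 ×ˢ Set.univ)) :
    ∃ g : ℝ × ℝ → ℝ, ContDiffOn ℝ ∞ g (Set.Icc (0 : ℝ) 1 ×ˢ Set.univ) ∧
      ∀ t ∈ Set.Icc (0 : ℝ) 1, ∀ x, HasDerivAt (fun x => f (t, x)) (g (t, x)) x := by
  set s : Set (ℝ × ℝ) := Set.Icc (0 : ℝ) 1 ×ˢ Set.univ with hs
  have hu : UniqueDiffOn ℝ s := (uniqueDiffOn_Icc zero_lt_one).prod uniqueDiffOn_univ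
  refine ⟨fun q => fderivWithin ℝ f s q (0, 1),
    (hf.fderivWithin hu (by simp)).clm_apply contDiffOn_const, fun t ht x => ?_⟩
  have hmem : (t, x) ∈ s := ⟨ht, Set.mem_univ _⟩
  have h1 := ((hf.differentiableOn (by simp)) (t, x) hmem).hasFDerivWithinAt
  have h2 : HasDerivWithinAt (fun x : ℝ => (t, x)) ((0 : ℝ), (1 : ℝ)) Set.univ x :=
    ((hasDerivAt_const x t).prodMk (hasDerivAt_id x)).hasDerivWithinAt
  have h3 := HasFDerivWithinAt.comp_hasDerivWithinAt x h1 h2 fun y _ => ⟨ht, Set.mem_univ _⟩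
  exact hasDerivWithinAt_univ.1 h3

/-- Rapid decay of the Fourier coefficients, uniformly in time. -/
lemma exists_freq_pow_mul_hatR_le (hL : 1 ≤ L) (j : ℕ) : ∀ {f : ℝ × ℝ → ℝ},
    ContDiffOn ℝ ∞ f (Set.Icc (0 : ℝ) 1 ×ˢ Set.univ) →
    (∀ t ∈ Set.Icc (0 : ℝ) 1, Function.Periodic (fun x => f (t, x)) (2 * Real.pi * L)) →
    ∃ C : ℝ, ∀ t ∈ Set.Icc (0 : ℝ) 1, ∀ k : ℤ,
      |freq L k| ^ j * ‖hatR L (fun x => f (t, x)) k‖ ≤ C := by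
  have hP : 0 < 2 * Real.pi * L := by positivity
  induction j with
  | zero =>
    intro f hf _
    have hK : IsCompact (Set.Icc (0 : ℝ) 1 ×ˢ Set.Icc (0 : ℝ) (2 * Real.pi * L)) :=
      isCompact_Icc.prod isCompact_Icc
    obtain ⟨C, hC⟩ := hK.exists_bound_of_continuousOn
      (hf.continuousOn.mono (Set.prod_mono le_rfl (Set.subset_univ _)))
    refine ⟨C * |2 * Real.pi * L - 0|, fun t ht k => ?_⟩
    rw [pow_zero, one_mul, hatR, fourierCoeffT]
    refine intervalIntegral.norm_integral_le_of_norm_le_const fun x hx => ?_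
    rw [Set.uIoc_of_le hP.le] at hx
    have h1 : ‖Complex.exp (-(Complex.I * (freq L k : ℂ) * (x : ℂ)))‖ = 1 := by
      rw [show -(Complex.I * (freq L k : ℂ) * (x : ℂ)) = ((-(freq L k * x) : ℝ) : ℂ) * Complex.I by
        push_cast; ring]
      exact Complex.norm_exp_ofReal_mul_I _
    rw [norm_mul, h1, one_mul, Complex.norm_real]
    exact hC (t, x) ⟨ht, hx.1.le, hx.2⟩
  | succ j ih =>
    intro f hf hper
    obtain ⟨g, hg, hfg⟩ := exists_spatial_deriv hf
    have hgper : ∀ t ∈ Set.Icc (0 : ℝ) 1,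
        Function.Periodic (fun x => g (t, x)) (2 * Real.pi * L) := by
      intro t ht x
      have h1 := (hfg t ht (x + 2 * Real.pi * L)).comp_add_const x (2 * Real.pi * L)
      have h2 : (fun x => f (t, x + 2 * Real.pi * L)) = fun x => f (t, x) :=
        funext fun y => hper t ht y
      rw [h2] at h1
      exact h1.unique (hfg t ht x)
    obtain ⟨C, hC⟩ := ih hg hgper
    refine ⟨C, fun t ht k => ?_⟩
    have hgc : Continuous fun x => g (t, x) :=
      hg.continuousOn.comp_continuous (by fun_prop) fun x => ⟨ht, Set.mem_univ _⟩
    have h1 := hC t ht k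
    rw [hatR_deriv hL (hfg t ht) hgc (hper t ht) k, norm_mul, norm_mul, Complex.norm_I,
      Complex.norm_real, one_mul, Real.norm_eq_abs] at h1
    rw [pow_succ]
    linarith

/-- A summable majorant of the Fourier coefficients. -/
lemma exists_hatR_majorant (hL : 1 ≤ L) {f : ℝ × ℝ → ℝ}
    (hf : ContDiffOn ℝ ∞ f (Set.Icc (0 : ℝ) 1 ×ˢ Set.univ))
    (hper : ∀ t ∈ Set.Icc (0 : ℝ) 1, Function.Periodic (fun x => f (t, x)) (2 * Real.pi * L)) :
    ∃ d : ℤ → ℝ, (Summable fun k : ℤ => (1 + |(k : ℝ)|) * d k) ∧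
      ∀ t ∈ Set.Icc (0 : ℝ) 1, ∀ k, ‖hatR L (fun x => f (t, x)) k‖ ≤ d k := by
  obtain ⟨C₀, hC₀⟩ := exists_freq_pow_mul_hatR_le hL 0 hf hper
  obtain ⟨C₃, hC₃⟩ := exists_freq_pow_mul_hatR_le hL 3 hf hper
  have hL0 : 0 < L := by linarith
  have h00 : (0 : ℝ) ∈ Set.Icc (0 : ℝ) 1 := by simp
  have hC₀0 : 0 ≤ C₀ := le_trans (by positivity) (hC₀ 0 h00 0)
  have hC₃0 : 0 ≤ C₃ := le_trans (by positivity) (hC₃ 0 h00 0)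
  -- Third-order decay leaves `|k|⁻²` after multiplication by `|k|`. At `k = 0` the real power takes
  -- the value `0`, so the bound `C₀` is added there.
  refine ⟨fun k => (if k = 0 then C₀ else 0) + C₃ * L ^ 3 * |(k : ℝ)| ^ (-3 : ℝ), ?_,
    fun t ht k => ?_⟩
  · have h1 : Summable fun k : ℤ => (1 + |(k : ℝ)|) * (if k = 0 then C₀ else 0) :=
      summable_of_ne_finset_zero (s := {0}) fun k hk => by
        rw [if_neg (by simpa using hk), mul_zero]
    have h2 : Summable fun k : ℤ => |(k : ℝ)| ^ (-3 : ℝ) :=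
      Real.summable_abs_int_rpow (by norm_num)
    have h3 : Summable fun k : ℤ => |(k : ℝ)| ^ (-2 : ℝ) :=
      Real.summable_abs_int_rpow (by norm_num)
    refine (h1.add ((h2.add h3).mul_left (C₃ * L ^ 3))).congr fun k => ?_
    have : |(k : ℝ)| * |(k : ℝ)| ^ (-3 : ℝ) = |(k : ℝ)| ^ (-2 : ℝ) := by
      rcases eq_or_ne k 0 with rfl | hk
      · simp
      · have hk' : 0 < |(k : ℝ)| := by positivity
        nth_rewrite 1 [← Real.rpow_one |(k : ℝ)|]
        rw [← Real.rpow_add hk']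
        norm_num
    rw [← this]
    ring
  · rcases eq_or_ne k 0 with rfl | hk
    · have := hC₀ t ht 0
      simp only [pow_zero, one_mul] at this
      simpa using this
    · have hk' : 0 < |(k : ℝ)| := by positivity
      have h := hC₃ t ht k
      rw [freq, abs_div, abs_of_pos hL0, div_pow] at h
      have e : |(k : ℝ)| ^ (-3 : ℝ) = (|(k : ℝ)| ^ 3)⁻¹ := by
        rw [Real.rpow_neg hk'.le]; norm_cast
      beta_reduce
      rw [if_neg hk, zero_add, e, ← div_eq_mul_inv, le_div_iff₀ (by positivity)]
      rw [div_mul_eq_mul_div, div_le_iff₀ (by positivity)] at h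
      linarith

end FourierCoefficients

/-! ### The evolution of `|a(k)|²` and conservation of mass. -/

section EnergyIdentity

variable {a : ℝ → ℤ → ℂ} {d : ℤ → ℝ} {P : ℝ → ℤ → ℝ} {c : ℝ}

lemma norm_cubic_le_tsum {b : ℤ → ℂ} (hd : Summable d) (hb : ∀ k, ‖b k‖ ≤ d k) (k : ℤ) :
    ‖cubic b k‖ ≤ ∑' m : ℤ × ℤ × ℤ, d m.1 * d m.2.1 * d m.2.2 := by
  have hd0 : ∀ k, 0 ≤ d k := fun k => (norm_nonneg _).trans (hb k)
  have hs := summable_triple hd hd hd hd0 hd0 hd0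
  have h1 : ∀ m : nonRes k, ‖b m.1.1 * b m.1.2.1 * b m.1.2.2‖ ≤ d m.1.1 * d m.1.2.1 * d m.1.2.2 :=
    fun m => by
      rw [norm_mul, norm_mul]
      have := hd0 m.1.1
      have := hd0 m.1.2.1
      exact mul_le_mul (mul_le_mul (hb _) (hb _) (norm_nonneg _) (hd0 _)) (hb _) (norm_nonneg _)
        (by positivity)
  refine (tsum_of_norm_bounded (hs.subtype (nonRes k)).hasSum h1).trans ?_
  exact hs.tsum_subtype_le _ _ fun m => by
    have := hd0 m.1
    have := hd0 m.2.1
    have := hd0 m.2.2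
    positivity

lemma continuousOn_cubic {I : Set ℝ} (hd : Summable d) (hd0 : ∀ k, 0 ≤ d k)
    (hb : ∀ t ∈ I, ∀ k, ‖a t k‖ ≤ d k) (hc : ∀ k, ContinuousOn (fun t => a t k) I) (k : ℤ) :
    ContinuousOn (fun t => cubic (a t) k) I := by
  have hs := summable_triple hd hd hd hd0 hd0 hd0
  refine continuousOn_tsum (fun m => ((hc _).mul (hc _)).mul (hc _)) (hs.subtype (nonRes k))
    fun m t ht => ?_
  rw [norm_mul, norm_mul]
  have := hd0 m.1.1
  have := hd0 m.1.2.1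
  exact mul_le_mul (mul_le_mul (hb t ht _) (hb t ht _) (norm_nonneg _) (hd0 _)) (hb t ht _)
    (norm_nonneg _) (by positivity)

/-- A real phase, even a time-dependent one, does not change `|a(k)|²`, so only the non-resonant
cubic term contributes. -/
lemma energy_identity (hd : Summable d)
    (hb : ∀ t ∈ Set.Icc (0 : ℝ) 1, ∀ k, ‖a t k‖ ≤ d k)
    (hconj : ∀ t ∈ Set.Icc (0 : ℝ) 1, ∀ k, a t (-k) = (starRingEnd ℂ) (a t k))
    (hderiv : ∀ t ∈ Set.Icc (0 : ℝ) 1, ∀ k, HasDerivWithinAt (fun τ => a τ k)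
      (Complex.I * (P t k : ℂ) * a t k + Complex.I * ((c * k : ℝ) : ℂ) * cubic (a t) k)
      (Set.Icc (0 : ℝ) 1) t) {t : ℝ} (ht : t ∈ Set.Icc (0 : ℝ) 1) (k : ℤ) :
    ‖a t k‖ ^ 2 - ‖a 0 k‖ ^ 2
      = -2 * c * k * (∫ τ in (0 : ℝ)..t, cubic (a τ) k * a τ (-k)).im := by
  have hd0 : ∀ k, 0 ≤ d k := fun k => (norm_nonneg _).trans (hb 0 (by simp) k)
  have hac : ∀ k, ContinuousOn (fun t => a t k) (Set.Icc (0 : ℝ) 1) :=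
    fun k t ht => (hderiv t ht k).continuousWithinAt
  have hcub : ContinuousOn (fun τ => cubic (a τ) k * a τ (-k)) (Set.Icc (0 : ℝ) 1) :=
    (continuousOn_cubic hd hd0 hb hac k).mul (hac _)
  have hsub : Set.Icc 0 t ⊆ Set.Icc (0 : ℝ) 1 := Set.Icc_subset_Icc_right ht.2
  have hint := Flow.intervalIntegrable hcub ht
  have him : IntervalIntegrable (fun τ => (cubic (a τ) k * a τ (-k)).im) volume 0 t :=
    Flow.intervalIntegrable (Complex.continuous_im.comp_continuousOn hcub) ht
  have hftc := intervalIntegral.integral_eq_sub_of_hasDerivAt_of_le (f := fun τ => ‖a τ k‖ ^ 2)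
    (f' := fun τ => -2 * c * k * (cubic (a τ) k * a τ (-k)).im) ht.1
    (((hac k).mono hsub).norm.pow 2) (fun τ hτ => by
      have hτ' : τ ∈ Set.Icc (0 : ℝ) 1 := hsub ⟨hτ.1.le, hτ.2.le⟩
      have hn : Set.Icc (0 : ℝ) 1 ∈ nhds τ := Icc_mem_nhds hτ.1 (hτ.2.trans_le ht.2)
      refine ((hderiv τ hτ' k).hasDerivAt hn).norm_sq.congr_deriv ?_
      rw [Complex.inner, hconj τ hτ']
      simp only [Complex.mul_re, Complex.mul_im, Complex.add_re, Complex.add_im, Complex.I_re,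
        Complex.I_im, Complex.conj_re, Complex.conj_im, Complex.ofReal_re, Complex.ofReal_im]
      ring) (him.const_mul _)
  rw [intervalIntegral.integral_const_mul] at hftc
  have e : ∫ τ in (0 : ℝ)..t, (cubic (a τ) k * a τ (-k)).im
      = (∫ τ in (0 : ℝ)..t, cubic (a τ) k * a τ (-k)).im :=
    Complex.imCLM.intervalIntegral_comp_comm hint
  rw [← e, hftc]

/-- Conservation of the `ℓ²` norm. -/
lemma mass_conserved (hd : Summable fun k : ℤ => (1 + |(k : ℝ)|) * d k)
    (hb : ∀ t ∈ Set.Icc (0 : ℝ) 1, ∀ k, ‖a t k‖ ≤ d k)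
    (hconj : ∀ t ∈ Set.Icc (0 : ℝ) 1, ∀ k, a t (-k) = (starRingEnd ℂ) (a t k))
    (hderiv : ∀ t ∈ Set.Icc (0 : ℝ) 1, ∀ k, HasDerivWithinAt (fun τ => a τ k)
      (Complex.I * (P t k : ℂ) * a t k + Complex.I * ((c * k : ℝ) : ℂ) * cubic (a t) k)
      (Set.Icc (0 : ℝ) 1) t) {t : ℝ} (ht : t ∈ Set.Icc (0 : ℝ) 1) :
    mass (a t) = mass (a 0) := by
  have hd0 : ∀ k, 0 ≤ d k := fun k => (norm_nonneg _).trans (hb 0 (by simp) k)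
  have hds : Summable d := Summable.of_nonneg_of_le hd0
    (fun k => by nlinarith [hd0 k, abs_nonneg (k : ℝ)]) hd
  have hac : ∀ k, ContinuousOn (fun t => a t k) (Set.Icc (0 : ℝ) 1) :=
    fun k t ht => (hderiv t ht k).continuousWithinAt
  have hsub : Set.uIoc 0 t ⊆ Set.Icc (0 : ℝ) 1 := by
    rw [Set.uIoc_of_le ht.1]
    exact Set.Ioc_subset_Icc_self.trans (Set.Icc_subset_Icc_right ht.2)
  set T := ∑' m : ℤ × ℤ × ℤ, d m.1 * d m.2.1 * d m.2.2 with hT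
  have hT0 : 0 ≤ T := (norm_nonneg _).trans (norm_cubic_le_tsum hds (hb 0 (by simp)) 0)
  set f : ℤ → ℝ → ℂ := fun k τ => (k : ℂ) * (cubic (a τ) k * a τ (-k)) with hf
  have hfc : ∀ k, ContinuousOn (f k) (Set.Icc (0 : ℝ) 1) := fun k =>
    continuousOn_const.mul ((continuousOn_cubic hds hd0 hb hac k).mul (hac _))
  have hQ : Summable fun k : ℤ => T * ((1 + |(k : ℝ)|) * d k) := hd.mul_left T
  have hfQ : ∀ k, ∀ τ ∈ Set.Icc (0 : ℝ) 1, ‖f k τ‖ ≤ T * ((1 + |(k : ℝ)|) * d k) := by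
    intro k τ hτ
    have h1 := norm_cubic_le_tsum hds (hb τ hτ) k
    have h2 := hb τ hτ k
    have h3 := hd0 k
    have h4 := abs_nonneg (k : ℝ)
    rw [hf, norm_mul, norm_mul, norm_neg_eq (hconj τ hτ), Complex.norm_intCast]
    calc |(k : ℝ)| * (‖cubic (a τ) k‖ * ‖a τ k‖) ≤ (1 + |(k : ℝ)|) * (T * d k) := by
          gcongr; linarith
      _ = _ := by ring
  -- The energy identities are summed over `k` in integrated form, which avoids differentiating the
  -- series for the mass.
  have hsum := intervalIntegral.hasSum_integral_of_dominated_convergence (μ := volume) (a := 0)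
    (b := t) (F := f) (f := fun τ => ∑' k, f k τ) (fun k _ => T * ((1 + |(k : ℝ)|) * d k))
    (fun k => ((hfc k).mono hsub).aestronglyMeasurable measurableSet_uIoc)
    (fun k => Filter.Eventually.of_forall fun τ hτ => hfQ k τ (hsub hτ))
    (Filter.Eventually.of_forall fun τ _ => hQ) (by simp)
    (Filter.Eventually.of_forall fun τ hτ =>
      (Summable.of_norm_bounded hQ fun k => hfQ k τ (hsub hτ)).hasSum)
  have hzero : ∫ τ in (0 : ℝ)..t, ∑' k, f k τ = 0 := by
    rw [intervalIntegral.integral_congr_ae (g := fun _ => (0 : ℂ)), intervalIntegral.integral_zero]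
    refine Filter.Eventually.of_forall fun τ hτ => ?_
    refine tsum_cubic_mul_eq_zero (Summable.of_nonneg_of_le (fun k => by positivity) (fun k => ?_) hd)
    exact mul_le_mul_of_nonneg_left (hb τ (hsub hτ) k) (by positivity)
  rw [hzero] at hsum
  have him' := (Complex.imCLM.hasSum hsum).mul_left (-2 * c)
  have hcoef : ∀ k, -2 * c * Complex.imCLM (∫ τ in (0 : ℝ)..t, f k τ)
      = ‖a t k‖ ^ 2 - ‖a 0 k‖ ^ 2 := by
    intro k
    rw [energy_identity hds hb hconj hderiv ht k, hf, intervalIntegral.integral_const_mul,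
      Complex.imCLM_apply, Complex.mul_im, Complex.intCast_re, Complex.intCast_im]
    ring
  have him := him'.congr_fun fun k => (hcoef k).symm
  have h1 := summable_norm_sq (summable_norm_of_le hds (hb t ht))
  have h2 := summable_norm_sq (summable_norm_of_le hds (hb 0 (by simp)))
  have := him.unique (h1.hasSum.sub h2.hasSum)
  simp only [map_zero, mul_zero] at this
  rw [mass, mass]
  linarith

end EnergyIdentity

/-! ### Plancherel in time and the `L²` control contained in the `X^{s,b}` norm. -/

section SpaceTimeNorm

variable {L : ℝ}

lemma one_le_bracket (x : ℝ) : 1 ≤ bracket x := by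
  unfold bracket
  exact Real.one_le_sqrt.2 (by nlinarith [sq_nonneg x])

lemma lintegral_enorm_sq_eq (g : ℝ → ℂ) (μ : Measure ℝ) :
    ∫⁻ t, ‖g t‖ₑ ^ 2 ∂μ = eLpNorm g 2 μ ^ 2 := by
  have := eLpNorm_nnreal_pow_eq_lintegral (μ := μ) (f := g) (p := 2) (by norm_num)
  simp only [NNReal.coe_ofNat, ENNReal.rpow_ofNat, ENNReal.coe_ofNat] at this
  exact this.symm

/-- Plancherel. -/
lemma lintegral_fourierL2 {g : ℝ → ℂ} (hg : MemLp g 2 volume) :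
    ∫⁻ ξ, ‖fourierL2 g ξ‖ₑ ^ 2 = ∫⁻ t, ‖g t‖ₑ ^ 2 := by
  rw [lintegral_enorm_sq_eq, lintegral_enorm_sq_eq, fourierL2, dif_pos hg, ← Lp.enorm_def,
    ← Lp.enorm_toLp hg]
  congr 1
  rw [← ofReal_norm, Lp.norm_fourier_eq, ofReal_norm]

lemma lintegral_comp_div (f : ℝ → ℝ≥0∞) {c : ℝ} (hc : 0 < c) :
    ∫⁻ τ, f (τ / c) = ENNReal.ofReal c * ∫⁻ ξ, f ξ := by
  have h := lintegral_map_equiv (μ := volume) f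
    (Homeomorph.mulLeft₀ c⁻¹ (inv_ne_zero hc.ne')).toMeasurableEquiv
  have e : Measure.map (⇑(Homeomorph.mulLeft₀ c⁻¹ (inv_ne_zero hc.ne')).toMeasurableEquiv) volume
      = ENNReal.ofReal c • (volume : Measure ℝ) := by
    have := Real.map_volume_mul_left (inv_ne_zero hc.ne')
    rw [inv_inv, abs_of_pos hc] at this
    exact this
  rw [e, lintegral_smul_measure, smul_eq_mul] at h
  rw [h]
  refine lintegral_congr fun τ => ?_
  simp [div_eq_inv_mul]

/-- The Fourier coefficients of an element of `L²(ℝ × 𝕋)` are square integrable. -/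
lemma memLp_fourierCoeffT (hL : 1 ≤ L) {u : ℝ → ℝ → ℂ}
    (hu : MemLp (fun q : ℝ × ℝ => u q.1 q.2) 2
      ((volume : Measure (ℝ × ℝ)).restrict (Set.univ ×ˢ Set.Ioc 0 (2 * Real.pi * L)))) (k : ℤ) :
    MemLp (fun t => fourierCoeffT L (u t) k) 2 volume := by
  have hP : 0 < 2 * Real.pi * L := by positivity
  set ν : Measure ℝ := volume.restrict (Set.Ioc 0 (2 * Real.pi * L)) with hν
  have hprod : (volume : Measure (ℝ × ℝ)).restrict (Set.univ ×ˢ Set.Ioc 0 (2 * Real.pi * L))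
      = (volume : Measure ℝ).prod ν := by
    rw [hν, ← Measure.restrict_univ (μ := (volume : Measure ℝ)), Measure.prod_restrict,
      Measure.restrict_univ]
    rfl
  rw [hprod] at hu
  have hcoef : ∀ t, fourierCoeffT L (u t) k
      = ∫ x, Complex.exp (-(Complex.I * (freq L k : ℂ) * (x : ℂ))) * u t x ∂ν := fun t => by
    rw [fourierCoeffT, intervalIntegral.integral_of_le hP.le]
  have hexp : Continuous fun q : ℝ × ℝ =>
      Complex.exp (-(Complex.I * (freq L k : ℂ) * (q.2 : ℂ))) := by fun_prop
  have hmeas : AEStronglyMeasurable (fun q : ℝ × ℝ =>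
      Complex.exp (-(Complex.I * (freq L k : ℂ) * (q.2 : ℂ))) * u q.1 q.2)
      ((volume : Measure ℝ).prod ν) := hexp.aestronglyMeasurable.mul hu.1
  refine ⟨?_, ?_⟩
  · simp_rw [hcoef]
    exact hmeas.integral_prod_right'
  · have hnorm : ∀ x : ℝ, ‖Complex.exp (-(Complex.I * (freq L k : ℂ) * (x : ℂ)))‖ₑ = 1 := fun x => by
      rw [← ofReal_norm,
        show -(Complex.I * (freq L k : ℂ) * (x : ℂ)) = ((-(freq L k * x) : ℝ) : ℂ) * Complex.I by
          push_cast; ring, Complex.norm_exp_ofReal_mul_I, ENNReal.ofReal_one]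
    have hpt : ∀ᵐ t, ‖fourierCoeffT L (u t) k‖ₑ ^ 2
        ≤ (∫⁻ x, ‖u t x‖ₑ ^ 2 ∂ν) * ν Set.univ := by
      filter_upwards [hu.1.prodMk_left] with t ht
      have h1 : ‖fourierCoeffT L (u t) k‖ₑ ≤ eLpNorm (u t) 1 ν := by
        rw [hcoef, eLpNorm_one_eq_lintegral_enorm]
        refine (enorm_integral_le_lintegral_enorm _).trans (le_of_eq ?_)
        refine lintegral_congr fun x => ?_
        rw [enorm_mul, hnorm, one_mul]
      have h2 := eLpNorm_le_eLpNorm_mul_rpow_measure_univ (μ := ν) (p := 1) (q := 2) (by norm_num) ht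
      calc ‖fourierCoeffT L (u t) k‖ₑ ^ 2
          ≤ (eLpNorm (u t) 2 ν * ν Set.univ ^ (1 / (1 : ℝ≥0∞).toReal - 1 / (2 : ℝ≥0∞).toReal)) ^ 2 := by
            gcongr; exact h1.trans h2
        _ = _ := by
            rw [mul_pow, lintegral_enorm_sq_eq, ← ENNReal.rpow_natCast (ν Set.univ ^ _),
              ← ENNReal.rpow_mul]
            norm_num
    have h2 : eLpNorm (fun t => fourierCoeffT L (u t) k) 2 volume ^ 2 < ⊤ := by
      rw [← lintegral_enorm_sq_eq]
      refine (lintegral_mono_ae hpt).trans_lt ?_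
      have hfin : ν Set.univ ≠ ⊤ := by simp [hν]
      rw [lintegral_mul_const' _ _ hfin]
      refine ENNReal.mul_lt_top ?_ hfin.lt_top
      have hae : AEMeasurable (fun q : ℝ × ℝ => ‖u q.1 q.2‖ₑ ^ 2) ((volume : Measure ℝ).prod ν) :=
        hu.1.enorm.pow_const 2
      rw [← lintegral_prod _ hae]
      have := eLpNorm_nnreal_pow_eq_lintegral (μ := (volume : Measure ℝ).prod ν)
        (f := fun q : ℝ × ℝ => u q.1 q.2) (p := 2) (by norm_num)
      simp only [NNReal.coe_ofNat, ENNReal.rpow_ofNat, ENNReal.coe_ofNat] at this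
      rw [← this]
      exact ENNReal.pow_lt_top hu.2
    by_contra hcon
    rw [not_lt, top_le_iff] at hcon
    rw [hcon] at h2
    simp at h2

/-- The prefactor contributes `(2π)⁻²` and the substitution `τ = 2πξ` contributes `2π`. -/
lemma lintegral_spaceTimeFourier (hL : 1 ≤ L) {u : ℝ → ℝ → ℂ}
    (hu : MemLp (fun q : ℝ × ℝ => u q.1 q.2) 2
      ((volume : Measure (ℝ × ℝ)).restrict (Set.univ ×ˢ Set.Ioc 0 (2 * Real.pi * L)))) (k : ℤ) :
    ∫⁻ τ, ‖spaceTimeFourier L u τ k‖ₑ ^ 2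
      = ENNReal.ofReal (1 / (2 * Real.pi)) * ∫⁻ t, ‖fourierCoeffT L (u t) k‖ₑ ^ 2 := by
  have hpi : 0 < 2 * Real.pi := by positivity
  have hc : ‖(((1 / (2 * Real.pi) : ℝ)) : ℂ)‖ₑ = ENNReal.ofReal (1 / (2 * Real.pi)) := by
    rw [← ofReal_norm, Complex.norm_real, Real.norm_of_nonneg (by positivity)]
  simp only [spaceTimeFourier, enorm_mul, mul_pow, hc]
  rw [lintegral_const_mul' _ _ (by simp),
    lintegral_comp_div (fun ξ => ‖fourierL2 (fun t => fourierCoeffT L (u t) k) ξ‖ₑ ^ 2) hpi,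
    lintegral_fourierL2 (memLp_fourierCoeffT hL hu k), ← mul_assoc, sq, mul_assoc (ENNReal.ofReal _),
    ← ENNReal.ofReal_mul (by positivity), one_div_mul_cancel hpi.ne', ENNReal.ofReal_one, mul_one]

/-- For nonnegative exponents the `X^{s,b}` norm controls the `L²` norm on the unit time interval. -/
lemma mass_le_normX (hL : 1 ≤ L) {p : ℤ → ℝ} {s b M : ℝ} (hs : 0 ≤ s) (hb : 0 ≤ b)
    {u : ℝ → ℝ → ℂ} (hu : MemX L p s b u)
    (hM : ∀ t ∈ Set.Icc (0 : ℝ) 1, HasSum (fun k => ‖fourierCoeffT L (u t) k‖ ^ 2) M) :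
    M ≤ 4 * Real.pi ^ 2 * L * (normX L p s b u).toReal ^ 2 := by
  have hL0 : 0 < L := by linarith
  set E : ℝ≥0∞ := ENNReal.ofReal (1 / (2 * Real.pi * L)) * ∑' k : ℤ, ∫⁻ τ : ℝ,
      ENNReal.ofReal (bracket (freq L k) ^ (2 * s) * bracket (τ - p k) ^ (2 * b))
        * ‖spaceTimeFourier L u τ k‖ₑ ^ 2 with hE
  have hN : normX L p s b u ^ 2 = E := by
    rw [normX, ← ENNReal.rpow_natCast, ← ENNReal.rpow_mul]
    rw [show (1 / 2 : ℝ) * ((2 : ℕ) : ℝ) = 1 by norm_num, ENNReal.rpow_one]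
  have hEfin : E ≠ ⊤ := by
    rw [← hN]; exact ENNReal.pow_ne_top hu.finite.ne
  -- The squared `ℓ²` norm equals `M` throughout `[0,1]`, an interval of length `1`, so the time
  -- integral is at least `M`.
  have hlow : ENNReal.ofReal M ≤ ∑' k : ℤ, ∫⁻ t, ‖fourierCoeffT L (u t) k‖ₑ ^ 2 := by
    have hmeas : ∀ k : ℤ, AEMeasurable (fun t => ‖fourierCoeffT L (u t) k‖ₑ ^ 2)
        (volume : Measure ℝ) := fun k => (memLp_fourierCoeffT hL hu.sqIntegrable k).1.enorm.pow_const 2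
    rw [← lintegral_tsum hmeas]
    calc ENNReal.ofReal M = ∫⁻ _ in Set.Icc (0 : ℝ) 1, ENNReal.ofReal M := by simp
      _ ≤ ∫⁻ t in Set.Icc (0 : ℝ) 1, ∑' k : ℤ, ‖fourierCoeffT L (u t) k‖ₑ ^ 2 := by
          refine setLIntegral_mono' measurableSet_Icc fun t ht => ?_
          rw [← (hM t ht).tsum_eq, ENNReal.ofReal_tsum_of_nonneg (fun _ => by positivity)
            (hM t ht).summable]
          refine le_of_eq (tsum_congr fun k => ?_)
          rw [ENNReal.ofReal_pow (norm_nonneg _), ofReal_norm]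
      _ ≤ _ := setLIntegral_le_lintegral _ _
  have hup : ENNReal.ofReal (1 / (2 * Real.pi * L)) * (ENNReal.ofReal (1 / (2 * Real.pi))
      * ENNReal.ofReal M) ≤ E := by
    rw [hE]
    gcongr
    refine (mul_le_mul_right hlow _).trans ?_
    rw [← ENNReal.tsum_mul_left]
    refine ENNReal.tsum_le_tsum fun k => ?_
    rw [← lintegral_spaceTimeFourier hL hu.sqIntegrable]
    refine lintegral_mono fun τ => ?_
    -- Both brackets are at least `1` and both exponents nonnegative, so the weights can be dropped.
    have h1 : 1 ≤ bracket (freq L k) ^ (2 * s) :=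
      Real.one_le_rpow (one_le_bracket _) (by linarith)
    have h2 : 1 ≤ bracket (τ - p k) ^ (2 * b) :=
      Real.one_le_rpow (one_le_bracket _) (by linarith)
    have h3 : (1 : ℝ≥0∞)
        ≤ ENNReal.ofReal (bracket (freq L k) ^ (2 * s) * bracket (τ - p k) ^ (2 * b)) := by
      rw [ENNReal.one_le_ofReal]; nlinarith
    exact le_mul_of_one_le_left bot_le h3
  rw [← ENNReal.ofReal_mul (by positivity), ← ENNReal.ofReal_mul (by positivity), ← hN] at hup
  have h4 := (ENNReal.ofReal_le_iff_le_toReal (by rw [hN]; exact hEfin)).1 hup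
  rw [ENNReal.toReal_pow] at h4
  have h5 : M = 4 * Real.pi ^ 2 * L * (1 / (2 * Real.pi * L) * (1 / (2 * Real.pi) * M)) := by
    field_simp; ring
  rw [h5]
  gcongr

end SpaceTimeNorm

/-! ### Comparison with the stated bound, and verification of the flow hypotheses. -/

section Assembly

lemma logFactor_nonneg {L : ℝ} (hL : 1 ≤ L) : 0 ≤ logFactor L := by
  unfold logFactor
  split_ifs
  · exact zero_le_one
  · exact Real.log_nonneg hL

lemma half_le_logFactor {L : ℝ} (hL : 2 ≤ L) : 1 / 2 ≤ logFactor L := by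
  unfold logFactor
  rw [if_neg (by linarith)]
  have h1 := Real.log_two_gt_d9
  have h2 := Real.log_le_log (by norm_num) hL
  linarith

/-- The bound obtained from the normal form is dominated by `smoothingBound`. -/
lemma le_smoothingBound {L s A B M : ℝ} (hL : 1 ≤ L) (hs : 0 ≤ s) (hM0 : 0 ≤ M)
    (hML : M ≤ 2 * L) (hMB : M ≤ 40 * L * B ^ 2) :
    1 / L ^ 4 * (M ^ 2 * (L ^ (4 / 3 : ℝ) + M ^ 2)) ≤ 5200000 * smoothingBound L s A B := by
  have hL0 : 0 < L := by linarith
  have hM2 : M ^ 2 ≤ 1600 * L ^ 2 * B ^ 4 := by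
    calc M ^ 2 ≤ (40 * L * B ^ 2) ^ 2 := by gcongr
      _ = _ := by ring
  set T₁ := L⁻¹ * logFactor L * (A ^ 4 + (A ^ 2 + L ^ (1 / 2 + 2 * s) * B ^ 4) ^ 2) with hT₁
  set T₂ := L ^ (-(1 / 2) : ℝ) * B ^ 4 with hT₂
  have hT₁0 : 0 ≤ T₁ := by have := logFactor_nonneg hL; positivity
  have hT₂0 : 0 ≤ T₂ := by positivity
  have hT₃0 : 0 ≤ L ^ (-(3 / 2) : ℝ) * B ^ 6 := by positivity
  have hsum : smoothingBound L s A B = T₁ + T₂ + L ^ (-(3 / 2) : ℝ) * B ^ 6 := rfl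
  -- The powers combine to `L^{-2/3}`, which is below the `L^{-1/2}` in front of `B⁴`.
  have h1 : 1 / L ^ 4 * (M ^ 2 * L ^ (4 / 3 : ℝ)) ≤ 1600 * T₂ := by
    have e1 : 1 / L ^ 4 * L ^ 2 * L ^ (4 / 3 : ℝ) = L ^ (-(2 / 3) : ℝ) := by
      rw [one_div, ← Real.rpow_natCast, ← Real.rpow_natCast, ← Real.rpow_neg hL0.le,
        ← Real.rpow_add hL0, ← Real.rpow_add hL0]
      norm_num
    have e2 : L ^ (-(2 / 3) : ℝ) ≤ L ^ (-(1 / 2) : ℝ) :=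
      Real.rpow_le_rpow_of_exponent_le hL (by norm_num)
    calc 1 / L ^ 4 * (M ^ 2 * L ^ (4 / 3 : ℝ))
        ≤ 1 / L ^ 4 * ((1600 * L ^ 2 * B ^ 4) * L ^ (4 / 3 : ℝ)) := by gcongr
      _ = 1600 * (1 / L ^ 4 * L ^ 2 * L ^ (4 / 3 : ℝ) * B ^ 4) := by ring
      _ = 1600 * (L ^ (-(2 / 3) : ℝ) * B ^ 4) := by rw [e1]
      _ ≤ 1600 * (L ^ (-(1 / 2) : ℝ) * B ^ 4) := by gcongr
  have h2 : 1 / L ^ 4 * (M ^ 2 * M ^ 2) ≤ 5120000 * T₁ + 12800 * T₂ := by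
    -- For `L ≥ 2`, `M⁴/L⁴` is at most a multiple of `B⁸`, which the first term of the bound
    -- contains since `(L^{1/2+2s})² ≥ L` and the logarithm is at least `1/2`. For `L` slightly
    -- above `1` the logarithm is arbitrarily small; there one factor `M²` is bounded by `4L²`,
    -- which leaves `B⁴`.
    rcases le_total 2 L with h | h
    · have hlog := half_le_logFactor h
      have e1 : L ≤ (L ^ (1 / 2 + 2 * s)) ^ 2 := by
        rw [← Real.rpow_natCast, ← Real.rpow_mul hL0.le]
        calc L = L ^ (1 : ℝ) := (Real.rpow_one L).symm
          _ ≤ _ := Real.rpow_le_rpow_of_exponent_le hL (by push_cast; linarith)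
      have e2 : L * B ^ 8 ≤ A ^ 4 + (A ^ 2 + L ^ (1 / 2 + 2 * s) * B ^ 4) ^ 2 := by
        have hq : 0 ≤ A ^ 2 * (L ^ (1 / 2 + 2 * s) * B ^ 4) := by positivity
        have hq2 : L * B ^ 8 ≤ (L ^ (1 / 2 + 2 * s) * B ^ 4) ^ 2 := by
          calc L * B ^ 8 ≤ (L ^ (1 / 2 + 2 * s)) ^ 2 * B ^ 8 := by gcongr
            _ = _ := by ring
        nlinarith [sq_nonneg (A ^ 2)]
      have e3 : B ^ 8 ≤ 2 * T₁ := by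
        calc B ^ 8 = 2 * (L⁻¹ * (1 / 2) * (L * B ^ 8)) := by field_simp
          _ ≤ 2 * (L⁻¹ * logFactor L * (A ^ 4 + (A ^ 2 + L ^ (1 / 2 + 2 * s) * B ^ 4) ^ 2)) := by
            gcongr
          _ = 2 * T₁ := rfl
      calc 1 / L ^ 4 * (M ^ 2 * M ^ 2)
          ≤ 1 / L ^ 4 * ((1600 * L ^ 2 * B ^ 4) * (1600 * L ^ 2 * B ^ 4)) := by gcongr
        _ = 2560000 * B ^ 8 := by field_simp; ring
        _ ≤ _ := by linarith
    · have e1 : 1 / 2 ≤ L ^ (-(1 / 2) : ℝ) := by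
        calc (1 / 2 : ℝ) ≤ L⁻¹ := by
              rw [one_div]; exact inv_anti₀ hL0 h
          _ = L ^ (-1 : ℝ) := (Real.rpow_neg_one L).symm
          _ ≤ _ := Real.rpow_le_rpow_of_exponent_le hL (by norm_num)
      have e2 : B ^ 4 ≤ 2 * T₂ := by
        calc B ^ 4 = 2 * (1 / 2 * B ^ 4) := by ring
          _ ≤ 2 * (L ^ (-(1 / 2) : ℝ) * B ^ 4) := by gcongr
      calc 1 / L ^ 4 * (M ^ 2 * M ^ 2)
          ≤ 1 / L ^ 4 * ((2 * L) ^ 2 * (1600 * L ^ 2 * B ^ 4)) := by gcongr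
        _ = 6400 * B ^ 4 := by field_simp; ring
        _ ≤ _ := by linarith
  rw [hsum, mul_add (M ^ 2), mul_add (1 / L ^ 4)]
  linarith

variable {β γ μ L : ℝ} {u₀ : ℝ → ℝ} {u : ℝ → ℝ → ℝ}

/-- The phase of the equation, including the resonant self-interaction. -/
noncomputable def fullPhase (β γ μ L : ℝ) (u₀ : ℝ → ℝ) (u : ℝ → ℝ → ℝ) (t : ℝ) (k : ℤ) : ℝ :=
  dispersion β γ μ L u₀ k
    - μ * freq L k / (2 * Real.pi * L) ^ 2 * (‖hatR L (u t) k‖ ^ 2 - ‖hatR L u₀ k‖ ^ 2)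

/-- The forcing term in `a' = i p a + F` for the Fourier coefficients `a` of a solution. -/
noncomputable def forcing (μ L : ℝ) (u₀ : ℝ → ℝ) (u : ℝ → ℝ → ℝ) (t : ℝ) (k : ℤ) : ℂ :=
  -((μ * freq L k / (2 * Real.pi * L) ^ 2
      * (‖hatR L (u t) k‖ ^ 2 - ‖hatR L u₀ k‖ ^ 2) : ℝ) : ℂ) * Complex.I * hatR L (u t) k
    + ((μ / (3 * (2 * Real.pi * L) ^ 2) * freq L k : ℝ) : ℂ) * Complex.I * cubic (hatR L (u t)) k

/-- The resonant self-interaction is a real multiple of `i a(k)` and may be counted in the phase.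
This is the form suited to the energy identity. -/
lemma IsSmoothSolution.hasDeriv_fullPhase (h : IsSmoothSolution β γ μ L u₀ u) {t : ℝ}
    (ht : t ∈ Set.Icc (0 : ℝ) 1) (k : ℤ) :
    HasDerivWithinAt (fun τ => hatR L (u τ) k)
      (Complex.I * (fullPhase β γ μ L u₀ u t k : ℂ) * hatR L (u t) k
        + Complex.I * ((μ / (3 * (2 * Real.pi * L) ^ 2 * L) * k : ℝ) : ℂ) * cubic (hatR L (u t)) k)
      (Set.Icc (0 : ℝ) 1) t := by
  refine (h.eqn t ht k).congr_deriv ?_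
  have hc : cubicSum L (u t) k = cubic (hatR L (u t)) k := rfl
  rw [hc, fullPhase, freq]
  push_cast
  ring

/-- Integration by parts needs a phase independent of time, so here the resonant self-interaction is
counted in the forcing. -/
lemma IsSmoothSolution.hasDeriv_forcing (h : IsSmoothSolution β γ μ L u₀ u) {t : ℝ}
    (ht : t ∈ Set.Icc (0 : ℝ) 1) (k : ℤ) :
    HasDerivWithinAt (fun τ => hatR L (u τ) k)
      (Complex.I * (dispersion β γ μ L u₀ k : ℂ) * hatR L (u t) k + forcing μ L u₀ u t k)
      (Set.Icc (0 : ℝ) 1) t := by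
  refine (h.eqn t ht k).congr_deriv ?_
  have hc : cubicSum L (u t) k = cubic (hatR L (u t)) k := rfl
  rw [hc, forcing]
  push_cast
  ring

/-- The resonant term is at most `M|a(k)|`, hence at most `√M ‖a * a‖` by `mass_sq_le_quartic`, and
the cubic sum is at most four times that. The total `1 + 4/3 = 7/3` is absorbed by `(2π)²`. -/
lemma norm_forcing_le (hμ : |μ| = 1) (hL : 1 ≤ L) {t : ℝ} {M : ℝ}
    (h₀ : Summable fun k => ‖hatR L u₀ k‖) (hm₀ : mass (hatR L u₀) = M)
    (h₁ : Summable fun k => ‖hatR L (u t) k‖) (hm₁ : mass (hatR L (u t)) = M) (k : ℤ) :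
    ‖forcing μ L u₀ u t k‖
      ≤ |freq L k| * ((L ^ 2)⁻¹ * √M * √(quartic (hatR L (u t)))) := by
  have hL0 : 0 < L := by linarith
  have hM : 0 ≤ M := hm₁ ▸ mass_nonneg _
  set q := √(quartic (hatR L (u t))) with hq
  have hMq : M ≤ q := by
    refine Real.le_sqrt_of_sq_le ?_
    have := mass_sq_le_quartic h₁ (hatR_neg L (u t))
    rwa [hm₁] at this
  have hq0 : 0 ≤ q := Real.sqrt_nonneg _
  have ha := norm_le_sqrt_mass h₁ k
  have hs₁ := norm_sq_le_mass h₁ k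
  have hs₀ := norm_sq_le_mass h₀ k
  rw [hm₁] at ha hs₁
  rw [hm₀] at hs₀
  have hdiff : |‖hatR L (u t) k‖ ^ 2 - ‖hatR L u₀ k‖ ^ 2| ≤ M := by
    rw [abs_le]
    constructor <;> nlinarith [sq_nonneg ‖hatR L (u t) k‖, sq_nonneg ‖hatR L u₀ k‖]
  have hcub := norm_cubic_le h₁ (hatR_neg L (u t)) k
  rw [hm₁, ← hq] at hcub
  have hX : M * ‖hatR L (u t) k‖ ≤ √M * q := by
    rw [mul_comm]
    exact mul_le_mul ha hMq hM (Real.sqrt_nonneg _)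
  have hn1 : ‖-((μ * freq L k / (2 * Real.pi * L) ^ 2
      * (‖hatR L (u t) k‖ ^ 2 - ‖hatR L u₀ k‖ ^ 2) : ℝ) : ℂ) * Complex.I * hatR L (u t) k‖
      ≤ |freq L k| * ((2 * Real.pi * L) ^ 2)⁻¹ * (√M * q) := by
    rw [norm_mul, norm_mul, norm_neg, Complex.norm_I, mul_one, Complex.norm_real, Real.norm_eq_abs,
      abs_mul, abs_div, abs_mul, hμ, one_mul, abs_of_pos (by positivity : 0 < (2 * Real.pi * L) ^ 2)]
    calc |freq L k| / (2 * Real.pi * L) ^ 2 * |‖hatR L (u t) k‖ ^ 2 - ‖hatR L u₀ k‖ ^ 2|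
          * ‖hatR L (u t) k‖
        ≤ |freq L k| / (2 * Real.pi * L) ^ 2 * M * ‖hatR L (u t) k‖ := by gcongr
      _ = |freq L k| * ((2 * Real.pi * L) ^ 2)⁻¹ * (M * ‖hatR L (u t) k‖) := by ring
      _ ≤ _ := by gcongr
  have hn2 : ‖((μ / (3 * (2 * Real.pi * L) ^ 2) * freq L k : ℝ) : ℂ) * Complex.I
      * cubic (hatR L (u t)) k‖ ≤ |freq L k| * ((2 * Real.pi * L) ^ 2)⁻¹ * (4 / 3 * (√M * q)) := by
    rw [norm_mul, norm_mul, Complex.norm_I, mul_one, Complex.norm_real, Real.norm_eq_abs,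
      abs_mul, abs_div, hμ, abs_of_pos (by positivity : 0 < 3 * (2 * Real.pi * L) ^ 2)]
    calc 1 / (3 * (2 * Real.pi * L) ^ 2) * |freq L k| * ‖cubic (hatR L (u t)) k‖
        ≤ 1 / (3 * (2 * Real.pi * L) ^ 2) * |freq L k| * (4 * (√M * q)) := by
          gcongr; linarith
      _ = _ := by field_simp
  have hpi : 3 ≤ (2 * Real.pi) ^ 2 := by nlinarith [Real.pi_gt_three]
  have hfin : ((2 * Real.pi * L) ^ 2)⁻¹ * (7 / 3) ≤ (L ^ 2)⁻¹ := by
    rw [mul_pow, mul_inv]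
    have : ((2 * Real.pi) ^ 2)⁻¹ ≤ 3⁻¹ := inv_anti₀ (by norm_num) hpi
    have hLi : 0 < (L ^ 2)⁻¹ := by positivity
    nlinarith
  refine (norm_add_le _ _).trans ((add_le_add hn1 hn2).trans ?_)
  calc |freq L k| * ((2 * Real.pi * L) ^ 2)⁻¹ * (√M * q)
        + |freq L k| * ((2 * Real.pi * L) ^ 2)⁻¹ * (4 / 3 * (√M * q))
      = |freq L k| * (((2 * Real.pi * L) ^ 2)⁻¹ * (7 / 3)) * (√M * q) := by ring
    _ ≤ |freq L k| * (L ^ 2)⁻¹ * (√M * q) := by gcongr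
    _ = _ := by ring

/-- The data-dependent term of the dispersion relation is a small perturbation. -/
lemma abs_dispersion_sub_le (hμ : |μ| = 1) (hL : 1 ≤ L)
    (h₀ : Summable fun k => ‖hatR L u₀ k‖) (hM : mass (hatR L u₀) ≤ Real.pi / 2 * L) (k : ℤ) :
    |dispersion β γ μ L u₀ k - (freq L k ^ 5 + β * (L ^ 2)⁻¹ * freq L k ^ 3
      - (γ + μ / (2 * Real.pi * L) * normL2 L u₀ ^ 2) * freq L k)| ≤ |freq L k| / (24 * L) := by
  have hL0 : 0 < L := by linarith
  have e : dispersion β γ μ L u₀ k - (freq L k ^ 5 + β * (L ^ 2)⁻¹ * freq L k ^ 3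
      - (γ + μ / (2 * Real.pi * L) * normL2 L u₀ ^ 2) * freq L k)
      = -(μ * freq L k / (2 * Real.pi * L) ^ 2 * ‖hatR L u₀ k‖ ^ 2) := by
    rw [dispersion]; ring
  rw [e, abs_neg, abs_mul, abs_div, abs_mul, hμ, one_mul, abs_of_nonneg (sq_nonneg ‖hatR L u₀ k‖),
    abs_of_pos (by positivity : 0 < (2 * Real.pi * L) ^ 2)]
  have h1 := (norm_sq_le_mass h₀ k).trans hM
  -- Numerically, `(π/2)/(2π)² = 1/(8π)`, which is below `1/24`.
  calc |freq L k| / (2 * Real.pi * L) ^ 2 * ‖hatR L u₀ k‖ ^ 2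
      ≤ |freq L k| / (2 * Real.pi * L) ^ 2 * (Real.pi / 2 * L) := by gcongr
    _ = |freq L k| / (8 * Real.pi * L) := by field_simp; ring
    _ ≤ |freq L k| / (24 * L) := by
        gcongr
        linarith [Real.pi_gt_three]

end Assembly

end Kawahara

/-! ### The proposition. -/

theorem proposition4p1 (β μ : ℝ) (hβ : 0 ≤ β) (hμ : μ = 1 ∨ μ = -1) :
    ∃ ρ : ℝ, 0 < ρ ∧ ∀ s : ℝ, 0 ≤ s → s < 1 / 2 → ∃ C : ℝ, 0 < C ∧
      ∀ (γ L : ℝ), 1 ≤ L →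
      ∀ (u₀ : ℝ → ℝ) (u : ℝ → ℝ → ℝ),
        ContDiff ℝ ∞ u₀ → Function.Periodic u₀ (2 * Real.pi * L) →
        Kawahara.normL2 L u₀ ≤ ρ →
        Kawahara.IsSmoothSolution β γ μ L u₀ u →
        Kawahara.MemX L (Kawahara.dispersion β γ μ L u₀) s (1 / 2) (fun t x => (u t x : ℂ)) →
        ∀ t ∈ Set.Icc (0 : ℝ) 1, ∀ k : ℤ,
          (∀ τ ∈ Set.Icc (0 : ℝ) 1,
            Summable (fun m : Kawahara.nonRes k => Kawahara.tripleProd L (u τ) m)) ∧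
          IntervalIntegrable (fun τ : ℝ => (Kawahara.freq L k : ℂ) ^ 2 *
            (Kawahara.cubicSum L (u τ) k * Kawahara.hatR L (u τ) (-k))) volume 0 t ∧
          |1 / L ^ 4 * (∫ τ in (0 : ℝ)..t, (Kawahara.freq L k : ℂ) ^ 2 *
              (Kawahara.cubicSum L (u τ) k * Kawahara.hatR L (u τ) (-k))).im|
            ≤ C * Kawahara.smoothingBound L s (Kawahara.normHs L s u₀)
                (Kawahara.normX L (Kawahara.dispersion β γ μ L u₀) s (1 / 2)
                  (fun t x => (u t x : ℂ))).toReal ∧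
          1 / L ^ 2 * (|Kawahara.freq L k| *
              |‖Kawahara.hatR L (u t) k‖ ^ 2 - ‖Kawahara.hatR L u₀ k‖ ^ 2|)
            ≤ C * Kawahara.smoothingBound L s (Kawahara.normHs L s u₀)
                (Kawahara.normX L (Kawahara.dispersion β γ μ L u₀) s (1 / 2)
                  (fun t x => (u t x : ℂ))).toReal := by
  obtain ⟨C₀, hC₀, hmain⟩ := Kawahara.Flow.exists_norm_integral_cubic_le
  -- With `ρ = 1/2`, Parseval gives `M = 2πL‖u₀‖² ≤ πL/2`, the smallness required in
  -- `abs_dispersion_sub_le`.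
  refine ⟨1 / 2, by norm_num, fun s hs _ => ⟨C₀ * 5200000, by positivity, ?_⟩⟩
  intro γ L hL u₀ u hu₀ _ hρ hsol hX t ht k
  have hL0 : 0 < L := by linarith
  have hμ1 : |μ| = 1 := by rcases hμ with rfl | rfl <;> norm_num
  have h0 : (0 : ℝ) ∈ Set.Icc (0 : ℝ) 1 := by simp
  have hper : ∀ t, Function.Periodic (u t) (2 * Real.pi * L) := fun t x => by
    have := hX.periodic t x
    exact_mod_cast this
  obtain ⟨d, hd, hb⟩ := Kawahara.exists_hatR_majorant hL hsol.smooth fun t _ => hper t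
  have hd0 : ∀ k, 0 ≤ d k := fun k => (norm_nonneg _).trans (hb 0 h0 k)
  have hds : Summable d := Summable.of_nonneg_of_le hd0
    (fun k => by nlinarith [hd0 k, abs_nonneg (k : ℝ)]) hd
  set a : ℝ → ℤ → ℂ := fun t => Kawahara.hatR L (u t) with ha
  have hconj : ∀ t ∈ Set.Icc (0 : ℝ) 1, ∀ k, a t (-k) = (starRingEnd ℂ) (a t k) :=
    fun t _ k => Kawahara.hatR_neg L (u t) k
  have hsum : ∀ t ∈ Set.Icc (0 : ℝ) 1, Summable fun k => ‖a t k‖ := fun t ht =>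
    Kawahara.summable_norm_of_le hds (hb t ht)
  have hmass : ∀ t ∈ Set.Icc (0 : ℝ) 1, Kawahara.mass (a t) = Kawahara.mass (a 0) := fun t ht =>
    Kawahara.mass_conserved hd hb hconj (fun t ht k => hsol.hasDeriv_fullPhase ht k) ht
  set M := Kawahara.mass (a 0) with hM
  have hM0 : 0 ≤ M := Kawahara.mass_nonneg _
  have hu0 : Kawahara.hatR L u₀ = a 0 := by rw [← hsol.init]
  have hMρ : M ≤ Real.pi / 2 * L := by
    have h1 := (Kawahara.hasSum_norm_sq_hatR hL hu₀.continuous).tsum_eq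
    rw [hu0] at h1
    have h2 : M = 2 * Real.pi * L * Kawahara.normL2 L u₀ ^ 2 := h1
    have h3 : Kawahara.normL2 L u₀ ^ 2 ≤ (1 / 2) ^ 2 := by
      have : 0 ≤ Kawahara.normL2 L u₀ := Real.sqrt_nonneg _
      gcongr
    calc M = 2 * Real.pi * L * Kawahara.normL2 L u₀ ^ 2 := h2
      _ ≤ 2 * Real.pi * L * (1 / 2) ^ 2 := by gcongr
      _ = _ := by ring
  have hac : ∀ k, ContinuousOn (fun t => a t k) (Set.Icc (0 : ℝ) 1) :=
    fun k t ht => (hsol.eqn t ht k).continuousWithinAt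
  have hcub : ∀ k, ContinuousOn (fun t => Kawahara.cubic (a t) k) (Set.Icc (0 : ℝ) 1) :=
    Kawahara.continuousOn_cubic hds hd0 hb hac
  have hflow : Kawahara.Flow L (Kawahara.dispersion β γ μ L u₀) a
      (Kawahara.forcing μ L u₀ u) d M := by
    refine ⟨hL, hconj, hds, hb, fun t ht k => hsol.hasDeriv_forcing ht k, fun k => ?_, hmass,
      fun t ht k => Kawahara.norm_forcing_le hμ1 hL (hu0 ▸ hsum 0 h0) (by rw [hu0]) (hsum t ht)
        (hmass t ht) k,
      fun m hm => Kawahara.resWeight_le hL hβ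
        (Kawahara.abs_dispersion_sub_le hμ1 hL (hu0 ▸ hsum 0 h0) (by rw [hu0]; exact hMρ)) hm⟩
    unfold Kawahara.forcing
    refine ContinuousOn.add (ContinuousOn.mul (ContinuousOn.mul ?_ continuousOn_const) (hac k))
      (continuousOn_const.mul (hcub k))
    refine (Complex.continuous_ofReal.comp_continuousOn ?_).neg
    exact continuousOn_const.mul (((hac k).norm.pow 2).sub continuousOn_const)
  have hcq : ContinuousOn (fun τ : ℝ => (Kawahara.freq L k : ℂ) ^ 2 *
      (Kawahara.cubic (a τ) k * a τ (-k))) (Set.Icc (0 : ℝ) 1) :=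
    continuousOn_const.mul ((hcub k).mul (hac _))
  set B := (Kawahara.normX L (Kawahara.dispersion β γ μ L u₀) s (1 / 2)
    (fun t x => (u t x : ℂ))).toReal with hB
  have hMB : M ≤ 40 * L * B ^ 2 := by
    have h1 := Kawahara.mass_le_normX (M := M) hL hs (by norm_num) hX fun t ht => by
      rw [← hmass t ht]
      exact (Kawahara.summable_norm_sq (hsum t ht)).hasSum
    have h2 : 4 * Real.pi ^ 2 ≤ 40 := by
      nlinarith [Real.pi_lt_d2, Real.pi_gt_three]
    calc M ≤ 4 * Real.pi ^ 2 * L * B ^ 2 := h1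
      _ ≤ 40 * L * B ^ 2 := by gcongr
  have hML : M ≤ 2 * L := by
    refine hMρ.trans ?_
    gcongr
    linarith [Real.pi_lt_four]
  have hbound := Kawahara.le_smoothingBound (s := s) (A := Kawahara.normHs L s u₀) hL hs hM0
    hML hMB
  set J : ℂ := ∫ τ in (0 : ℝ)..t, (Kawahara.freq L k : ℂ) ^ 2 *
    (Kawahara.cubic (a τ) k * a τ (-k)) with hJ
  have hest : |1 / L ^ 4 * J.im|
      ≤ C₀ * 5200000 * Kawahara.smoothingBound L s (Kawahara.normHs L s u₀) B := by
    rw [abs_mul, abs_of_pos (by positivity : 0 < 1 / L ^ 4)]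
    calc 1 / L ^ 4 * |J.im| ≤ 1 / L ^ 4 * (C₀ * (M ^ 2 * (L ^ (4 / 3 : ℝ) + M ^ 2))) := by
          gcongr
          exact (Complex.abs_im_le_norm J).trans (hmain hflow k t ht)
      _ = C₀ * (1 / L ^ 4 * (M ^ 2 * (L ^ (4 / 3 : ℝ) + M ^ 2))) := by ring
      _ ≤ C₀ * (5200000 * Kawahara.smoothingBound L s (Kawahara.normHs L s u₀) B) := by gcongr
      _ = _ := by ring
  refine ⟨fun τ hτ => ?_, Kawahara.Flow.intervalIntegrable hcq ht, hest, le_trans ?_ hest⟩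
  · have h1 := Kawahara.summable_triple (hsum τ hτ) (hsum τ hτ) (hsum τ hτ)
      (fun _ => norm_nonneg _) (fun _ => norm_nonneg _) (fun _ => norm_nonneg _)
    refine Summable.of_norm ((h1.subtype (Kawahara.nonRes k)).congr fun m => ?_)
    simp only [Kawahara.tripleProd, norm_mul, Function.comp_apply, ha]
  · have hen := Kawahara.energy_identity hds hb hconj
      (fun t ht k => hsol.hasDeriv_fullPhase ht k) ht k
    have hJ' : J.im = Kawahara.freq L k ^ 2
        * (∫ τ in (0 : ℝ)..t, Kawahara.cubic (a τ) k * a τ (-k)).im := by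
      rw [hJ, intervalIntegral.integral_const_mul, ← Complex.ofReal_pow, Complex.im_ofReal_mul]
    change 1 / L ^ 2 * (|Kawahara.freq L k| * |‖a t k‖ ^ 2 - ‖Kawahara.hatR L u₀ k‖ ^ 2|) ≤ _
    rw [hu0, hen, hJ']
    set X := (∫ τ in (0 : ℝ)..t, Kawahara.cubic (a τ) k * a τ (-k)).im
    -- The energy identity has the coefficient `-μ n/(6π²L²)`, so the second quantity is the first
    -- divided by `6π²`.
    have hk : -2 * (μ / (3 * (2 * Real.pi * L) ^ 2 * L)) * (k : ℝ) * X
        = -(μ * (1 / (6 * (Real.pi * L) ^ 2) * (Kawahara.freq L k * X))) := by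
      unfold Kawahara.freq
      field_simp
      ring
    rw [hk, abs_neg, abs_mul μ, hμ1, one_mul, abs_mul, abs_mul, abs_mul, abs_mul, abs_pow,
      abs_of_pos (by positivity : 0 < 1 / (6 * (Real.pi * L) ^ 2)),
      abs_of_pos (by positivity : 0 < 1 / L ^ 4)]
    have h6 : (1 : ℝ) ≤ 6 * Real.pi ^ 2 := by nlinarith [Real.pi_gt_three]
    calc 1 / L ^ 2 * (|Kawahara.freq L k| *
          (1 / (6 * (Real.pi * L) ^ 2) * (|Kawahara.freq L k| * |X|)))
        = 1 / (6 * Real.pi ^ 2) * (1 / L ^ 4 * (|Kawahara.freq L k| ^ 2 * |X|)) := by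
          field_simp
      _ ≤ 1 * (1 / L ^ 4 * (|Kawahara.freq L k| ^ 2 * |X|)) := by
          gcongr
          exact (div_le_one (by positivity)).2 h6
      _ = _ := one_mul _
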